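/- Let $\mathbb T=\mathbb R/\mathbb Z$, $\mathbb T^2=\mathbb R^2/\mathbb Z^2$ with coordinates $(q^1,q^2)$, let $g$ be a smooth Riemannian metric and $\sigma$ a smooth 2-form on $\mathbb T^2$ (oriented by $dq^1\wedge dq^2$). Let $\mathcal M=H^1(\mathbb T,\mathbb T^2)\times(0,\infty)$ be the Hilbert manifold of $H^1$-loops $\gamma=(x,T)$ with arbitrary period, $\gamma(t)=x(t/T)$. For $(a,b)\in\mathbb Z^2$ let $\mathcal M(a,b)\subset\mathcal M$ be the set of loops having a continuous lift $\tilde\gamma$ to $\mathbb R^2$ with $\tilde\gamma(T)=(a,b)+\tilde\gamma(0)$, and, for a fixed period $T>0$, let $\phi_{(a,b)}:\mathbb T^2\to\mathcal M(a,b)$, $\phi_{(a,b)}(q)=q+\gamma_{(a,b)}$, where $\gamma_{(a,b)}$ is the projection of $t\mapsto(ta/T,tb/T)$. Let $\bar\sigma=dq^1\wedge dq^2$ and define 1-forms on $\mathcal M$ by $$\tau_\gamma=\int_0^T\bar\sigma_{\gamma(t)}(\,\cdot\,,\dot\gamma(t))\,dt,\qquad \eta_k(x,T)=d\mathbb A_k(x,T)+\int_0^1\sigma_{x(s)}(\,\cdot\,,x'(s))\,ds,$$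 where $k>0$ and $\mathbb A_k(x,T)=T\int_0^1\big(\tfrac1{2T^2}|x'(s)|_g^2+k\big)\,ds$. Then: (0) $\tau$ and, for every $k>0$, $\eta_k$ are smooth closed 1-forms on $\mathcal M$, and $\phi_{(a,b)}$ is smooth. (i) For every $(a,b)\in\mathbb Z^2$ and every period $T>0$, $[\phi_{(a,b)}^*\tau]=-[\imath_{(a,b)}\bar\sigma]=[\,b\,dq^1-a\,dq^2\,]\in H^1(\mathbb T^2,\mathbb R)$, and the restricted class $[\tau]|_{\mathcal M(a,b)}$ is trivial if and only if $(a,b)=(0,0)$. (ii) For every $\gamma\in\mathcal M$ (in particular for every closed magnetic geodesic) there is a point $q\in\mathbb T^2\setminus\gamma(\mathbb R)$, and for every such $q$ the set $\mathcal V^\gamma$ of all loops in $\mathcal M$ with image in $\mathbb T^2\setminus\{q\}$ is open, contains all rotations $\psi\cdot\gamma^n$ of all iterates $\gamma^n$, $n\ge1$, and the class $[\tau]|_{\mathcal V^\gamma}$ is trivial. (iii) For every $k>0$, $(a,b)\in\mathbb Z^2$ and every period $T>0$, $[\phi_{(a,b)}^*\eta_k]=\big(\int_{\mathbb T^2}\sigma\big)\,[\,b\,dq^1-a\,dq^2\,]\in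 H^1(\mathbb T^2,\mathbb R)$, and the group of periods $[\eta_k]\big(H_1(\mathcal M(a,b),\mathbb Z)\big)$ is a discrete subgroup of $\mathbb R$. -/

import Mathlib

open scoped Manifold ContDiff Topology
open MeasureTheory Set

namespace MagneticTorus

noncomputable section

/-! ### Manifolds whose charts are translations -/

section Charts

variable {E X : Type*} [NormedAddCommGroup E] [NormedSpace ℝ E]
  [AddCommGroup X] [TopologicalSpace X] [IsTopologicalAddGroup X]

set_option linter.unusedSectionVars false in
theorem isLocalHomeomorph_translate (p : E →+ X) (hp : IsLocalHomeomorph p) (x : X) :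
    IsLocalHomeomorph (fun e : E => x + p e) :=
  (Homeomorph.addLeft x).isLocalHomeomorph.comp hp

/-- A restriction of `e ↦ x + p e` to an open neighbourhood of `0` on which it is a homeomorphism
onto an open subset of `X`. -/
def translateParam (p : E →+ X) (hp : IsLocalHomeomorph p) (x : X) : OpenPartialHomeomorph E X :=
  (isLocalHomeomorph_translate p hp x 0).choose

theorem zero_mem_translateParam (p : E →+ X) (hp : IsLocalHomeomorph p) (x : X) :
    (0 : E) ∈ (translateParam p hp x).source :=
  (isLocalHomeomorph_translate p hp x 0).choose_spec.1

theorem translateParam_apply (p : E →+ X) (hp : IsLocalHomeomorph p) (x : X) (e : E) :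
    translateParam p hp x e = x + p e :=
  (congrFun (isLocalHomeomorph_translate p hp x 0).choose_spec.2 e).symm

/-- The atlas given by a homomorphism `p : E → X` that is a local homeomorphism: the chart at `x`
is the local inverse of `e ↦ x + p e`. -/
@[reducible]
def translationCharts (p : E →+ X) (hp : IsLocalHomeomorph p) : ChartedSpace E X where
  atlas := range fun x => (translateParam p hp x).symm
  chartAt x := (translateParam p hp x).symm
  mem_chart_source x := by
    have h := (translateParam p hp x).map_source (zero_mem_translateParam p hp x)
    simpa [translateParam_apply] using h
  chart_mem_atlas x := ⟨x, rfl⟩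

/-- The coordinate changes of this atlas are locally translations, so the atlas is smooth. -/
theorem isManifold_translationCharts (p : E →+ X) (hp : IsLocalHomeomorph p) :
    @IsManifold ℝ _ E _ _ E _ 𝓘(ℝ, E) ∞ X _ (translationCharts p hp) := by
  let _ := translationCharts p hp
  refine isManifold_of_contDiffOn 𝓘(ℝ, E) ∞ X ?_
  rintro _ _ ⟨x, rfl⟩ ⟨y, rfl⟩
  simp only [modelWithCornersSelf_coe, modelWithCornersSelf_coe_symm, Function.comp_id,
    Function.id_comp, preimage_id, range_id, inter_univ, OpenPartialHomeomorph.symm_symm]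
  intro e he
  apply ContDiffAt.contDiffWithinAt
  set P := translateParam p hp x
  set Q := translateParam p hp y
  have hs : e ∈ P.source ∧ P e ∈ Q.target := by
    simpa [OpenPartialHomeomorph.trans_source] using he
  set e' := Q.symm (P e)
  have he' : e' ∈ Q.source := Q.map_target hs.2
  have hQ : Q e' = P e := Q.right_inv hs.2
  have hev : ∀ᶠ z in 𝓝 e, (P.trans Q.symm) z = e' + (z - e) := by
    have hc : Filter.Tendsto (fun z : E => e' + (z - e)) (𝓝 e) (𝓝 e') := by
      have : Continuous (fun z : E => e' + (z - e)) := by fun_prop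
      simpa using this.tendsto e
    filter_upwards [hc.eventually (Q.open_source.mem_nhds he')] with z hz
    have h1 : Q (e' + (z - e)) = P z := by
      have hQ' : y + p e' = x + p e := by
        simpa [P, Q, translateParam_apply] using hQ
      simp only [P, Q, translateParam_apply, map_add, map_sub]
      rw [← add_assoc, hQ']; abel
    change Q.symm (P z) = _
    rw [← h1, Q.left_inv hz]
  have : ContDiffAt ℝ ∞ (fun z : E => e' + (z - e)) e := by fun_prop
  exact this.congr_of_eventuallyEq hev

end Charts

/-! ### The torus -/

abbrev Plane : Type := ℝ × ℝ

abbrev Torus : Type := UnitAddCircle × UnitAddCircle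

/-- The projection `ℝ² → 𝕋² = ℝ²/ℤ²`. -/
def proj : Plane →+ Torus where
  toFun v := ((v.1 : UnitAddCircle), (v.2 : UnitAddCircle))
  map_zero' := by simp
  map_add' v w := by simp

theorem isLocalHomeomorph_coe_circle :
    IsLocalHomeomorph ((↑) : ℝ → UnitAddCircle) :=
  AddCircle.isLocalHomeomorph_coe (1 : ℝ)

theorem isLocalHomeomorph_prodMap {A B C D : Type*} [TopologicalSpace A] [TopologicalSpace B]
    [TopologicalSpace C] [TopologicalSpace D] {f : A → B} {h : C → D}
    (hf : IsLocalHomeomorph f) (hh : IsLocalHomeomorph h) :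
    IsLocalHomeomorph (fun z : A × C => (f z.1, h z.2)) := by
  rintro ⟨a, c⟩
  obtain ⟨e, ha, rfl⟩ := hf a
  obtain ⟨e', hc, rfl⟩ := hh c
  exact ⟨e.prod e', ⟨ha, hc⟩, rfl⟩

theorem isLocalHomeomorph_proj : IsLocalHomeomorph proj :=
  isLocalHomeomorph_prodMap isLocalHomeomorph_coe_circle isLocalHomeomorph_coe_circle

instance : ChartedSpace Plane Torus := translationCharts proj isLocalHomeomorph_proj

instance : IsManifold 𝓘(ℝ, Plane) ∞ Torus := isManifold_translationCharts _ _

/-! ### Differential 1-forms, first de Rham cohomology, periods -/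

section Forms

variable (E X : Type*) [NormedAddCommGroup E] [NormedSpace ℝ E]

/-- 1-forms on a manifold with translation charts: the tangent bundle is trivialised by the charts,
so that every tangent space is `E`, compatibly with Mathlib's `TangentSpace`. -/
abbrev OneForm : Type _ := X → E →L[ℝ] ℝ

instance : AddCommGroup (OneForm E X) := Pi.addCommGroup

variable {E X} [TopologicalSpace X] [ChartedSpace E X]

/-- The exterior derivative of a function. -/
def extDer (f : X → ℝ) : OneForm E X := fun x => mfderiv 𝓘(ℝ, E) 𝓘(ℝ, ℝ) f x

/-- The derivative `v ↦ D_v α` of a 1-form in a translation chart. -/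
def formDer (α : OneForm E X) (x : X) : E →L[ℝ] E →L[ℝ] ℝ :=
  mfderiv 𝓘(ℝ, E) 𝓘(ℝ, E →L[ℝ] ℝ) α x

/-- The 1-forms that are smooth and closed on the open set `U`: the derivative
`(v, w) ↦ D_v α (w)` in a translation chart is symmetric, that is `dα = 0`. -/
def closedForms (U : Set X) : Submodule ℝ (OneForm E X) where
  carrier := {α | ∀ x ∈ U, ContMDiffAt 𝓘(ℝ, E) 𝓘(ℝ, E →L[ℝ] ℝ) ∞ α x ∧
    ∀ v w : E, formDer α x v w = formDer α x w v}
  zero_mem' := by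
    intro x _
    refine ⟨contMDiffAt_const, fun v w => ?_⟩
    have : formDer (0 : OneForm E X) x = 0 := mfderiv_const (c := (0 : E →L[ℝ] ℝ))
    rw [this]; rfl
  add_mem' := by
    intro α β hα hβ x hx
    refine ⟨(hα x hx).1.add (hβ x hx).1, fun v w => ?_⟩
    have : formDer (α + β) x = formDer α x + formDer β x :=
      mfderiv_add ((hα x hx).1.mdifferentiableAt (by simp))
        ((hβ x hx).1.mdifferentiableAt (by simp))
    rw [this]
    exact congrArg₂ (· + ·) ((hα x hx).2 v w) ((hβ x hx).2 v w)
  smul_mem' := by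
    intro c α hα x hx
    refine ⟨(contDiff_const_smul c).contMDiff.contMDiffAt.comp x (hα x hx).1, fun v w => ?_⟩
    have : formDer (c • α) x = c • formDer α x :=
      const_smul_mfderiv ((hα x hx).1.mdifferentiableAt (by simp)) c
    rw [this]
    exact congrArg (c • ·) ((hα x hx).2 v w)

/-- The 1-forms that are the differential of a smooth function on the open set `U`. -/
def exactForms (U : Set X) : Submodule ℝ (OneForm E X) where
  carrier := {α | ∃ f : X → ℝ, ∀ x ∈ U,
    ContMDiffAt 𝓘(ℝ, E) 𝓘(ℝ, ℝ) ∞ f x ∧ α x = extDer f x}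
  zero_mem' := by
    refine ⟨0, fun x _ => ⟨contMDiffAt_const, ?_⟩⟩
    exact (mfderiv_const (c := (0 : ℝ))).symm
  add_mem' := by
    rintro α β ⟨f, hf⟩ ⟨h, hh⟩
    refine ⟨f + h, fun x hx => ⟨(hf x hx).1.add (hh x hx).1, ?_⟩⟩
    have := mfderiv_add ((hf x hx).1.mdifferentiableAt (by simp))
      ((hh x hx).1.mdifferentiableAt (by simp))
    rw [Pi.add_apply, (hf x hx).2, (hh x hx).2]
    exact this.symm
  smul_mem' := by
    rintro c α ⟨f, hf⟩
    refine ⟨c • f, fun x hx => ⟨(contDiff_const_smul c).contMDiff.contMDiffAt.comp x (hf x hx).1, ?_⟩⟩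
    have := const_smul_mfderiv ((hf x hx).1.mdifferentiableAt (by simp)) c
    rw [Pi.smul_apply, (hf x hx).2]
    exact this.symm

/-- `H¹(U, ℝ)`: closed 1-forms on the open set `U` modulo those that are exact on `U`. (Forms that
agree on `U` are identified, because a form vanishing on `U` is exact on `U`.) -/
abbrev DeRhamH1 (E : Type*) {X : Type*} [NormedAddCommGroup E] [NormedSpace ℝ E]
    [TopologicalSpace X] [ChartedSpace E X] (U : Set X) : Type _ :=
  ↥(closedForms (E := E) U) ⧸ (exactForms (E := E) U).submoduleOf (closedForms U)

/-- The cohomology class on `U` of a 1-form that is closed on `U`. -/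
def cohClass (U : Set X) (α : OneForm E X) (hα : α ∈ closedForms U) : DeRhamH1 E U :=
  Submodule.Quotient.mk ⟨α, hα⟩

/-- The pull-back of a 1-form by a map of manifolds. -/
def pullback {F Y : Type*} [NormedAddCommGroup F] [NormedSpace ℝ F] [TopologicalSpace Y]
    [ChartedSpace F Y] (φ : X → Y) (α : OneForm F Y) : OneForm E X :=
  fun x => (α (φ x)).comp (mfderiv 𝓘(ℝ, E) 𝓘(ℝ, F) φ x : E →L[ℝ] F)

/-- The integral of a 1-form along a path parametrised by `[0,1]`. -/
def pathIntegral (α : OneForm E X) (c : ℝ → X) : ℝ :=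
  ∫ t in (0 : ℝ)..1, α (c t) (mfderivWithin 𝓘(ℝ, ℝ) 𝓘(ℝ, E) c (Icc 0 1) t (1 : ℝ) : E)

/-- The boundary of a singular 1-chain with integer coefficients; a 1-simplex is given by a map
on `ℝ` of which only the restriction to `[0,1]` matters. -/
def boundary (X : Type*) : ((ℝ → X) →₀ ℤ) →+ (X →₀ ℤ) :=
  Finsupp.liftAddHom fun c =>
    (Finsupp.singleAddHom (c 1) : ℤ →+ (X →₀ ℤ)) - Finsupp.singleAddHom (c 0)

/-- The group of smooth singular 1-cycles in `U`, with integer coefficients. -/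
def smoothCycles (E : Type*) {X : Type*} [NormedAddCommGroup E] [NormedSpace ℝ E]
    [TopologicalSpace X] [ChartedSpace E X] (U : Set X) : AddSubgroup ((ℝ → X) →₀ ℤ) where
  carrier := {z | (∀ c ∈ z.support, ContMDiffOn 𝓘(ℝ, ℝ) 𝓘(ℝ, E) ∞ c (Icc 0 1) ∧
    MapsTo c (Icc 0 1) U) ∧ boundary X z = 0}
  zero_mem' := by simp
  add_mem' := by
    classical
    rintro z w ⟨hz, hz'⟩ ⟨hw, hw'⟩
    refine ⟨fun c hc => ?_, by rw [map_add, hz', hw', add_zero]⟩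
    rcases Finset.mem_union.1 (Finsupp.support_add hc) with h | h
    exacts [hz c h, hw c h]
  neg_mem' := by
    rintro z ⟨hz, hz'⟩
    refine ⟨fun c hc => hz c (by simpa using hc), by rw [map_neg, hz', neg_zero]⟩

/-- Integration of a 1-form over singular 1-chains. -/
def chainIntegral (α : OneForm E X) : ((ℝ → X) →₀ ℤ) →+ ℝ :=
  Finsupp.liftAddHom fun c => (AddMonoidHom.mulRight (pathIntegral α c)).comp (Int.castAddHom ℝ)

/-- The group of periods of `α` over `U`: the image of `H₁(U, ℤ)`, represented by smooth singular
cycles, under integration of `α`. -/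
def periods (α : OneForm E X) (U : Set X) : AddSubgroup ℝ :=
  (smoothCycles E U).map (chainIntegral α)

end Forms

/-! ### `H¹` loops -/

/-- `L²(𝕋, ℝ²)`. -/
abbrev L2 : Type := Lp Plane 2 (volume : Measure UnitAddCircle)

theorem integrable_L2 (u : L2) : Integrable (u : UnitAddCircle → Plane) volume :=
  (Lp.memLp u).integrable (by norm_num)

theorem intervalIntegrable_of_integrable {u : UnitAddCircle → Plane} (hu : Integrable u volume) :
    IntervalIntegrable (fun r : ℝ => u r) volume 0 1 := by
  have h := (AddCircle.measurePreserving_mk (1 : ℝ) 0).integrable_comp_of_integrable hu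
  rw [intervalIntegrable_iff_integrableOn_Ioc_of_le zero_le_one]
  simpa [IntegrableOn, Function.comp_def] using h

/-- The primitive `s ↦ ∫₀ˢ u` of `u ∈ L²(𝕋, ℝ²)`. -/
def prim (u : L2) (s : ℝ) : Plane := ∫ r in (0 : ℝ)..s, u (r : UnitAddCircle)

theorem intervalIntegrable_L2 (u : L2) {s : ℝ} (hs : s ∈ Icc (0 : ℝ) 1) :
    IntervalIntegrable (fun r : ℝ => u (r : UnitAddCircle)) volume 0 s :=
  (intervalIntegrable_of_integrable (integrable_L2 u)).mono_set (by
    rw [uIcc_of_le hs.1, uIcc_of_le zero_le_one]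
    exact Icc_subset_Icc le_rfl hs.2)

theorem integral_congr_L2 {u v : UnitAddCircle → Plane} (h : u =ᵐ[volume] v) {s : ℝ}
    (hs : s ∈ Icc (0 : ℝ) 1) :
    ∫ r in (0 : ℝ)..s, u (r : UnitAddCircle) = ∫ r in (0 : ℝ)..s, v (r : UnitAddCircle) := by
  have h' := (AddCircle.measurePreserving_mk (1 : ℝ) 0).quasiMeasurePreserving.ae_eq_comp h
  rw [intervalIntegral.integral_of_le hs.1, intervalIntegral.integral_of_le hs.1]
  refine integral_congr_ae ?_
  refine ae_restrict_of_ae_restrict_of_subset (t := Ioc (0 : ℝ) (0 + 1)) ?_ h'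
  exact Ioc_subset_Ioc le_rfl (by simpa using hs.2)

theorem prim_zero {s : ℝ} (hs : s ∈ Icc (0 : ℝ) 1) : prim 0 s = 0 := by
  unfold prim
  rw [integral_congr_L2 (Lp.coeFn_zero Plane 2 (volume : Measure UnitAddCircle)) hs]
  simp

theorem prim_add (u v : L2) {s : ℝ} (hs : s ∈ Icc (0 : ℝ) 1) :
    prim (u + v) s = prim u s + prim v s := by
  unfold prim
  rw [integral_congr_L2 (Lp.coeFn_add u v) hs]
  exact intervalIntegral.integral_add (intervalIntegrable_L2 u hs) (intervalIntegrable_L2 v hs)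

theorem prim_smul (c : ℝ) (u : L2) {s : ℝ} (hs : s ∈ Icc (0 : ℝ) 1) :
    prim (c • u) s = c • prim u s := by
  unfold prim
  rw [integral_congr_L2 (Lp.coeFn_smul c u) hs]
  exact intervalIntegral.integral_smul c _

theorem prim_neg (u : L2) {s : ℝ} (hs : s ∈ Icc (0 : ℝ) 1) :
    prim (-u) s = -prim u s := by
  have := prim_smul (-1) u hs
  simpa using this

/-- `H¹(𝕋, ℝ²)`: pairs `(ξ, ξ')` of a continuous function and a square integrable one such that
`ξ(s) = ξ(0) + ∫₀ˢ ξ'`, that is, `ξ` is absolutely continuous with derivative `ξ' ∈ L²`. The norm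
`max (‖ξ‖_∞, ‖ξ'‖_{L²})` is equivalent to the usual Hilbert norm of `H¹`. -/
def H1 : Submodule ℝ (C(UnitAddCircle, Plane) × L2) where
  carrier := {ξ | ∀ s ∈ Icc (0 : ℝ) 1, ξ.1 (s : UnitAddCircle) = ξ.1 0 + prim ξ.2 s}
  zero_mem' := by
    intro s hs
    simp [prim_zero hs]
  add_mem' := by
    intro ξ ζ hξ hζ s hs
    simp only [Prod.fst_add, Prod.snd_add, ContinuousMap.add_apply, prim_add _ _ hs, hξ s hs,
      hζ s hs]
    abel
  smul_mem' := by
    intro c ξ hξ s hs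
    simp only [Prod.smul_fst, Prod.smul_snd, ContinuousMap.smul_apply, prim_smul _ _ hs, hξ s hs,
      smul_add]

/-- `H¹(𝕋, 𝕋²)`: pairs `(x, x')` of a continuous loop in the torus and its derivative
`x' ∈ L²(𝕋, ℝ²)`, in the sense that `x(s) = x(0) + ∫₀ˢ x'` modulo `ℤ²`. It carries the `H¹`
topology: uniform convergence of `x` and `L²` convergence of `x'`. -/
def H1Loop : AddSubgroup (C(UnitAddCircle, Torus) × L2) where
  carrier := {x | ∀ s ∈ Icc (0 : ℝ) 1, x.1 (s : UnitAddCircle) = x.1 0 + proj (prim x.2 s)}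
  zero_mem' := by
    intro s hs
    simp [prim_zero hs]
  add_mem' := by
    intro x y hx hy s hs
    simp only [Prod.fst_add, Prod.snd_add, ContinuousMap.add_apply, prim_add _ _ hs, hx s hs,
      hy s hs, map_add]
    abel
  neg_mem' := by
    intro x hx s hs
    simp only [Prod.fst_neg, Prod.snd_neg, ContinuousMap.neg_apply, prim_neg _ hs, hx s hs,
      map_neg]
    abel

theorem continuous_proj : Continuous proj := isLocalHomeomorph_proj.continuous

/-- The map `ξ ↦ π ∘ ξ` from `H¹(𝕋, ℝ²)` to `H¹(𝕋, 𝕋²)`. -/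
def loopExp : H1 →+ H1Loop where
  toFun ξ := ⟨(⟨fun s => proj (ξ.1.1 s), continuous_proj.comp ξ.1.1.continuous⟩, ξ.1.2), by
    intro s hs
    have := congrArg proj (ξ.2 s hs)
    rwa [map_add] at this⟩
  map_zero' := by
    apply Subtype.ext
    refine Prod.ext ?_ rfl
    ext1 s
    exact map_zero proj
  map_add' ξ ζ := by
    apply Subtype.ext
    refine Prod.ext ?_ rfl
    ext1 s
    exact map_add proj _ _

/-- A small circle element has a unique small real representative, depending continuously on it. -/
theorem exists_circle_section : ∃ r : UnitAddCircle → ℝ,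
    ContinuousOn r (Metric.ball 0 (1 / 2)) ∧
    ∀ z : UnitAddCircle, ‖z‖ < 1 / 2 → ((r z : ℝ) : UnitAddCircle) = z ∧ |r z| = ‖z‖ := by
  let e := AddCircle.openPartialHomeomorphCoe (1 : ℝ) (-(1 / 2) : ℝ)
  have ht : ∀ z : UnitAddCircle, ‖z‖ < 1 / 2 → z ∈ e.target := by
    intro z hz hz'
    have h1 : z = ((-(1 / 2) : ℝ) : UnitAddCircle) := hz'
    have h2 : ‖((-(1 / 2) : ℝ) : UnitAddCircle)‖ = |(-(1 / 2) : ℝ)| :=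
      (AddCircle.norm_coe_eq_abs_iff (1 : ℝ) one_ne_zero).2 (by norm_num)
    rw [h1, h2] at hz
    norm_num at hz
  refine ⟨e.symm, e.continuousOn_symm.mono fun z hz => ht z (by simpa using hz), fun z hz => ?_⟩
  have h1 : ((e.symm z : ℝ) : UnitAddCircle) = z := e.right_inv (ht z hz)
  have h2 : e.symm z ∈ Ioo (-(1 / 2) : ℝ) (-(1 / 2) + 1) := e.map_target (ht z hz)
  refine ⟨h1, ?_⟩
  have h3 : ‖((e.symm z : ℝ) : UnitAddCircle)‖ = |e.symm z| := by
    refine (AddCircle.norm_coe_eq_abs_iff (1 : ℝ) one_ne_zero).2 ?_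
    rw [abs_one, abs_le]
    constructor <;> linarith [h2.1, h2.2]
  rw [← h3, h1]

theorem continuousOn_prim (u : L2) : ContinuousOn (prim u) (Icc 0 1) := by
  have h := intervalIntegral.continuousOn_primitive_interval'
    (intervalIntegrable_of_integrable (integrable_L2 u)) left_mem_uIcc
  rwa [uIcc_of_le zero_le_one] at h

theorem eqOn_of_coe_eqOn {f h : ℝ → ℝ} (hf : ContinuousOn f (Icc 0 1))
    (hh : ContinuousOn h (Icc 0 1)) (h0 : f 0 = h 0)
    (hc : ∀ s ∈ Icc (0 : ℝ) 1, ((f s : ℝ) : UnitAddCircle) = (h s : UnitAddCircle)) :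
    EqOn f h (Icc 0 1) :=
  (AddCircle.isCoveringMap_coe (1 : ℝ)).eqOn_of_comp_eqOn isPreconnected_Icc hf hh hc
    (left_mem_Icc.2 zero_le_one) h0

/-- Loops near the constant loop `0` lift to small elements of `H¹(𝕋, ℝ²)`. -/
theorem exists_lift_of_norm_lt (y : H1Loop) (hy : ‖y‖ < 1 / 2) :
    ∃ ξ : H1, loopExp ξ = y ∧ ‖ξ‖ ≤ ‖y‖ := by
  obtain ⟨r, hr, hr'⟩ := exists_circle_section
  have hn : ∀ s, ‖y.1.1 s‖ ≤ ‖y.1.1‖ := y.1.1.norm_coe_le_norm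
  have hy1 : ‖y.1.1‖ < 1 / 2 := (norm_fst_le y.1).trans_lt hy
  have h1 : ∀ s, ‖(y.1.1 s).1‖ < 1 / 2 := fun s =>
    ((norm_fst_le (y.1.1 s)).trans (hn s)).trans_lt hy1
  have h2 : ∀ s, ‖(y.1.1 s).2‖ < 1 / 2 := fun s =>
    ((norm_snd_le (y.1.1 s)).trans (hn s)).trans_lt hy1
  have c1 : Continuous fun s => r (y.1.1 s).1 :=
    hr.comp_continuous (continuous_fst.comp y.1.1.continuous) fun s => by simpa using h1 s
  have c2 : Continuous fun s => r (y.1.1 s).2 :=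
    hr.comp_continuous (continuous_snd.comp y.1.1.continuous) fun s => by simpa using h2 s
  let f : C(UnitAddCircle, Plane) := ⟨fun s => (r (y.1.1 s).1, r (y.1.1 s).2), c1.prodMk c2⟩
  have hf : ∀ s, proj (f s) = y.1.1 s := fun s =>
    Prod.ext (hr' _ (h1 s)).1 (hr' _ (h2 s)).1
  have hcoe : Continuous fun s : ℝ => (s : UnitAddCircle) := isLocalHomeomorph_coe_circle.continuous
  have hmem : (f, y.1.2) ∈ H1 := by
    have key : ∀ s ∈ Icc (0 : ℝ) 1, proj (f (s : UnitAddCircle)) = proj (f 0 + prim y.1.2 s) := by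
      intro s hs
      rw [map_add, hf, hf]
      exact y.2 s hs
    have p0 : prim y.1.2 0 = 0 := intervalIntegral.integral_same
    intro s hs
    refine Prod.ext ?_ ?_
    · refine eqOn_of_coe_eqOn (f := fun s => (f (s : UnitAddCircle)).1)
        (h := fun s => (f 0 + prim y.1.2 s).1) ?_ ?_ ?_ ?_ hs
      · exact (continuous_fst.comp (f.continuous.comp hcoe)).continuousOn
      · exact continuous_fst.comp_continuousOn (continuousOn_const.add (continuousOn_prim _))
      · simp [p0]
      · exact fun s hs => congrArg Prod.fst (key s hs)
    · refine eqOn_of_coe_eqOn (f := fun s => (f (s : UnitAddCircle)).2)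
        (h := fun s => (f 0 + prim y.1.2 s).2) ?_ ?_ ?_ ?_ hs
      · exact (continuous_snd.comp (f.continuous.comp hcoe)).continuousOn
      · exact continuous_snd.comp_continuousOn (continuousOn_const.add (continuousOn_prim _))
      · simp [p0]
      · exact fun s hs => congrArg Prod.snd (key s hs)
  refine ⟨⟨(f, y.1.2), hmem⟩, ?_, ?_⟩
  · apply Subtype.ext
    refine Prod.ext ?_ rfl
    ext1 s
    exact hf s
  · change max ‖f‖ ‖y.1.2‖ ≤ max ‖y.1.1‖ ‖y.1.2‖
    refine max_le_max ((ContinuousMap.norm_le _ (norm_nonneg _)).2 fun s => ?_) le_rfl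
    refine le_trans ?_ (hn s)
    refine max_le_max (le_of_eq ?_) (le_of_eq ?_)
    · exact (hr' _ (h1 s)).2
    · exact (hr' _ (h2 s)).2

theorem continuous_loopExp : Continuous loopExp := by
  refine Continuous.subtype_mk (Continuous.prodMk ?_ ?_) _
  · exact (ContinuousMap.continuous_postcomp (⟨proj, continuous_proj⟩ : C(Plane, Torus))).comp
      (continuous_fst.comp continuous_subtype_val)
  · exact continuous_snd.comp continuous_subtype_val

theorem eq_zero_of_loopExp_eq_zero {ξ : H1} (h : loopExp ξ = 0) (hξ : ‖ξ‖ < 1 / 2) : ξ = 0 := by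
  have hz : ∀ t : ℝ, |t| < 1 / 2 → (t : UnitAddCircle) = 0 → t = 0 := by
    intro t ht h0
    have := (AddCircle.norm_coe_eq_abs_iff (1 : ℝ) (x := t) one_ne_zero).2 (by
      rw [abs_one]; exact ht.le)
    rw [h0, norm_zero] at this
    exact abs_eq_zero.1 this.symm
  have h' : ξ.1.1 = 0 ∧ ξ.1.2 = 0 := by
    refine ⟨?_, congrArg (fun y : H1Loop => y.1.2) h⟩
    ext1 s
    have hs : proj (ξ.1.1 s) = 0 := congrArg (fun y : H1Loop => y.1.1 s) h
    have hn : ‖ξ.1.1 s‖ < 1 / 2 :=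
      ((ξ.1.1.norm_coe_le_norm s).trans (norm_fst_le ξ.1)).trans_lt hξ
    exact Prod.ext (hz _ ((norm_fst_le _).trans_lt hn) (congrArg Prod.fst hs))
      (hz _ ((norm_snd_le _).trans_lt hn) (congrArg Prod.snd hs))
  exact Subtype.ext (Prod.ext h'.1 h'.2)

theorem isLocalHomeomorph_loopExp : IsLocalHomeomorph loopExp := by
  have hopen : IsOpenMap loopExp := by
    refine IsOpenMap.of_nhds_le fun ξ => ?_
    intro V hV
    obtain ⟨ε, hε, hεV⟩ := Metric.mem_nhds_iff.1 (Filter.mem_map.1 hV)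
    refine Metric.mem_nhds_iff.2 ⟨min ε (1 / 2), by positivity, fun y hy => ?_⟩
    rw [Metric.mem_ball, dist_eq_norm] at hy
    obtain ⟨ζ, hζ, hζn⟩ := exists_lift_of_norm_lt (y - loopExp ξ) (hy.trans_le (min_le_right _ _))
    have hm : ξ + ζ ∈ Metric.ball ξ ε := by
      rw [Metric.mem_ball, dist_eq_norm, add_sub_cancel_left]
      exact (hζn.trans_lt hy).trans_le (min_le_left _ _)
    have := hεV hm
    rwa [mem_preimage, map_add, hζ, add_sub_cancel] at this
  refine isLocalHomeomorph_iff_isOpenEmbedding_restrict.2 fun ξ => ?_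
  refine ⟨Metric.ball ξ (1 / 4), Metric.ball_mem_nhds _ (by norm_num), ?_⟩
  refine Topology.IsOpenEmbedding.of_continuous_injective_isOpenMap
    (continuous_loopExp.comp continuous_subtype_val) ?_
    (hopen.comp Metric.isOpen_ball.isOpenMap_subtype_val)
  rintro ⟨a, ha⟩ ⟨b, hb⟩ hab
  have hab' : loopExp a = loopExp b := hab
  have h0 : loopExp (a - b) = 0 := by rw [map_sub, hab', sub_self]
  have hlt : ‖a - b‖ < 1 / 2 := by
    refine lt_of_eq_of_lt (dist_eq_norm a b).symm ?_
    calc dist a b ≤ dist a ξ + dist b ξ := dist_triangle_right _ _ _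
      _ < 1 / 4 + 1 / 4 := add_lt_add ha hb
      _ = 1 / 2 := by norm_num
  exact Subtype.ext (sub_eq_zero.1 (eq_zero_of_loopExp_eq_zero h0 hlt))

/-! ### The free loop space with arbitrary period -/

/-- `H¹(𝕋, 𝕋²) × ℝ`; the free loop space is its open subset where the period is positive. -/
abbrev Loop : Type := H1Loop × ℝ

/-- The tangent space `H¹(𝕋, ℝ²) × ℝ` at every point. -/
abbrev LoopVec : Type := H1 × ℝ

/-- The exponential map `(ξ, t) ↦ (π ∘ ξ, t)`; the chart at `(x, T)` is the local inverse of
`(ξ, t) ↦ (x + π ∘ ξ, T + t)`, as for the exponential map of the flat torus. -/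
def freeExp : LoopVec →+ Loop := loopExp.prodMap (AddMonoidHom.id ℝ)

theorem isLocalHomeomorph_freeExp : IsLocalHomeomorph freeExp :=
  isLocalHomeomorph_prodMap isLocalHomeomorph_loopExp (Homeomorph.refl ℝ).isLocalHomeomorph

instance : ChartedSpace LoopVec Loop := translationCharts freeExp isLocalHomeomorph_freeExp

instance : IsManifold 𝓘(ℝ, LoopVec) ∞ Loop := isManifold_translationCharts _ _

/-- The loop `x : 𝕋 → 𝕋²` of `γ = (x, T)`. -/
def Loop.pt (γ : Loop) (s : UnitAddCircle) : Torus := γ.1.1.1 s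

/-- The derivative `x'` of the loop of `γ = (x, T)`. -/
def Loop.vel (γ : Loop) (s : UnitAddCircle) : Plane := γ.1.1.2 s

/-- The value at `s` of the vector field along the loop given by a tangent vector. -/
def LoopVec.field (ζ : LoopVec) (s : UnitAddCircle) : Plane := ζ.1.1.1 s

/-- The periodic curve `γ(t) = x(t / T)`. -/
def Loop.curve (γ : Loop) (t : ℝ) : Torus := Loop.pt γ ((t / γ.2 : ℝ) : UnitAddCircle)

/-- The free loop space `ℳ = H¹(𝕋, 𝕋²) × (0, ∞)`. -/
def freeLoops : Set Loop := {γ | 0 < γ.2}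

/-- The component `ℳ(a, b)`: loops with a lift `c` to `ℝ²` such that `c(T) = (a, b) + c(0)`. -/
def component (a b : ℤ) : Set Loop :=
  {γ | γ ∈ freeLoops ∧ ∃ c : ℝ → Plane, Continuous c ∧ (∀ t, proj (c t) = Loop.curve γ t) ∧
    c γ.2 = ((a : ℝ), (b : ℝ)) + c 0}

/-- The loops whose image does not contain `q`. -/
def avoiding (q : Torus) : Set Loop := {γ | γ ∈ freeLoops ∧ ∀ t, Loop.curve γ t ≠ q}

/-- `β = ψ · γⁿ`: the loop `γ = (x, T)` iterated `n` times and rotated by `ψ`, that is, the loop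
`s ↦ x(n (ψ + s))` with period `n T`. -/
def IsRotatedIterate (γ : Loop) (n : ℕ) (ψ : UnitAddCircle) (β : Loop) : Prop :=
  β.2 = n * γ.2 ∧ ∀ s, Loop.pt β s = Loop.pt γ (n • (ψ + s))

theorem straightLoop_mem (a b : ℤ) (q : Torus) :
    ((⟨fun s => q + (a • s, b • s), by fun_prop⟩ : C(UnitAddCircle, Torus)),
      (Lp.const 2 (volume : Measure UnitAddCircle) ((a : ℝ), (b : ℝ)) : L2)) ∈ H1Loop := by
  intro s hs
  have h : prim (Lp.const 2 (volume : Measure UnitAddCircle) ((a : ℝ), (b : ℝ))) s =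
      s • ((a : ℝ), (b : ℝ)) := by
    unfold prim
    rw [integral_congr_L2 (Lp.coeFn_const 2 (volume : Measure UnitAddCircle) ((a : ℝ), (b : ℝ))) hs]
    simp
  simp only [ContinuousMap.coe_mk, h, smul_zero, Prod.mk_zero_zero, add_zero]
  congr 1
  refine Prod.ext ?_ ?_
  · change a • (s : UnitAddCircle) = ((s • (a : ℝ) : ℝ) : UnitAddCircle)
    rw [← AddCircle.coe_zsmul, zsmul_eq_mul, smul_eq_mul, mul_comm]
  · change b • (s : UnitAddCircle) = ((s • (b : ℝ) : ℝ) : UnitAddCircle)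
    rw [← AddCircle.coe_zsmul, zsmul_eq_mul, smul_eq_mul, mul_comm]

/-- The map `φ_{(a,b)}(q) = q + γ_{(a,b)}`, where `γ_{(a,b)}` is the projection of
`t ↦ (t a / T, t b / T)`, with period `T`. -/
def straight (a b : ℤ) (T : ℝ) (q : Torus) : Loop := (⟨_, straightLoop_mem a b q⟩, T)

/-! ### Metric, 2-forms and the action 1-form -/

/-- A smooth Riemannian metric on the torus, in the trivialisation `T𝕋² = 𝕋² × ℝ²`. -/
structure TorusMetric where
  toFun : Torus → Plane →L[ℝ] Plane →L[ℝ] ℝ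
  smooth : ContMDiff 𝓘(ℝ, Plane) 𝓘(ℝ, Plane →L[ℝ] Plane →L[ℝ] ℝ) ∞ toFun
  symm : ∀ q v w, toFun q v w = toFun q w v
  pos : ∀ q v, v ≠ 0 → 0 < toFun q v v

/-- A smooth differential 2-form on the torus, in the trivialisation `T𝕋² = 𝕋² × ℝ²`. -/
structure TwoForm where
  toFun : Torus → Plane →L[ℝ] Plane →L[ℝ] ℝ
  smooth : ContMDiff 𝓘(ℝ, Plane) 𝓘(ℝ, Plane →L[ℝ] Plane →L[ℝ] ℝ) ∞ toFun
  alt : ∀ q v, toFun q v v = 0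

/-- `∫_{𝕋²} σ`, the torus being oriented by `dq¹ ∧ dq²`. -/
def TwoForm.integral (σ : TwoForm) : ℝ := ∫ q : Torus, σ.toFun q (1, 0) (0, 1)

/-- The 1-form `dq¹`. -/
def dq1 : OneForm Plane Torus := fun _ => ContinuousLinearMap.fst ℝ ℝ ℝ

/-- The 1-form `dq²`. -/
def dq2 : OneForm Plane Torus := fun _ => ContinuousLinearMap.snd ℝ ℝ ℝ

/-- The 2-form `dq¹ ∧ dq²`. -/
def areaForm : TwoForm where
  toFun q := (dq1 q).smulRight (dq2 q) - (dq2 q).smulRight (dq1 q)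
  smooth := by
    unfold dq1 dq2
    exact contMDiff_const
  alt q v := by simp [dq1, dq2, mul_comm]

/-- The interior product `ι_v σ = σ(v, ·)` with a constant vector field. -/
def interiorProduct (v : Plane) (σ : TwoForm) : OneForm Plane Torus := fun q => σ.toFun q v

theorem TwoForm.exists_bound (σ : TwoForm) : ∃ C : ℝ, ∀ q, ‖σ.toFun q‖ ≤ C := by
  obtain ⟨C, hC⟩ := (isCompact_univ (X := Torus)).exists_bound_of_continuousOn
    (f := σ.toFun) σ.smooth.continuous.continuousOn
  exact ⟨C, fun q => hC q (mem_univ q)⟩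

theorem norm_field_le (ζ : LoopVec) (s : UnitAddCircle) : ‖LoopVec.field ζ s‖ ≤ ‖ζ‖ :=
  ((ζ.1.1.1.norm_coe_le_norm s).trans (norm_fst_le ζ.1.1)).trans (norm_fst_le ζ)

theorem transgression_bound (σ : TwoForm) {C : ℝ} (hC : ∀ q, ‖σ.toFun q‖ ≤ C) (γ : Loop)
    (ζ : LoopVec) (s : UnitAddCircle) :
    ‖σ.toFun (Loop.pt γ s) (LoopVec.field ζ s) (Loop.vel γ s)‖ ≤
      C * ‖ζ‖ * ‖Loop.vel γ s‖ := by
  have hC0 : 0 ≤ C := (norm_nonneg (σ.toFun 0)).trans (hC 0)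
  refine (ContinuousLinearMap.le_opNorm₂ _ _ _).trans ?_
  gcongr
  · exact hC _
  · exact norm_field_le ζ s

theorem integrable_transgression (σ : TwoForm) (γ : Loop) (ζ : LoopVec) :
    Integrable (fun s => σ.toFun (Loop.pt γ s) (LoopVec.field ζ s) (Loop.vel γ s)) volume := by
  obtain ⟨C, hC⟩ := σ.exists_bound
  refine Integrable.mono' ((integrable_L2 γ.1.1.2).norm.const_mul (C * ‖ζ‖)) ?_
    (Filter.Eventually.of_forall fun s => transgression_bound σ hC γ ζ s)
  have hc : Continuous fun s => σ.toFun (Loop.pt γ s) (LoopVec.field ζ s) :=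
    (σ.smooth.continuous.comp γ.1.1.1.continuous).clm_apply ζ.1.1.1.continuous
  exact (ContinuousLinearMap.id ℝ (Plane →L[ℝ] ℝ)).aestronglyMeasurable_comp₂
    hc.aestronglyMeasurable (integrable_L2 γ.1.1.2).aestronglyMeasurable

/-- The transgression `ζ ↦ ∫₀¹ σ_{x(s)}(ζ(s), x'(s)) ds` of a 2-form, a 1-form on loop space. -/
def transgression (σ : TwoForm) : OneForm LoopVec Loop := fun γ =>
  LinearMap.mkContinuousOfExistsBound
    { toFun := fun ζ =>
        ∫ s : UnitAddCircle, σ.toFun (Loop.pt γ s) (LoopVec.field ζ s) (Loop.vel γ s)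
      map_add' := by
        intro ζ ξ
        rw [← integral_add (integrable_transgression σ γ ζ) (integrable_transgression σ γ ξ)]
        congr 1 with s
        have : LoopVec.field (ζ + ξ) s = LoopVec.field ζ s + LoopVec.field ξ s := rfl
        simp [this]
      map_smul' := by
        intro c ζ
        rw [RingHom.id_apply, ← integral_smul]
        congr 1 with s
        have : LoopVec.field (c • ζ) s = c • LoopVec.field ζ s := rfl
        simp [this] }
    (by
      obtain ⟨C, hC⟩ := σ.exists_bound
      refine ⟨C * ∫ s, ‖Loop.vel γ s‖, fun ζ => ?_⟩
      refine (norm_integral_le_of_norm_le ((integrable_L2 γ.1.1.2).norm.const_mul (C * ‖ζ‖))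
        (Filter.Eventually.of_forall fun s => transgression_bound σ hC γ ζ s)).trans (le_of_eq ?_)
      rw [integral_const_mul]
      exact mul_right_comm C ‖ζ‖ _)

/-- The transgression 1-form `τ` of `dq¹ ∧ dq²`. -/
def tau : OneForm LoopVec Loop := transgression areaForm

/-- In terms of `γ(t) = x(t / T)`, so that `γ'(t) = x'(t / T) / T`, the form `τ` is
`ζ ↦ ∫₀ᵀ (dq¹ ∧ dq²)(ζ, γ'(t)) dt`. -/
theorem tau_apply (γ : Loop) (hγ : γ ∈ freeLoops) (ζ : LoopVec) :
    tau γ ζ = ∫ t in (0 : ℝ)..γ.2, areaForm.toFun (Loop.curve γ t)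
      (LoopVec.field ζ ((t / γ.2 : ℝ) : UnitAddCircle))
      ((1 / γ.2) • Loop.vel γ ((t / γ.2 : ℝ) : UnitAddCircle)) := by
  have h0 : γ.2 ≠ 0 := (show 0 < γ.2 from hγ).ne'
  have h1 := AddCircle.intervalIntegral_preimage (1 : ℝ) 0 (fun s : UnitAddCircle =>
    areaForm.toFun (Loop.pt γ s) (LoopVec.field ζ s) (Loop.vel γ s))
  have h2 := intervalIntegral.integral_comp_div (a := 0) (b := γ.2) (fun r : ℝ =>
    areaForm.toFun (Loop.pt γ r) (LoopVec.field ζ r) (Loop.vel γ r)) h0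
  simp only [map_smul, intervalIntegral.integral_smul, Loop.curve]
  rw [h2, zero_div, div_self h0, smul_smul, one_div, inv_mul_cancel₀ h0, one_smul]
  rw [zero_add] at h1
  exact h1.symm

/-- The free-period action of the kinetic energy:
`𝔸_k(x, T) = T ∫₀¹ (|x'(s)|² / (2 T²) + k) ds`. -/
def action (g : TorusMetric) (k : ℝ) (γ : Loop) : ℝ :=
  γ.2 * ∫ s : UnitAddCircle,
    (1 / (2 * γ.2 ^ 2) * g.toFun (Loop.pt γ s) (Loop.vel γ s) (Loop.vel γ s) + k)

/-- The action 1-form `η_k = d𝔸_k + ∫₀¹ σ_{x(s)}(·, x'(s)) ds`. -/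
def eta (g : TorusMetric) (σ : TwoForm) (k : ℝ) : OneForm LoopVec Loop :=
  extDer (action g k) + transgression σ

end

end MagneticTorus

open MagneticTorus

/-! A loop is replaced by its path data `(p, u)`: a lift `p` of the initial point and the velocity
`u ∈ L²`. In a translation chart a tangent vector simply adds its own path data (`IsLift.add`), so
all local analysis takes place on the Banach space `PathData`. There, integrals along the path are
smooth, because composition with a smooth function is smooth on spaces of continuous maps and the
velocity enters through bounded bilinear pairings.

For a periodic coefficient `h`, the plane form `h dx ∧ dy` has the primitive `(∫₀ˣ h) dy`. Its line
integral, minus a correction for the loop not closing up in the plane, is a local primitive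
`areaPot` of the transgression (`fderiv_areaPot`). This gives smoothness and closedness of `τ` and
of `η_k`. The primitive depends on the lift: moving the lift by `(m, n)` for a loop with
displacement `(a, b)` adds `(b m - a n) ∫ h` (`areaPot_add`). This jump formula governs all the
cohomological assertions.

For `τ` the pull-back by the straight loops is the constant form `b dq¹ - a dq²`. A primitive of `τ`
on the component would pull back to a function on the compact torus, whose differential vanishes at
a maximum; hence `a = b = 0`. Conversely there is no jump when the displacement is zero. For `η_k`,
the primitive of the pull-back on the plane has the same lattice jumps as a linear form, and their
difference descends to the torus. Along a chain, `η_k` integrates to boundary values of a potential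
that is well defined modulo `∫ σ`, so all periods lie in `ℤ ∫ σ`.

For loops avoiding a point, take an angular form around that point, multiplied by a radial function.
It is periodic, smooth away from the lattice translated by the point, and its exterior derivative
extends to a smooth form `ringCurl` of positive total integral `C`. For loops missing the point, the
transgression of `ringCurl` therefore has two local primitives: the line integral of the angular
form, which does not jump, and `areaPot`, which jumps by multiples of `C`. Their difference is
locally constant on lifts, and `C⁻¹` times it cancels the jump of the primitive of `τ`
(`avoidingPot_eq_of_isLift`, `tau_exact_avoiding`). A missed point exists because a path with
integrable velocity is a Lipschitz image of a subset of the line, of dimension at most one. -/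

namespace MagneticTorus

noncomputable section

set_option linter.unusedSectionVars false
set_option maxSynthPendingDepth 3

/-! ### Superposition operators on spaces of continuous functions -/

section Superposition

universe v

variable {K : Type*} [TopologicalSpace K] [CompactSpace K]
  {E F : Type v} [NormedAddCommGroup E] [NormedSpace ℝ E] [NormedAddCommGroup F] [NormedSpace ℝ F]

/-- Pointwise application of a continuous family of linear maps to a continuous function. -/
def applyL (K : Type*) [TopologicalSpace K] [CompactSpace K]
    (E F : Type v) [NormedAddCommGroup E] [NormedSpace ℝ E]
    [NormedAddCommGroup F] [NormedSpace ℝ F] :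
    C(K, E →L[ℝ] F) →L[ℝ] C(K, E) →L[ℝ] C(K, F) :=
  LinearMap.mkContinuous₂
    (LinearMap.mk₂ ℝ (fun (A : C(K, E →L[ℝ] F)) (ξ : C(K, E)) =>
        (⟨fun s => A s (ξ s), A.continuous.clm_apply ξ.continuous⟩ : C(K, F)))
      (fun A B ξ => by ext; simp) (fun c A ξ => by ext; simp)
      (fun A ξ ζ => by ext; simp) (fun c A ξ => by ext; simp)) 1 (by
    intro A ξ
    rw [one_mul]
    refine (ContinuousMap.norm_le _ (by positivity)).2 fun s => ?_
    exact (A s).le_of_opNorm_le_of_le (A.norm_coe_le_norm s) (ξ.norm_coe_le_norm s))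

/-- The superposition operator `ξ ↦ f ∘ ξ`. -/
def superpose (f : C(E, F)) (ξ : C(K, E)) : C(K, F) := f.comp ξ

theorem continuous_superpose (f : C(E, F)) : Continuous (superpose (K := K) f) :=
  f.continuous_postcomp

/-- The mean value inequality is applied pointwise to `f` near each `ξ s`. The required uniformity
in `s` is the continuity of superposition by `f'` at `ξ` in the sup norm. -/
theorem hasFDerivAt_superpose (f : C(E, F)) (f' : C(E, E →L[ℝ] F))
    (hf : ∀ x, HasFDerivAt f (f' x) x) (ξ : C(K, E)) :
    HasFDerivAt (superpose f) (applyL K E F (superpose f' ξ)) ξ := by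
  rw [hasFDerivAt_iff_isLittleO_nhds_zero, Asymptotics.isLittleO_iff]
  intro ε hε
  have h1 := (continuous_superpose (K := K) f').continuousAt (x := ξ)
  obtain ⟨δ, hδ, hδ'⟩ := Metric.continuousAt_iff.1 h1 ε hε
  filter_upwards [Metric.ball_mem_nhds (0 : C(K, E)) hδ] with ζ hζ
  have hζ' : ‖ζ‖ < δ := by simpa using hζ
  refine (ContinuousMap.norm_le _ (by positivity)).2 fun s => ?_
  have hbound : ∀ e ∈ Metric.ball (0 : E) δ, ‖f' (ξ s + e) - f' (ξ s)‖ ≤ ε := by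
    intro e he
    have he' : ‖e‖ < δ := by simpa using he
    -- Perturbing `ξ` by a constant function turns sup-norm continuity into a bound on `f'` at every
    -- point `ξ s + e`.
    have h2 : dist (ξ + ContinuousMap.const K e) ξ < δ := by
      rw [dist_eq_norm, add_sub_cancel_left]
      exact ((ContinuousMap.norm_le _ (norm_nonneg e)).2 fun _ => le_rfl).trans_lt he'
    have h3 := (ContinuousMap.norm_coe_le_norm
      (superpose f' (ξ + ContinuousMap.const K e) - superpose f' ξ) s)
    have h4 := hδ' h2
    rw [dist_eq_norm] at h4
    exact h3.trans h4.le
  have hs : ζ s ∈ Metric.ball (0 : E) δ := by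
    simpa using (ζ.norm_coe_le_norm s).trans_lt hζ'
  have hmv := (convex_ball (0 : E) δ).norm_image_sub_le_of_norm_hasFDerivWithin_le'
    (f := fun e => f (ξ s + e)) (f' := fun e => f' (ξ s + e)) (φ := f' (ξ s)) (C := ε)
    (fun e _ => by
      have := (hf (ξ s + e)).comp e ((hasFDerivAt_id e).const_add (ξ s))
      exact this.hasFDerivWithinAt) hbound (Metric.mem_ball_self hδ) hs
  simp only [add_zero, sub_zero] at hmv
  refine le_trans ?_ (hmv.trans ?_)
  · exact le_of_eq rfl
  · gcongr
    exact ζ.norm_coe_le_norm s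

/-- The derivative is the superposition by `f'` followed by a bounded linear map, so one order of
smoothness passes to `f'`. The target is quantified inside the induction because it becomes `E →L[ℝ]
F`; the common universe of `E` and `F` keeps that type admissible. -/
theorem contDiff_superpose_nat (n : ℕ) : ∀ {F : Type v} [NormedAddCommGroup F] [NormedSpace ℝ F]
    (f : C(E, F)), ContDiff ℝ n f → ContDiff ℝ n (superpose (K := K) f) := by
  induction n with
  | zero =>
    intro F _ _ f _
    exact contDiff_zero.2 (continuous_superpose f)
  | succ n ih =>
    intro F _ _ f hf
    push_cast at hf ⊢
    rw [contDiff_succ_iff_hasFDerivAt] at hf ⊢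
    obtain ⟨f', hf', hd⟩ := hf
    let g : C(E, E →L[ℝ] F) := ⟨f', hf'.continuous⟩
    exact ⟨fun ξ => applyL K E F (superpose g ξ), ContDiff.comp
        (ContinuousLinearMap.contDiff (𝕜 := ℝ) (E := C(K, E →L[ℝ] F))
          (F := C(K, E) →L[ℝ] C(K, F)) (applyL K E F)) (ih g hf'),
      fun ξ => hasFDerivAt_superpose f g hd ξ⟩

theorem contDiff_superpose (f : C(E, F)) (hf : ContDiff ℝ ∞ f) :
    ContDiff ℝ ∞ (superpose (K := K) f) :=
  contDiff_infty.2 fun n => contDiff_superpose_nat n f (contDiff_infty.1 hf n)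

end Superposition

/-! ### Calculus in translation charts -/

section TranslationCalculus

variable {E X : Type*} [NormedAddCommGroup E] [NormedSpace ℝ E]
  [AddCommGroup X] [TopologicalSpace X] [IsTopologicalAddGroup X] [ChartedSpace E X]
  {F : Type*} [NormedAddCommGroup F] [NormedSpace ℝ F]

/-- The atlas of `X` is the one given by the homomorphism `p`. -/
structure HasTranslationCharts (p : E →+ X) : Prop where
  isLocalHomeomorph : IsLocalHomeomorph p
  chartAt_eq : ∀ x, chartAt E x = (translateParam p isLocalHomeomorph x).symm

theorem hasTranslationCharts_proj : HasTranslationCharts proj :=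
  ⟨isLocalHomeomorph_proj, fun _ => rfl⟩

theorem hasTranslationCharts_freeExp : HasTranslationCharts freeExp :=
  ⟨isLocalHomeomorph_freeExp, fun _ => rfl⟩

namespace HasTranslationCharts

variable {p : E →+ X}

theorem extChartAt_symm (hp : HasTranslationCharts p) (x : X) : ⇑(extChartAt 𝓘(ℝ, E) x).symm = fun e => x + p e := by
  funext e
  simp [extChartAt, hp.chartAt_eq, translateParam_apply]

theorem extChartAt_eventually (hp : HasTranslationCharts p) (x : X) :
    ∀ᶠ e in 𝓝 (0 : E), extChartAt 𝓘(ℝ, E) x (x + p e) = e := by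
  filter_upwards [(translateParam p hp.isLocalHomeomorph x).open_source.mem_nhds
    (zero_mem_translateParam p hp.isLocalHomeomorph x)] with e he
  have := (translateParam p hp.isLocalHomeomorph x).left_inv he
  simpa [extChartAt, hp.chartAt_eq, translateParam_apply] using this

theorem extChartAt_self (hp : HasTranslationCharts p) (x : X) : extChartAt 𝓘(ℝ, E) x x = 0 := by
  simpa using (hp.extChartAt_eventually x).self_of_nhds

/-- Continuity and germs at a point of `X` can thereby be tested at `0` in the model space. -/
theorem map_nhds (hp : HasTranslationCharts p) (x : X) : Filter.map (fun e => x + p e) (𝓝 0) = 𝓝 x := by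
  have := (isLocalHomeomorph_translate p hp.isLocalHomeomorph x).map_nhds_eq 0
  simpa using this

theorem tendsto_nhds (hp : HasTranslationCharts p) (x : X) : Filter.Tendsto (fun e => x + p e) (𝓝 0) (𝓝 x) :=
  (hp.map_nhds x).le

theorem contMDiffAt (hp : HasTranslationCharts p) {n : WithTop ℕ∞} {f : X → F} {x : X}
    (h : ContDiffAt ℝ n (fun e => f (x + p e)) 0) : ContMDiffAt 𝓘(ℝ, E) 𝓘(ℝ, F) n f x := by
  rw [contMDiffAt_iff]
  constructor
  · have := h.continuousAt
    unfold ContinuousAt at this ⊢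
    rw [← hp.map_nhds x, Filter.tendsto_map'_iff]
    simpa [Function.comp_def] using this
  · rw [hp.extChartAt_self, hp.extChartAt_symm]
    exact h.contDiffWithinAt

theorem contDiffAt (hp : HasTranslationCharts p) {n : WithTop ℕ∞} {f : X → F} {x : X}
    (h : ContMDiffAt 𝓘(ℝ, E) 𝓘(ℝ, F) n f x) : ContDiffAt ℝ n (fun e => f (x + p e)) 0 := by
  rw [contMDiffAt_iff, hp.extChartAt_self, hp.extChartAt_symm] at h
  rw [modelWithCornersSelf_coe, range_id, contDiffWithinAt_univ] at h
  exact h.2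

theorem contDiff_comp (hp : HasTranslationCharts p) {n : WithTop ℕ∞} {f : X → F}
    (h : ContMDiff 𝓘(ℝ, E) 𝓘(ℝ, F) n f) : ContDiff ℝ n (fun e => f (p e)) := by
  rw [contDiff_iff_contDiffAt]
  intro e
  have h1 := hp.contDiffAt (h (p e))
  have h2 : ContDiffAt ℝ n (fun z : E => z - e) e := by fun_prop
  have h3 : ContDiffAt ℝ n (fun e' => f (p e + p e')) ((fun z : E => z - e) e) := by simpa using h1
  refine (ContDiffAt.comp (f := fun z : E => z - e) e h3 h2).congr_of_eventuallyEq (Filter.Eventually.of_forall fun z => ?_)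
  simp [← map_add]

theorem hasMFDerivAt (hp : HasTranslationCharts p) {f : X → F} {x : X} {f' : E →L[ℝ] F}
    (h : HasFDerivAt (fun e => f (x + p e)) f' 0) :
    HasMFDerivAt 𝓘(ℝ, E) 𝓘(ℝ, F) f x f' := by
  constructor
  · have := h.continuousAt
    unfold ContinuousAt at this ⊢
    rw [← hp.map_nhds x, Filter.tendsto_map'_iff]
    simpa [Function.comp_def] using this
  · rw [writtenInExtChartAt, hp.extChartAt_self, hp.extChartAt_symm]
    exact h.hasFDerivWithinAt

theorem mfderiv_eq (hp : HasTranslationCharts p) {f : X → F} {x : X} {f' : E →L[ℝ] F}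
    (h : HasFDerivAt (fun e => f (x + p e)) f' 0) :
    mfderiv 𝓘(ℝ, E) 𝓘(ℝ, F) f x = f' :=
  (hp.hasMFDerivAt h).mfderiv

/-- A map that is, in translation charts, a linear map is smooth. -/
theorem hasMFDerivAt_of_linear (hp : HasTranslationCharts p) {E' X' : Type*} [NormedAddCommGroup E'] [NormedSpace ℝ E']
    [AddCommGroup X'] [TopologicalSpace X'] [IsTopologicalAddGroup X'] [ChartedSpace E' X']
    {p' : E' →+ X'} (hp' : HasTranslationCharts p') {φ : X → X'} {x : X} (L : E →L[ℝ] E')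
    (h : ∀ e, φ (x + p e) = φ x + p' (L e)) :
    ContMDiffAt 𝓘(ℝ, E) 𝓘(ℝ, E') ∞ φ x ∧ HasMFDerivAt 𝓘(ℝ, E) 𝓘(ℝ, E') φ x L := by
  have hc : ContinuousAt φ x := by
    unfold ContinuousAt
    rw [← hp.map_nhds x, Filter.tendsto_map'_iff]
    have h1 : Filter.Tendsto L (𝓝 0) (𝓝 0) := by simpa using L.continuous.tendsto 0
    have := (hp'.tendsto_nhds (φ x)).comp h1
    refine this.congr fun e => ?_
    simp [h]
  have hev : ∀ᶠ e in 𝓝 (0 : E), extChartAt 𝓘(ℝ, E') (φ x) (φ (x + p e)) = L e := by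
    have h1 : Filter.Tendsto L (𝓝 0) (𝓝 0) := by simpa using L.continuous.tendsto 0
    filter_upwards [h1.eventually (hp'.extChartAt_eventually (φ x))] with e he
    rw [h, he]
  constructor
  · rw [contMDiffAt_iff, hp.extChartAt_self, hp.extChartAt_symm]
    refine ⟨hc, ?_⟩
    have h2 : ContDiffAt ℝ ∞ L 0 := L.contDiff.contDiffAt
    exact (h2.congr_of_eventuallyEq hev).contDiffWithinAt
  · refine ⟨hc, ?_⟩
    rw [writtenInExtChartAt, hp.extChartAt_self, hp.extChartAt_symm]
    exact (L.hasFDerivAt.congr_of_eventuallyEq hev).hasFDerivWithinAt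

/-- A 1-form with a smooth primitive in a chart is smooth and closed. -/
theorem closed_of_primitive (hp : HasTranslationCharts p) {α : OneForm E X} {x : X} {Ψ : E → ℝ} (hΨ : ContDiffAt ℝ ∞ Ψ 0)
    (hα : ∀ᶠ e in 𝓝 (0 : E), α (x + p e) = fderiv ℝ Ψ e) :
    ContMDiffAt 𝓘(ℝ, E) 𝓘(ℝ, E →L[ℝ] ℝ) ∞ α x ∧
      ∀ v w : E, formDer α x v w = formDer α x w v := by
  have h1 : ContDiffAt ℝ ∞ (fderiv ℝ Ψ) 0 := hΨ.fderiv_right (by simp)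
  have h2 : ContDiffAt ℝ ∞ (fun e => α (x + p e)) 0 := h1.congr_of_eventuallyEq hα
  refine ⟨hp.contMDiffAt h2, fun v w => ?_⟩
  have h3 : HasFDerivAt (fun e => α (x + p e)) (fderiv ℝ (fderiv ℝ Ψ) 0) 0 :=
    ((h1.differentiableAt (by simp)).hasFDerivAt).congr_of_eventuallyEq hα
  have h4 : formDer α x = fderiv ℝ (fderiv ℝ Ψ) 0 := hp.mfderiv_eq h3
  rw [h4]
  exact (hΨ.isSymmSndFDerivAt (by
    simp only [minSmoothness_of_isRCLikeNormedField]; exact WithTop.coe_le_coe.2 le_top)) v w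

/-- The local primitives `Ψ` may vary from point to point; a single function `f` has to agree with
each of them near its point. This allows `f` to be defined through a discontinuous choice of lifts.
-/
theorem exact_of_primitive (hp : HasTranslationCharts p) {α : OneForm E X} {U : Set X} (f : X → ℝ)
    (h : ∀ x ∈ U, ∃ Ψ : E → ℝ, ContDiffAt ℝ ∞ Ψ 0 ∧ (∀ᶠ e in 𝓝 (0 : E), f (x + p e) = Ψ e) ∧
      α x = fderiv ℝ Ψ 0) : α ∈ exactForms U := by
  refine ⟨f, fun x hx => ?_⟩
  obtain ⟨Ψ, h1, h2, h3⟩ := h x hx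
  refine ⟨hp.contMDiffAt (h1.congr_of_eventuallyEq h2), ?_⟩
  rw [h3]
  exact (hp.mfderiv_eq (((h1.differentiableAt (by simp)).hasFDerivAt).congr_of_eventuallyEq
    h2)).symm

/-- The differential of a function at nearby points, in a chart. -/
theorem extDer_eventually (hp : HasTranslationCharts p) {f : X → ℝ} {x : X} {Ψ : E → ℝ} (hΨ : ContDiffAt ℝ ∞ Ψ 0)
    (hf : ∀ᶠ e in 𝓝 (0 : E), f (x + p e) = Ψ e) :
    ∀ᶠ e in 𝓝 (0 : E), extDer f (x + p e) = fderiv ℝ Ψ e := by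
  have h1 : ∀ᶠ e in 𝓝 (0 : E), DifferentiableAt ℝ Ψ e := by
    filter_upwards [(hΨ.of_le (m := 1) (by simp)).eventually (by simp)] with e he
    exact he.differentiableAt (by simp)
  filter_upwards [h1, hf.eventually_nhds] with e he hfe
  refine hp.mfderiv_eq ?_
  have h2 : HasFDerivAt (fun e' : E => Ψ (e + e')) (fderiv ℝ Ψ e) 0 := by
    have h3 : HasFDerivAt Ψ (fderiv ℝ Ψ e) (e + 0) := by simpa using he.hasFDerivAt
    exact h3.comp (0 : E) ((hasFDerivAt_id (0 : E)).const_add e)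
  refine h2.congr_of_eventuallyEq ?_
  have h4 : Filter.Tendsto (fun e' : E => e + e') (𝓝 0) (𝓝 e) := by
    have : Continuous fun e' : E => e + e' := by fun_prop
    simpa using this.tendsto 0
  filter_upwards [h4.eventually hfe] with e' he'
  rw [← he', map_add, add_assoc]

end HasTranslationCharts

end TranslationCalculus

/-! ### Absolutely continuous paths in the plane and integrals along them -/

section Paths

theorem integral_circle_eq {E : Type*} [NormedAddCommGroup E] [NormedSpace ℝ E]
    (g : UnitAddCircle → E) :
    ∫ s, g s = ∫ s : unitInterval, g ((s : ℝ) : UnitAddCircle) := by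
  have h1 := AddCircle.intervalIntegral_preimage (1 : ℝ) 0 g
  rw [zero_add] at h1
  have h2 := integral_subtype (measurableSet_Icc (a := (0 : ℝ)) (b := 1))
    (fun r : ℝ => g (r : UnitAddCircle))
  rw [integral_Icc_eq_integral_Ioc, ← intervalIntegral.integral_of_le zero_le_one, h1] at h2
  exact h2.symm

theorem integral_unitInterval_eq {E : Type*} [NormedAddCommGroup E] [NormedSpace ℝ E]
    (g : ℝ → E) : ∫ s : unitInterval, g s = ∫ s in (0 : ℝ)..1, g s := by
  have h2 := integral_subtype (measurableSet_Icc (a := (0 : ℝ)) (b := 1)) g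
  rw [integral_Icc_eq_integral_Ioc, ← intervalIntegral.integral_of_le zero_le_one] at h2
  exact h2

theorem measurePreserving_unitInterval :
    MeasurePreserving (fun s : unitInterval => ((s : ℝ) : UnitAddCircle)) volume volume := by
  have h := AddCircle.measurePreserving_mk (1 : ℝ) 0
  rw [zero_add, Measure.restrict_congr_set (Ioc_ae_eq_Icc (a := (0 : ℝ)) (b := 1))] at h
  exact h.comp unitInterval.measurePreserving_coe

/-- The restriction to the unit interval of a function on the circle. -/
def restrictL : L2 →L[ℝ] Lp Plane 2 (volume : Measure unitInterval) :=
  (Lp.compMeasurePreservingₗᵢ ℝ _ measurePreserving_unitInterval).toContinuousLinearMap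

theorem coeFn_restrictL (u : L2) :
    restrictL u =ᵐ[volume] fun s : unitInterval => u ((s : ℝ) : UnitAddCircle) :=
  Lp.coeFn_compMeasurePreserving u measurePreserving_unitInterval

instance isProbabilityMeasure_circle : IsProbabilityMeasure (volume : Measure UnitAddCircle) :=
  ⟨UnitAddCircle.measure_univ⟩

/-- The circle has total mass one, so the `L¹` norm is bounded by the `L²` norm with constant one.
-/
theorem integral_norm_L2_le (u : L2) : ∫ s, ‖u s‖ ≤ ‖u‖ := by
  rw [integral_norm_eq_lintegral_enorm (integrable_L2 u).aestronglyMeasurable,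
    ← eLpNorm_one_eq_lintegral_enorm, Lp.norm_def]
  exact ENNReal.toReal_mono (Lp.eLpNorm_ne_top u)
    (eLpNorm_le_eLpNorm_of_exponent_le (by norm_num) (integrable_L2 u).aestronglyMeasurable)

theorem integral_norm_interval (u : L2) : ∫ r in (0 : ℝ)..1, ‖u (r : UnitAddCircle)‖ ≤ ‖u‖ := by
  have h1 := AddCircle.intervalIntegral_preimage (1 : ℝ) 0 (fun s => ‖u s‖)
  rw [zero_add] at h1
  rw [h1]
  exact integral_norm_L2_le u

theorem norm_prim_le (u : L2) {s : ℝ} (hs : s ∈ Icc (0 : ℝ) 1) : ‖prim u s‖ ≤ ‖u‖ := by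
  refine (intervalIntegral.norm_integral_le_integral_norm hs.1).trans
    (le_trans ?_ (integral_norm_interval u))
  exact intervalIntegral.integral_mono_interval le_rfl hs.1 hs.2
    (Filter.Eventually.of_forall fun _ => norm_nonneg _)
    (intervalIntegrable_of_integrable (integrable_L2 u)).norm

/-- An absolutely continuous path in the plane, given by its initial point and its velocity. -/
abbrev PathData : Type := Plane × L2

/-- The path with given initial point and velocity. -/
def path : PathData →L[ℝ] C(unitInterval, Plane) :=
  LinearMap.mkContinuous
    { toFun := fun w => ⟨fun s => w.1 + prim w.2 s, continuous_const.add
        (continuousOn_iff_continuous_domRestrict.1 (continuousOn_prim w.2))⟩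
      map_add' := fun w w' => by
        ext1 s
        change w.1 + w'.1 + prim (w.2 + w'.2) s = w.1 + prim w.2 s + (w'.1 + prim w'.2 s)
        rw [prim_add _ _ s.2]
        abel
      map_smul' := fun c w => by
        ext1 s
        change c • w.1 + prim (c • w.2) s = c • (w.1 + prim w.2 s)
        rw [prim_smul _ _ s.2, smul_add] } 2 (by
    intro w
    refine (ContinuousMap.norm_le _ (by positivity)).2 fun s => ?_
    refine (norm_add_le _ _).trans ?_
    have h1 := norm_fst_le w
    have h2 := (norm_prim_le w.2 s.2).trans (norm_snd_le w)
    linarith)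

theorem path_apply (w : PathData) (s : unitInterval) : path w s = w.1 + prim w.2 s := rfl

@[simp] theorem prim_at_zero (u : L2) : prim u 0 = 0 := intervalIntegral.integral_same

@[simp] theorem path_zero (w : PathData) : path w 0 = w.1 := by
  simp [path_apply]

theorem path_one (w : PathData) : path w 1 = w.1 + prim w.2 1 := by
  simp [path_apply]

/-- The pairing `∫₀¹ Θ(s) u(s) ds`. -/
def pairing : C(unitInterval, Plane →L[ℝ] ℝ) →L[ℝ] L2 →L[ℝ] ℝ :=
  (((ContinuousLinearMap.id ℝ (Plane →L[ℝ] ℝ)).lpPairing (volume : Measure unitInterval) 2 2).comp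
    (ContinuousMap.toLp (E := Plane →L[ℝ] ℝ) 2 (volume : Measure unitInterval) ℝ)).bilinearComp
      (ContinuousLinearMap.id ℝ _) restrictL

theorem pairing_apply (Θ : C(unitInterval, Plane →L[ℝ] ℝ)) (u : L2) :
    pairing Θ u = ∫ s : unitInterval, Θ s (u ((s : ℝ) : UnitAddCircle)) := by
  change (ContinuousLinearMap.id ℝ (Plane →L[ℝ] ℝ)).lpPairing (volume : Measure unitInterval) 2 2
    (ContinuousMap.toLp (E := Plane →L[ℝ] ℝ) 2 (volume : Measure unitInterval) ℝ Θ)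
    (restrictL u) = _
  rw [ContinuousLinearMap.lpPairing_eq_integral]
  refine integral_congr_ae ?_
  filter_upwards [coeFn_restrictL u,
    ContinuousMap.coeFn_toLp (p := 2) (𝕜 := ℝ) (volume : Measure unitInterval) Θ] with s h1 h2
  rw [h1, h2]
  rfl

/-- The pairing `∫₀¹ G(s)(u(s), v(s)) ds`. -/
def pairing₂ : C(unitInterval, Plane →L[ℝ] Plane →L[ℝ] ℝ) →L[ℝ] L2 →L[ℝ] L2 →L[ℝ] ℝ :=
  ((((ContinuousLinearMap.id ℝ (Plane →L[ℝ] ℝ)).lpPairing (volume : Measure unitInterval) 2 2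
    ).bilinearComp (ContinuousLinearMap.id ℝ _) restrictL).postcomp L2).comp
    ((((ContinuousLinearMap.id ℝ (Plane →L[ℝ] Plane →L[ℝ] ℝ)).holderL
      (volume : Measure unitInterval) ⊤ 2 2).comp
      (ContinuousMap.toLp (E := Plane →L[ℝ] Plane →L[ℝ] ℝ) ⊤ (volume : Measure unitInterval) ℝ)
      ).bilinearComp (ContinuousLinearMap.id ℝ _) restrictL)

/-- The pairing is Hölder multiplication `L^∞ · L² → L²` followed by the duality of `L²`. It is
therefore bounded in the sup norm of `G`, which makes the energy smooth in the path data. -/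
theorem pairing₂_apply (G : C(unitInterval, Plane →L[ℝ] Plane →L[ℝ] ℝ)) (u v : L2) :
    pairing₂ G u v = ∫ s : unitInterval,
      G s (u ((s : ℝ) : UnitAddCircle)) (v ((s : ℝ) : UnitAddCircle)) := by
  change (ContinuousLinearMap.id ℝ (Plane →L[ℝ] ℝ)).lpPairing (volume : Measure unitInterval) 2 2
    ((ContinuousLinearMap.id ℝ (Plane →L[ℝ] Plane →L[ℝ] ℝ)).holder 2
      (ContinuousMap.toLp (E := Plane →L[ℝ] Plane →L[ℝ] ℝ) ⊤ (volume : Measure unitInterval) ℝ G)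
      (restrictL u)) (restrictL v) = _
  rw [ContinuousLinearMap.lpPairing_eq_integral]
  refine integral_congr_ae ?_
  filter_upwards [coeFn_restrictL u, coeFn_restrictL v,
    ContinuousMap.coeFn_toLp (p := ⊤) (𝕜 := ℝ) (volume : Measure unitInterval) G,
    (ContinuousLinearMap.id ℝ (Plane →L[ℝ] Plane →L[ℝ] ℝ)).coeFn_holder (r := 2)
      (ContinuousMap.toLp (E := Plane →L[ℝ] Plane →L[ℝ] ℝ) ⊤ (volume : Measure unitInterval) ℝ G)
      (restrictL u)] with s h1 h2 h3 h4
  rw [h2, h4, h1, h3]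
  rfl

/-- Two paths, considered as a path in the product of two planes. -/
def pathPair : PathData × PathData →L[ℝ] C(unitInterval, Plane × Plane) :=
  LinearMap.mkContinuous
    { toFun := fun w => ⟨fun s => (path w.1 s, path w.2 s),
        (path w.1).continuous.prodMk (path w.2).continuous⟩
      map_add' := fun w w' => by ext1 s; simp
      map_smul' := fun c w => by ext1 s; simp } ‖path‖ (by
    intro w
    refine (ContinuousMap.norm_le _ (by positivity)).2 fun s => max_le ?_ ?_
    · exact ((path w.1).norm_coe_le_norm s).trans
        (path.le_of_opNorm_le_of_le le_rfl (norm_fst_le w))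
    · exact ((path w.2).norm_coe_le_norm s).trans
        (path.le_of_opNorm_le_of_le le_rfl (norm_snd_le w)))

theorem pathPair_apply (w : PathData × PathData) (s : unitInterval) :
    pathPair w s = (path w.1 s, path w.2 s) := rfl

theorem hasDerivAt_prim_toLp (u : C(UnitAddCircle, Plane)) {s : ℝ} :
    HasDerivAt (fun s : ℝ => ∫ r in (0 : ℝ)..s, u (r : UnitAddCircle)) (u (s : UnitAddCircle)) s :=
  by
  have hc : Continuous fun r : ℝ => u (r : UnitAddCircle) :=
    u.continuous.comp isLocalHomeomorph_coe_circle.continuous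
  exact hc.integral_hasStrictDerivAt 0 s |>.hasDerivAt

/-- The fundamental theorem of calculus along absolutely continuous paths. -/
theorem pairing_fderiv (f : C(Plane × Plane, ℝ)) (f₁ f₂ : C(Plane × Plane, Plane →L[ℝ] ℝ))
    (hf : ∀ v, HasFDerivAt f ((f₁ v).coprod (f₂ v)) v) (w : PathData × PathData) :
    pairing (f₁.comp (pathPair w)) w.1.2 + pairing (f₂.comp (pathPair w)) w.2.2 =
      f (path w.1 1, path w.2 1) - f (path w.1 0, path w.2 0) := by
  -- Both sides are continuous in the path data and continuous velocities are dense in `L²`, so the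
  -- identity reduces to the classical theorem for `C¹` paths.
  have hd : DenseRange (fun z : (Plane × C(UnitAddCircle, Plane)) ×
      (Plane × C(UnitAddCircle, Plane)) =>
      (((z.1.1, ContinuousMap.toLp 2 volume ℝ z.1.2),
        (z.2.1, ContinuousMap.toLp 2 volume ℝ z.2.2)) : PathData × PathData)) := by
    have h1 : DenseRange (ContinuousMap.toLp 2 volume ℝ : C(UnitAddCircle, Plane) → L2) :=
      ContinuousMap.toLp_denseRange Plane volume ℝ (by norm_num)
    have h2 : DenseRange (Prod.map id (ContinuousMap.toLp 2 volume ℝ) :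
      Plane × C(UnitAddCircle, Plane) → PathData) := denseRange_id.prodMap h1
    exact h2.prodMap h2
  have hc1 : Continuous fun w : PathData × PathData => f₁.comp (pathPair w) :=
    f₁.continuous_postcomp.comp pathPair.continuous
  have hc2 : Continuous fun w : PathData × PathData => f₂.comp (pathPair w) :=
    f₂.continuous_postcomp.comp pathPair.continuous
  have hev : ∀ s, Continuous fun w : PathData => path w s := fun s =>
    (ContinuousEvalConst.continuous_eval_const s).comp path.continuous
  have hL : Continuous fun w : PathData × PathData =>
      pairing (f₁.comp (pathPair w)) w.1.2 + pairing (f₂.comp (pathPair w)) w.2.2 := by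
    exact ((pairing.continuous.comp hc1).clm_apply (by fun_prop)).add
      ((pairing.continuous.comp hc2).clm_apply (by fun_prop))
  have hR : Continuous fun w : PathData × PathData =>
      f (path w.1 1, path w.2 1) - f (path w.1 0, path w.2 0) := by
    have := hev 0
    have := hev 1
    have := f.continuous
    fun_prop
  refine congrFun (hd.equalizer hL hR ?_) w
  funext z
  obtain ⟨⟨p, u⟩, ⟨q, v⟩⟩ := z
  simp only [Function.comp]
  set U : L2 := ContinuousMap.toLp 2 volume ℝ u with hU
  set V : L2 := ContinuousMap.toLp 2 volume ℝ v with hV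
  have hUae : ∀ u : C(UnitAddCircle, Plane), ∀ᵐ s : unitInterval,
      (ContinuousMap.toLp 2 volume ℝ u : L2) ((s : ℝ) : UnitAddCircle) =
        u ((s : ℝ) : UnitAddCircle) := fun u =>
    measurePreserving_unitInterval.quasiMeasurePreserving.ae_eq_comp
      (ContinuousMap.coeFn_toLp (p := 2) (𝕜 := ℝ) (volume : Measure UnitAddCircle) u)
  let cu : ℝ → Plane := fun s => p + ∫ r in (0 : ℝ)..s, u (r : UnitAddCircle)
  let cv : ℝ → Plane := fun s => q + ∫ r in (0 : ℝ)..s, v (r : UnitAddCircle)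
  have hcu : ∀ s : unitInterval, path (p, U) s = cu s := fun s => by
    rw [path_apply]
    exact congrArg (p + ·) (integral_congr_L2
      (ContinuousMap.coeFn_toLp (p := 2) (𝕜 := ℝ) (volume : Measure UnitAddCircle) u) s.2)
  have hcv : ∀ s : unitInterval, path (q, V) s = cv s := fun s => by
    rw [path_apply]
    exact congrArg (q + ·) (integral_congr_L2
      (ContinuousMap.coeFn_toLp (p := 2) (𝕜 := ℝ) (volume : Measure UnitAddCircle) v) s.2)
  have hdu : ∀ s : ℝ, HasDerivAt cu (u (s : UnitAddCircle)) s := fun s =>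
    (hasDerivAt_prim_toLp u).const_add p
  have hdv : ∀ s : ℝ, HasDerivAt cv (v (s : UnitAddCircle)) s := fun s =>
    (hasDerivAt_prim_toLp v).const_add q
  have hcuc : Continuous cu := continuous_iff_continuousAt.2 fun s => (hdu s).continuousAt
  have hcvc : Continuous cv := continuous_iff_continuousAt.2 fun s => (hdv s).continuousAt
  have hcoe : Continuous fun s : ℝ => (s : UnitAddCircle) :=
    isLocalHomeomorph_coe_circle.continuous
  have e1 : pairing (f₁.comp (pathPair ((p, U), (q, V)))) U =
      ∫ s in (0 : ℝ)..1, f₁ (cu s, cv s) (u (s : UnitAddCircle)) := by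
    rw [pairing_apply, ← integral_unitInterval_eq]
    refine integral_congr_ae ?_
    filter_upwards [hUae u] with s hs
    rw [hs, ContinuousMap.comp_apply, pathPair_apply, hcu, hcv]
  have e2 : pairing (f₂.comp (pathPair ((p, U), (q, V)))) V =
      ∫ s in (0 : ℝ)..1, f₂ (cu s, cv s) (v (s : UnitAddCircle)) := by
    rw [pairing_apply, ← integral_unitInterval_eq]
    refine integral_congr_ae ?_
    filter_upwards [hUae v] with s hs
    rw [hs, ContinuousMap.comp_apply, pathPair_apply, hcu, hcv]
  have c1 : Continuous fun s : ℝ => f₁ (cu s, cv s) (u (s : UnitAddCircle)) :=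
    (f₁.continuous.comp (hcuc.prodMk hcvc)).clm_apply (u.continuous.comp hcoe)
  have c2 : Continuous fun s : ℝ => f₂ (cu s, cv s) (v (s : UnitAddCircle)) :=
    (f₂.continuous.comp (hcuc.prodMk hcvc)).clm_apply (v.continuous.comp hcoe)
  rw [e1, e2, ← intervalIntegral.integral_add (c1.intervalIntegrable _ _)
    (c2.intervalIntegrable _ _)]
  have hF : ∀ s : ℝ, HasDerivAt (fun s => f (cu s, cv s)) (f₁ (cu s, cv s) (u (s : UnitAddCircle)) +
      f₂ (cu s, cv s) (v (s : UnitAddCircle))) s := fun s => by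
    have := (hf (cu s, cv s)).comp_hasDerivAt s ((hdu s).prodMk (hdv s))
    rw [ContinuousLinearMap.coprod_apply] at this
    exact this
  rw [intervalIntegral.integral_eq_sub_of_hasDerivAt (fun s _ => hF s)
    ((c1.add c2).intervalIntegrable _ _), hcu, hcu, hcv, hcv]
  simp

end Paths

/-! ### Line integrals of 1-forms and their variation -/

section LineIntegrals

/-- The determinant of two vectors in the plane. -/
def planeDet (v w : Plane) : ℝ := v.1 * w.2 - v.2 * w.1

/-- The integral of a 1-form along an absolutely continuous path. -/
def lineInt (θ : C(Plane, Plane →L[ℝ] ℝ)) (w : PathData) : ℝ :=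
  pairing (superpose θ (path w)) w.2

theorem lineInt_eq (θ : C(Plane, Plane →L[ℝ] ℝ)) (w : PathData) :
    lineInt θ w = ∫ s : unitInterval, θ (path w s) (w.2 ((s : ℝ) : UnitAddCircle)) :=
  pairing_apply _ _

theorem contDiff_lineInt (θ : C(Plane, Plane →L[ℝ] ℝ)) (hθ : ContDiff ℝ ∞ θ) :
    ContDiff ℝ ∞ (lineInt θ) := by
  have h1 : ContDiff ℝ ∞ fun w : PathData => superpose θ (path w) :=
    (contDiff_superpose θ hθ).comp path.contDiff
  have h2 : ContDiff ℝ ∞ pairing := ContinuousLinearMap.contDiff (𝕜 := ℝ)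
    (E := C(unitInterval, Plane →L[ℝ] ℝ)) (F := L2 →L[ℝ] ℝ) pairing
  exact (h2.comp h1).clm_apply contDiff_snd

/-- The derivative of a line integral: Stokes' formula for infinitesimal variations. -/
theorem fderiv_lineInt_apply (θ : C(Plane, Plane →L[ℝ] ℝ)) (hθ : ContDiff ℝ ∞ θ) {h : Plane → ℝ}
    (hh : ∀ v a b, fderiv ℝ θ v a b - fderiv ℝ θ v b a = h v * planeDet a b) (w w' : PathData) :
    fderiv ℝ (lineInt θ) w w' =
      (∫ s : unitInterval, h (path w s) *
        planeDet (path w' s) (w.2 ((s : ℝ) : UnitAddCircle))) +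
      (θ (path w 1) (path w' 1) - θ (path w 0) (path w' 0)) := by
  have hc' : Continuous (fderiv ℝ θ) := hθ.continuous_fderiv (by simp)
  have hd : ∀ v, HasFDerivAt θ (fderiv ℝ θ v) v := fun v =>
    (hθ.differentiable (by simp) v).hasFDerivAt
  let θ' : C(Plane, Plane →L[ℝ] Plane →L[ℝ] ℝ) := ⟨fderiv ℝ θ, hc'⟩
  -- The fundamental theorem for `θ_x(y)` along the pair `(w, w')` is an integration by parts: it
  -- trades the velocity of `w'` for `w'` itself plus the boundary term. What remains is the
  -- antisymmetrised derivative of `θ`, that is, its exterior derivative.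
  let f : C(Plane × Plane, ℝ) := ⟨fun v => θ v.1 v.2,
    (θ.continuous.comp continuous_fst).clm_apply continuous_snd⟩
  let f₁ : C(Plane × Plane, Plane →L[ℝ] ℝ) := ⟨fun v => (fderiv ℝ θ v.1).flip v.2,
    ((ContinuousLinearMap.flipₗᵢ ℝ Plane Plane ℝ).continuous.comp
      (hc'.comp continuous_fst)).clm_apply continuous_snd⟩
  let f₂ : C(Plane × Plane, Plane →L[ℝ] ℝ) := ⟨fun v => θ v.1, θ.continuous.comp continuous_fst⟩
  have hf : ∀ v, HasFDerivAt f ((f₁ v).coprod (f₂ v)) v := by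
    intro v
    have h1 : HasFDerivAt (fun v : Plane × Plane => θ v.1)
        ((fderiv ℝ θ v.1).comp (ContinuousLinearMap.fst ℝ Plane Plane)) v :=
      (hd v.1).comp v hasFDerivAt_fst
    have h2 := h1.clm_apply (hasFDerivAt_snd (𝕜 := ℝ) (p := v))
    refine h2.congr_fderiv ?_
    refine ContinuousLinearMap.ext fun a => ?_
    exact add_comm (θ v.1 a.2) (fderiv ℝ θ v.1 a.1 v.2)
  have hs := pairing_fderiv f f₁ f₂ hf (w, w')
  have hD : HasFDerivAt (fun w : PathData => superpose θ (path w))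
      ((applyL unitInterval Plane (Plane →L[ℝ] ℝ) (superpose θ' (path w))).comp path) w :=
    (hasFDerivAt_superpose θ θ' hd (path w)).comp w path.hasFDerivAt
  have hD2 : HasFDerivAt (fun w : PathData => pairing (superpose θ (path w)))
      (pairing.comp ((applyL unitInterval Plane (Plane →L[ℝ] ℝ)
        (superpose θ' (path w))).comp path)) w :=
    pairing.hasFDerivAt.comp w hD
  have hD3 := hD2.clm_apply (hasFDerivAt_snd (𝕜 := ℝ) (p := w))
  have e1 : fderiv ℝ (lineInt θ) w w' = pairing (superpose θ (path w)) w'.2 +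
      pairing (applyL unitInterval Plane (Plane →L[ℝ] ℝ) (superpose θ' (path w)) (path w')) w.2 := by
    have : fderiv ℝ (lineInt θ) w = _ := hD3.fderiv
    rw [this]
    simp
  have e2 : f₂.comp (pathPair (w, w')) = superpose θ (path w) := rfl
  have e3 : pairing (applyL unitInterval Plane (Plane →L[ℝ] ℝ) (superpose θ' (path w)) (path w')
      - f₁.comp (pathPair (w, w'))) w.2 = ∫ s : unitInterval, h (path w s) *
        planeDet (path w' s) (w.2 ((s : ℝ) : UnitAddCircle)) := by
    rw [pairing_apply]
    refine integral_congr_ae (Filter.Eventually.of_forall fun s => ?_)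
    exact hh (path w s) (path w' s) (w.2 ((s : ℝ) : UnitAddCircle))
  have e4 : f (path w 1, path w' 1) - f (path w 0, path w' 0) =
    θ (path w 1) (path w' 1) - θ (path w 0) (path w' 0) := rfl
  rw [map_sub, sub_apply] at e3
  simp only [e2] at hs
  rw [e1, ← e3, ← e4, ← hs]
  ring

/-- The fundamental theorem of calculus for a function on the plane. -/
theorem integral_fderiv_path (f : Plane → ℝ) (hf : ContDiff ℝ 1 f) (w : PathData) :
    ∫ s : unitInterval, fderiv ℝ f (path w s) (w.2 ((s : ℝ) : UnitAddCircle)) =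
      f (path w 1) - f (path w 0) := by
  have hc' : Continuous (fderiv ℝ f) := hf.continuous_fderiv (by simp)
  let g : C(Plane × Plane, ℝ) := ⟨fun v => f v.1, hf.continuous.comp continuous_fst⟩
  let g₁ : C(Plane × Plane, Plane →L[ℝ] ℝ) := ⟨fun v => fderiv ℝ f v.1, hc'.comp continuous_fst⟩
  have hg : ∀ v, HasFDerivAt g ((g₁ v).coprod ((0 : C(Plane × Plane, Plane →L[ℝ] ℝ)) v)) v := by
    intro v
    have h1 : HasFDerivAt (fun v : Plane × Plane => f v.1)
        ((fderiv ℝ f v.1).comp (ContinuousLinearMap.fst ℝ Plane Plane)) v :=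
      ((hf.differentiable (by simp) v.1).hasFDerivAt).comp v hasFDerivAt_fst
    refine h1.congr_fderiv ?_
    exact ContinuousLinearMap.ext fun a => (add_zero (fderiv ℝ f v.1 a.1)).symm
  have hs := pairing_fderiv g g₁ 0 hg (w, 0)
  have e : pairing (g₁.comp (pathPair (w, 0))) w.2 =
      ∫ s : unitInterval, fderiv ℝ f (path w s) (w.2 ((s : ℝ) : UnitAddCircle)) :=
    pairing_apply _ _
  rw [← e]
  simpa [g] using hs

end LineIntegrals

/-! ### Primitives of periodic area forms and of their transgressions -/

section Potentials

/-- Integration over the unit interval. -/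
def integralC : C(unitInterval, ℝ) →L[ℝ] ℝ :=
  LinearMap.mkContinuous
    { toFun := fun f => ∫ s, f s
      map_add' := fun f g => integral_add
        (f.continuous.integrable_of_hasCompactSupport (HasCompactSupport.of_compactSpace _))
        (g.continuous.integrable_of_hasCompactSupport (HasCompactSupport.of_compactSpace _))
      map_smul' := fun c f => integral_smul c _ } 1 (by
    intro f
    have := norm_integral_le_of_norm_le_const (μ := (volume : Measure unitInterval))
      (Filter.Eventually.of_forall fun s => f.norm_coe_le_norm s)
    simpa using this)

/-- The horizontal segment `s ↦ (s x, y)`. -/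
def segmentL : Plane →L[ℝ] C(unitInterval, Plane) :=
  LinearMap.mkContinuous
    { toFun := fun v => ⟨fun s => (v.1 * s, v.2), by fun_prop⟩
      map_add' := fun v w => by ext s <;> simp [add_mul]
      map_smul' := fun c v => by ext s <;> simp [mul_assoc] } 1 (by
    intro v
    rw [one_mul]
    refine (ContinuousMap.norm_le _ (by positivity)).2 fun s => max_le ?_ ?_
    · change ‖v.1 * (s : ℝ)‖ ≤ ‖v‖
      rw [norm_mul]
      have h1 : ‖(s : ℝ)‖ ≤ 1 := by
        rw [Real.norm_of_nonneg s.2.1]; exact s.2.2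
      calc ‖v.1‖ * ‖(s : ℝ)‖ ≤ ‖v.1‖ * 1 := by gcongr
        _ ≤ ‖v‖ := by rw [mul_one]; exact norm_fst_le v
    · exact norm_snd_le v)

/-- The primitive `∫₀ˣ h(r, y) dr` in the first variable. -/
def xPrim (h : Plane → ℝ) (v : Plane) : ℝ := ∫ r in (0 : ℝ)..v.1, h (r, v.2)

/-- The primitive `∫₀ʸ ∫₀¹ h(r, t) dr dt`. -/
def yPrim (h : Plane → ℝ) (y : ℝ) : ℝ := xPrim (fun v => xPrim h (1, v.1)) (y, 0)

variable {h : Plane → ℝ}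

/-- Rescaling gives `∫₀ˣ h(r, y) dr = x ∫₀¹ h(x s, y) ds`, where the segment depends linearly on
`(x, y)`. Smoothness follows from that of superposition, without differentiating under the integral.
-/
theorem contDiff_xPrim (hh : ContDiff ℝ ∞ h) : ContDiff ℝ ∞ (xPrim h) := by
  let H : C(Plane, ℝ) := ⟨h, hh.continuous⟩
  have h1 : xPrim h = fun v => v.1 * integralC (superpose H (segmentL v)) := by
    funext v
    have e1 : integralC (superpose H (segmentL v)) = ∫ s in (0 : ℝ)..1, h (v.1 * s, v.2) :=
      integral_unitInterval_eq fun s => h (v.1 * s, v.2)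
    have e2 := intervalIntegral.smul_integral_comp_mul_left (a := 0) (b := 1)
      (fun r : ℝ => h (r, v.2)) v.1
    rw [e1, xPrim, ← smul_eq_mul, e2, mul_zero, mul_one]
  rw [h1]
  have h2 : ContDiff ℝ ∞ fun v : Plane => superpose H (segmentL v) :=
    (contDiff_superpose H hh).comp segmentL.contDiff
  have h3 : ContDiff ℝ ∞ fun v : Plane => integralC (superpose H (segmentL v)) :=
    integralC.contDiff.comp h2
  exact contDiff_fst.mul h3

theorem contDiff_yPrim (hh : ContDiff ℝ ∞ h) : ContDiff ℝ ∞ (yPrim h) := by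
  have h1 : ContDiff ℝ ∞ fun v : Plane => xPrim h (1, v.1) :=
    (contDiff_xPrim hh).comp (contDiff_const.prodMk contDiff_fst)
  exact (contDiff_xPrim h1).comp (contDiff_id.prodMk contDiff_const)

theorem hasDerivAt_xPrim (hh : Continuous h) (v : Plane) :
    HasDerivAt (fun x => xPrim h (x, v.2)) (h v) v.1 := by
  have hc : Continuous fun r : ℝ => h (r, v.2) := by fun_prop
  exact (hc.integral_hasStrictDerivAt 0 v.1).hasDerivAt

theorem hasDerivAt_yPrim (hh : ContDiff ℝ ∞ h) (y : ℝ) :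
    HasDerivAt (yPrim h) (xPrim h (1, y)) y := by
  have h1 : Continuous fun v : Plane => xPrim h (1, v.1) :=
    (contDiff_xPrim hh).continuous.comp (by fun_prop)
  exact hasDerivAt_xPrim h1 (y, 0)

/-- The derivative in the second variable is left unevaluated, since it cancels in the exterior
derivative of `xPrim h dy`. -/
theorem fderiv_xPrim (hh : ContDiff ℝ ∞ h) (v a : Plane) :
    fderiv ℝ (xPrim h) v a = h v * a.1 + fderiv ℝ (xPrim h) v (0, 1) * a.2 := by
  have h1 : HasFDerivAt (xPrim h) (fderiv ℝ (xPrim h) v) v :=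
    ((contDiff_xPrim hh).differentiable (by simp) v).hasFDerivAt
  have h2 : HasDerivAt (fun x : ℝ => ((x, v.2) : Plane)) (1, 0) v.1 :=
    (hasDerivAt_id v.1).prodMk (hasDerivAt_const v.1 v.2)
  have h3 : HasDerivAt (fun x => xPrim h (x, v.2)) (fderiv ℝ (xPrim h) v (1, 0)) v.1 :=
    HasFDerivAt.comp_hasDerivAt (f := fun x : ℝ => ((x, v.2) : Plane)) v.1 h1 h2
  have h4 := h3.unique (hasDerivAt_xPrim hh.continuous v)
  have h5 : a = a.1 • ((1, 0) : Plane) + a.2 • ((0, 1) : Plane) := by ext <;> simp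
  conv_lhs => rw [h5, map_add, map_smul, map_smul, h4]
  simp [mul_comm]

/-- Invariance under the integer lattice. -/
def LatticePeriodic {F : Type*} (h : Plane → F) : Prop :=
  ∀ (v : Plane) (m n : ℤ), h (v + ((m : ℝ), (n : ℝ))) = h v

/-- Crossing `m` horizontal periods adds `m` copies of the integral over one period, and periodicity
in the second variable removes `n`. -/
theorem xPrim_add (hper : LatticePeriodic h) (hh : Continuous h) (v : Plane) (m n : ℤ) :
    xPrim h (v + ((m : ℝ), (n : ℝ))) = xPrim h v + m * xPrim h (1, v.2) := by
  have e1 : ∀ r, h (r, v.2 + n) = h (r, v.2) := fun r => by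
    simpa using hper (r, v.2) 0 n
  have hc : Continuous fun r : ℝ => h (r, v.2) := by fun_prop
  have hp : Function.Periodic (fun r : ℝ => h (r, v.2)) 1 := fun r => by
    simpa using hper (r, v.2) 1 0
  simp only [xPrim, Prod.fst_add, Prod.snd_add, e1]
  rw [← intervalIntegral.integral_add_adjacent_intervals (b := v.1)
    (hc.intervalIntegrable _ _) (hc.intervalIntegrable _ _)]
  have h2 := hp.intervalIntegral_add_zsmul_eq m v.1
  have h3 := hp.intervalIntegral_add_eq v.1 0
  rw [h3] at h2
  simpa using h2 fun _ _ => hc.intervalIntegrable _ _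

theorem xPrim_one_add (hper : LatticePeriodic h) (y : ℝ) (n : ℤ) :
    xPrim h (1, y + n) = xPrim h (1, y) := by
  have e1 : ∀ r, h (r, y + n) = h (r, y) := fun r => by
    simpa using hper (r, y) 0 n
  simp only [xPrim, e1]

/-- The row integral `y ↦ ∫₀¹ h(r, y) dr` is itself periodic, so the rule for `xPrim` applies to it.
-/
theorem yPrim_add (hper : LatticePeriodic h) (hh : ContDiff ℝ ∞ h) (y : ℝ) (n : ℤ) :
    yPrim h (y + n) = yPrim h y + n * yPrim h 1 := by
  have h1 : LatticePeriodic fun v : Plane => xPrim h (1, v.1) := fun v m n => by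
    exact xPrim_one_add hper v.1 m
  have h2 : Continuous fun v : Plane => xPrim h (1, v.1) :=
    (contDiff_xPrim hh).continuous.comp (by fun_prop)
  simpa [yPrim] using xPrim_add h1 h2 (y, 0) n 0

/-- The 1-form `(∫₀ˣ h) dy`, a primitive of `h dx ∧ dy`. -/
def potForm (h : Plane → ℝ) (hh : ContDiff ℝ ∞ h) : C(Plane, Plane →L[ℝ] ℝ) :=
  ⟨fun v => xPrim h v • ContinuousLinearMap.snd ℝ ℝ ℝ,
    (contDiff_xPrim hh).continuous.smul continuous_const⟩

theorem contDiff_potForm (hh : ContDiff ℝ ∞ h) : ContDiff ℝ ∞ (potForm h hh) :=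
  (contDiff_xPrim hh).smul contDiff_const

theorem fderiv_potForm (hh : ContDiff ℝ ∞ h) (v a b : Plane) :
    fderiv ℝ (potForm h hh) v a b - fderiv ℝ (potForm h hh) v b a = h v * planeDet a b := by
  have h1 : HasFDerivAt (xPrim h) (fderiv ℝ (xPrim h) v) v :=
    ((contDiff_xPrim hh).differentiable (by simp) v).hasFDerivAt
  have h2 : HasFDerivAt (potForm h hh)
      ((fderiv ℝ (xPrim h) v).smulRight (ContinuousLinearMap.snd ℝ ℝ ℝ)) v :=
    h1.smul_const (ContinuousLinearMap.snd ℝ ℝ ℝ)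
  rw [h2.fderiv]
  simp only [ContinuousLinearMap.smulRight_apply, smul_apply,
    ContinuousLinearMap.coe_snd', smul_eq_mul]
  rw [fderiv_xPrim hh v a, fderiv_xPrim hh v b, planeDet]
  ring

/-- The displacement of a path. -/
def displacement : L2 →L[ℝ] Plane :=
  ((ContinuousMap.evalCLM ℝ (1 : unitInterval)).comp path).comp (ContinuousLinearMap.inr ℝ Plane L2)

theorem displacement_apply (u : L2) : displacement u = prim u 1 := by
  change path (0, u) 1 = _
  rw [path_one, zero_add]

/-- The primitive of the transgression of `h dx ∧ dy`, as a function of paths in the plane. -/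
def areaPot (h : Plane → ℝ) (hh : ContDiff ℝ ∞ h) (w : PathData) : ℝ :=
  lineInt (potForm h hh) w - (displacement w.2).1 * yPrim h w.1.2

theorem contDiff_areaPot (hh : ContDiff ℝ ∞ h) : ContDiff ℝ ∞ (areaPot h hh) := by
  have h1 := contDiff_lineInt _ (contDiff_potForm hh)
  have h2 : ContDiff ℝ ∞ fun w : PathData => yPrim h w.1.2 :=
    (contDiff_yPrim hh).comp (contDiff_snd.comp contDiff_fst)
  have h3 : ContDiff ℝ ∞ fun w : PathData => (displacement w.2).1 :=
    contDiff_fst.comp (displacement.contDiff.comp contDiff_snd)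
  exact h1.sub (h3.mul h2)

/-- Since the path ends at its start plus `(a, b)`, Stokes' formula leaves the boundary term `a (∫₀¹
h(r, y) dr) dy`, with `y` the height of the starting point. This is the differential of `a * yPrim h
y`, the term subtracted in `areaPot`. The variation closes up, so the displacement stays fixed to
first order. -/
theorem fderiv_areaPot (hh : ContDiff ℝ ∞ h) (hper : LatticePeriodic h) (w w' : PathData)
    {a b : ℤ} (hw : prim w.2 1 = ((a : ℝ), (b : ℝ))) (hw' : prim w'.2 1 = 0) :
    fderiv ℝ (areaPot h hh) w w' = ∫ s : unitInterval, h (path w s) *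
        planeDet (path w' s) (w.2 ((s : ℝ) : UnitAddCircle)) := by
  have h1 : HasFDerivAt (lineInt (potForm h hh)) (fderiv ℝ (lineInt (potForm h hh)) w) w :=
    ((contDiff_lineInt _ (contDiff_potForm hh)).differentiable (by simp) w).hasFDerivAt
  have h2 : HasFDerivAt (fun w : PathData => yPrim h w.1.2)
      ((xPrim h (1, w.1.2)) • ((ContinuousLinearMap.snd ℝ ℝ ℝ).comp
        (ContinuousLinearMap.fst ℝ Plane L2))) w :=
    HasDerivAt.comp_hasFDerivAt (f := fun w : PathData => w.1.2) w (hasDerivAt_yPrim hh w.1.2)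
      ((ContinuousLinearMap.snd ℝ ℝ ℝ).comp (ContinuousLinearMap.fst ℝ Plane L2)).hasFDerivAt
  have h3 : HasFDerivAt (fun w : PathData => (displacement w.2).1)
      ((ContinuousLinearMap.fst ℝ ℝ ℝ).comp (displacement.comp
        (ContinuousLinearMap.snd ℝ Plane L2))) w :=
    ((ContinuousLinearMap.fst ℝ ℝ ℝ).comp (displacement.comp
      (ContinuousLinearMap.snd ℝ Plane L2))).hasFDerivAt
  have h4 := (h1.sub (h3.mul h2)).fderiv
  have h5 : fderiv ℝ (areaPot h hh) w = _ := h4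
  rw [h5]
  have e1 : path w 1 = w.1 + ((a : ℝ), (b : ℝ)) := by rw [path_one, hw]
  have e2 : path w' 1 = w'.1 := by rw [path_one, hw', add_zero]
  have e3 := fderiv_lineInt_apply _ (contDiff_potForm hh) (fderiv_potForm hh) w w'
  have e4 : potForm h hh (path w 1) (path w' 1) - potForm h hh (path w 0) (path w' 0) =
      a * xPrim h (1, w.1.2) * w'.1.2 := by
    rw [e1, e2, path_zero, path_zero]
    change xPrim h (w.1 + ((a : ℝ), (b : ℝ))) * w'.1.2 - xPrim h w.1 * w'.1.2 = _
    rw [xPrim_add hper hh.continuous]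
    ring
  rw [e4] at e3
  simp only [sub_apply, e3, add_apply, smul_apply, ContinuousLinearMap.comp_apply,
    ContinuousLinearMap.coe_fst', ContinuousLinearMap.coe_snd', displacement_apply, hw, hw',
    smul_eq_mul, Prod.fst_zero]
  ring

/-- The dependence of the primitive on the choice of the lift. -/
theorem areaPot_add (hh : ContDiff ℝ ∞ h) (hper : LatticePeriodic h) (p : Plane) (u : L2)
    {a b : ℤ} (hu : prim u 1 = ((a : ℝ), (b : ℝ))) (m n : ℤ) :
    areaPot h hh (p + ((m : ℝ), (n : ℝ)), u) =
      areaPot h hh (p, u) + yPrim h 1 * (b * m - a * n) := by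
  have e0 : ∀ s, path (p + ((m : ℝ), (n : ℝ)), u) s = path (p, u) s + ((m : ℝ), (n : ℝ)) := by
    intro s
    rw [path_apply, path_apply]
    exact add_right_comm _ _ _
  -- Translating the path by `(m, n)` adds `m dY` to the potential form. As `Y` grows by `b * yPrim
  -- h 1` along the path, the line integral gains `m b` times the total integral, while the
  -- correction term loses `a n` times it.
  let Y : Plane → ℝ := fun v => yPrim h v.2
  have hY : ContDiff ℝ ∞ Y := (contDiff_yPrim hh).comp contDiff_snd
  have hYd : ∀ v : Plane, fderiv ℝ Y v = xPrim h (1, v.2) • ContinuousLinearMap.snd ℝ ℝ ℝ :=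
    fun v => (HasDerivAt.comp_hasFDerivAt (f := fun v : Plane => v.2) v (hasDerivAt_yPrim hh v.2)
      (ContinuousLinearMap.snd ℝ ℝ ℝ).hasFDerivAt).fderiv
  have hY' : Continuous (fderiv ℝ Y) := hY.continuous_fderiv (by simp)
  have hsum : lineInt (potForm h hh) (p + ((m : ℝ), (n : ℝ)), u) =
      lineInt (potForm h hh) (p, u) + m * (Y (path (p, u) 1) - Y (path (p, u) 0)) := by
    rw [← integral_fderiv_path Y (hY.of_le (by simp)) (p, u)]
    let A : C(unitInterval, Plane →L[ℝ] ℝ) := superpose ⟨fderiv ℝ Y, hY'⟩ (path (p, u))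
    have hA : pairing A u = ∫ s : unitInterval,
        fderiv ℝ Y (path (p, u) s) (u ((s : ℝ) : UnitAddCircle)) := pairing_apply _ _
    rw [← hA]
    have : superpose (potForm h hh) (path (p + ((m : ℝ), (n : ℝ)), u)) =
        superpose (potForm h hh) (path (p, u)) + (m : ℝ) • A := by
      ext1 s
      change xPrim h (path (p + ((m : ℝ), (n : ℝ)), u) s) • ContinuousLinearMap.snd ℝ ℝ ℝ =
        xPrim h (path (p, u) s) • ContinuousLinearMap.snd ℝ ℝ ℝ +
          (m : ℝ) • fderiv ℝ Y (path (p, u) s)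
      rw [e0, xPrim_add hper hh.continuous, hYd, smul_smul, add_smul]
    rw [lineInt, this, map_add, map_smul]
    rfl
  have e1 : Y (path (p, u) 1) - Y (path (p, u) 0) = b * yPrim h 1 := by
    rw [path_one, path_zero, hu]
    simp only [Y, Prod.snd_add]
    rw [yPrim_add hper hh]
    ring
  rw [areaPot, areaPot, hsum, e1, displacement_apply, hu]
  simp only [Prod.snd_add]
  rw [yPrim_add hper hh]
  ring

end Potentials

/-! ### Lifts of loops -/

section Lifts

theorem coe_eq_coe_iff_exists_int (x y : ℝ) :
    (x : UnitAddCircle) = (y : UnitAddCircle) ↔ ∃ n : ℤ, x = y + n := by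
  rw [← sub_eq_zero, ← AddCircle.coe_sub, AddCircle.coe_eq_zero_iff]
  constructor
  · rintro ⟨n, hn⟩
    refine ⟨n, ?_⟩
    simp only [zsmul_eq_mul, mul_one] at hn
    linarith
  · rintro ⟨n, hn⟩
    refine ⟨n, ?_⟩
    simp only [zsmul_eq_mul, mul_one]
    linarith

theorem proj_eq_proj_iff (v w : Plane) :
    proj v = proj w ↔ ∃ m n : ℤ, v = w + ((m : ℝ), (n : ℝ)) := by
  constructor
  · intro h
    obtain ⟨m, hm⟩ := (coe_eq_coe_iff_exists_int _ _).1 (congrArg Prod.fst h)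
    obtain ⟨n, hn⟩ := (coe_eq_coe_iff_exists_int _ _).1 (congrArg Prod.snd h)
    exact ⟨m, n, Prod.ext hm hn⟩
  · rintro ⟨m, n, rfl⟩
    exact Prod.ext ((coe_eq_coe_iff_exists_int _ _).2 ⟨m, rfl⟩)
      ((coe_eq_coe_iff_exists_int _ _).2 ⟨n, rfl⟩)

theorem proj_surjective : Function.Surjective proj := by
  rintro ⟨a, b⟩
  obtain ⟨x, rfl⟩ := QuotientAddGroup.mk_surjective a
  obtain ⟨y, rfl⟩ := QuotientAddGroup.mk_surjective b
  exact ⟨(x, y), rfl⟩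

theorem latticePeriodic_comp_proj {F : Type*} (f : Torus → F) :
    LatticePeriodic fun v => f (proj v) := fun _ m n =>
  congrArg f ((proj_eq_proj_iff _ _).2 ⟨m, n, rfl⟩)

/-- The path `w` in the plane is a lift of the loop `γ`, parametrised by `[0, 1]`. -/
def IsLift (γ : Loop) (w : PathData) : Prop := proj w.1 = Loop.pt γ 0 ∧ w.2 = γ.1.1.2

theorem exists_isLift (γ : Loop) : ∃ w, IsLift γ w := by
  obtain ⟨p, hp⟩ := proj_surjective (Loop.pt γ 0)
  exact ⟨(p, γ.1.1.2), hp, rfl⟩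

/-- A lift of a loop. -/
def chosenLift (γ : Loop) : PathData := (exists_isLift γ).choose

theorem isLift_chosenLift (γ : Loop) : IsLift γ (chosenLift γ) := (exists_isLift γ).choose_spec

theorem IsLift.proj_path {γ : Loop} {w : PathData} (h : IsLift γ w) (s : unitInterval) :
    proj (path w s) = Loop.pt γ ((s : ℝ) : UnitAddCircle) := by
  rw [path_apply, map_add, h.1, h.2]
  exact (γ.1.2 s s.2).symm

theorem IsLift.vel {γ : Loop} {w : PathData} (h : IsLift γ w) (s : UnitAddCircle) :
    Loop.vel γ s = w.2 s := by
  rw [h.2]; rfl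

/-- The projected path is closed, so its endpoints differ by a lattice vector. -/
theorem IsLift.exists_displacement {γ : Loop} {w : PathData} (h : IsLift γ w) :
    ∃ a b : ℤ, prim w.2 1 = ((a : ℝ), (b : ℝ)) := by
  have h1 : proj (path w 1) = proj (path w 0) := by
    rw [h.proj_path, h.proj_path]
    have : (((1 : unitInterval) : ℝ) : UnitAddCircle) = (((0 : unitInterval) : ℝ) : UnitAddCircle) :=
      (coe_eq_coe_iff_exists_int _ _).2 ⟨1, by simp⟩
    rw [this]
  obtain ⟨m, n, hmn⟩ := (proj_eq_proj_iff _ _).1 h1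
  refine ⟨m, n, ?_⟩
  rw [path_one, path_zero] at hmn
  exact add_left_cancel hmn

theorem IsLift.eq_add {γ : Loop} {w w' : PathData} (h : IsLift γ w) (h' : IsLift γ w') :
    ∃ m n : ℤ, w' = (w.1 + ((m : ℝ), (n : ℝ)), w.2) := by
  obtain ⟨m, n, hmn⟩ := (proj_eq_proj_iff _ _).1 (h'.1.trans h.1.symm)
  exact ⟨m, n, Prod.ext hmn (h'.2.trans h.2.symm)⟩

/-- The path data of a tangent vector to the loop space. -/
def liftL : LoopVec →L[ℝ] PathData :=
  ((((ContinuousMap.evalCLM ℝ (0 : UnitAddCircle)).comp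
    (ContinuousLinearMap.fst ℝ C(UnitAddCircle, Plane) L2)).prod
    (ContinuousLinearMap.snd ℝ C(UnitAddCircle, Plane) L2)).comp H1.subtypeL).comp
    (ContinuousLinearMap.fst ℝ H1 ℝ)

theorem path_liftL (e : LoopVec) (s : unitInterval) :
    path (liftL e) s = LoopVec.field e ((s : ℝ) : UnitAddCircle) :=
  (e.1.2 s s.2).symm

theorem prim_liftL (e : LoopVec) : prim (liftL e).2 1 = 0 := by
  have h1 := path_liftL e 1
  have h2 := path_liftL e 0
  have : (((1 : unitInterval) : ℝ) : UnitAddCircle) = (((0 : unitInterval) : ℝ) : UnitAddCircle) :=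
    (coe_eq_coe_iff_exists_int _ _).2 ⟨1, by simp⟩
  rw [this, ← h2, path_one, path_zero] at h1
  simpa using h1

/-- This transports calculus in a chart of the loop space to calculus on path data; it holds for
every `e`, not only near `0`. -/
theorem IsLift.add {γ : Loop} {w : PathData} (h : IsLift γ w) (e : LoopVec) :
    IsLift (γ + freeExp e) (w + liftL e) := by
  refine ⟨?_, ?_⟩
  · change proj (w.1 + e.1.1.1 0) = Loop.pt γ 0 + proj (e.1.1.1 0)
    rw [map_add, h.1]
  · change w.2 + e.1.1.2 = γ.1.1.2 + e.1.1.2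
    rw [h.2]

theorem TwoForm.apply_eq (σ : TwoForm) (q : Torus) (a b : Plane) :
    σ.toFun q a b = σ.toFun q (1, 0) (0, 1) * planeDet a b := by
  have hsk : σ.toFun q (0, 1) (1, 0) = -σ.toFun q (1, 0) (0, 1) := by
    have h := σ.alt q ((1, 0) + (0, 1))
    simp only [map_add, add_apply, σ.alt] at h
    linarith
  have ha : a = a.1 • ((1, 0) : Plane) + a.2 • ((0, 1) : Plane) := by ext <;> simp
  have hb : b = b.1 • ((1, 0) : Plane) + b.2 • ((0, 1) : Plane) := by ext <;> simp
  conv_lhs => rw [ha, hb]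
  simp only [map_add, map_smul, add_apply, smul_apply, σ.alt, hsk, smul_eq_mul, planeDet]
  ring

/-- The coefficient of a 2-form, as a function on the plane. -/
def TwoForm.coeff (σ : TwoForm) (v : Plane) : ℝ := σ.toFun (proj v) (1, 0) (0, 1)

theorem TwoForm.latticePeriodic_coeff (σ : TwoForm) : LatticePeriodic σ.coeff :=
  latticePeriodic_comp_proj fun q => σ.toFun q (1, 0) (0, 1)

theorem TwoForm.contDiff_coeff (σ : TwoForm) : ContDiff ℝ ∞ σ.coeff :=
  ((hasTranslationCharts_proj.contDiff_comp σ.smooth).clm_apply contDiff_const).clm_apply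
    contDiff_const

/-- The primitive of the transgression of `σ`. -/
def TwoForm.pot (σ : TwoForm) : PathData → ℝ := areaPot σ.coeff σ.contDiff_coeff

theorem TwoForm.contDiff_pot (σ : TwoForm) : ContDiff ℝ ∞ σ.pot := contDiff_areaPot _

theorem transgression_eq (σ : TwoForm) {γ : Loop} {w : PathData} (h : IsLift γ w) (e : LoopVec) :
    transgression σ γ e = ∫ s : unitInterval, σ.coeff (path w s) *
      planeDet (path (liftL e) s) (w.2 ((s : ℝ) : UnitAddCircle)) := by
  change ∫ s : UnitAddCircle, σ.toFun (Loop.pt γ s) (LoopVec.field e s) (Loop.vel γ s) = _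
  rw [integral_circle_eq]
  refine integral_congr_ae (Filter.Eventually.of_forall fun s => ?_)
  simp only [path_liftL, TwoForm.coeff, h.proj_path, h.vel]
  exact σ.apply_eq _ _ _

/-- The differential is correct only along `liftL e`: these variations have zero displacement, and
the lift of a loop has integral displacement, as `fderiv_areaPot` requires. -/
theorem fderiv_pot (σ : TwoForm) {γ : Loop} {w : PathData} (h : IsLift γ w) (e : LoopVec) :
    fderiv ℝ σ.pot w (liftL e) = transgression σ γ e := by
  obtain ⟨a, b, hab⟩ := h.exists_displacement
  rw [transgression_eq σ h e]
  exact fderiv_areaPot _ σ.latticePeriodic_coeff w (liftL e) hab (prim_liftL e)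

theorem contDiff_liftL : ContDiff ℝ ∞ liftL :=
  ContinuousLinearMap.contDiff (𝕜 := ℝ) (E := LoopVec) (F := PathData) liftL

theorem contDiff_add_liftL {f : PathData → ℝ} (hf : ContDiff ℝ ∞ f) (w : PathData) :
    ContDiff ℝ ∞ fun e => f (w + liftL e) :=
  hf.comp (contDiff_const.add contDiff_liftL)

theorem fderiv_add_liftL {f : PathData → ℝ} {w : PathData} {e : LoopVec}
    (hf : DifferentiableAt ℝ f (w + liftL e)) :
    fderiv ℝ (fun e => f (w + liftL e)) e = (fderiv ℝ f (w + liftL e)).comp liftL :=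
  (HasFDerivAt.comp (f := fun e => w + liftL e) e hf.hasFDerivAt
    (liftL.hasFDerivAt.const_add w)).fderiv

theorem transgression_chart (σ : TwoForm) {γ : Loop} {w : PathData} (h : IsLift γ w)
    (e : LoopVec) :
    transgression σ (γ + freeExp e) = fderiv ℝ (fun e => σ.pot (w + liftL e)) e := by
  rw [fderiv_add_liftL (σ.contDiff_pot.differentiable (by simp) _)]
  exact ContinuousLinearMap.ext fun ζ => (fderiv_pot σ (h.add e) ζ).symm

/-- The period of the transgression of `σ` over the circles of lifts. -/
theorem pot_eq_of_isLift (σ : TwoForm) {γ : Loop} {w w' : PathData} (h : IsLift γ w)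
    (h' : IsLift γ w') : ∃ n : ℤ, σ.pot w' = σ.pot w + n * yPrim σ.coeff 1 := by
  obtain ⟨a, b, hab⟩ := h.exists_displacement
  obtain ⟨j, n, rfl⟩ := h.eq_add h'
  refine ⟨b * j - a * n, ?_⟩
  have := areaPot_add σ.contDiff_coeff σ.latticePeriodic_coeff w.1 w.2 hab j n
  rw [TwoForm.pot, this]
  push_cast
  ring

/-- Fubini, with the first coordinate as the inner variable to match the definition of `yPrim`. It
identifies the jump constant of the potential with the integral of the form. -/
theorem integral_torus_eq (f : Torus → ℝ) (hf : Continuous f) :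
    ∫ q, f q = yPrim (fun v => f (proj v)) 1 := by
  have h1 : Integrable f ((volume : Measure UnitAddCircle).prod volume) :=
    hf.integrable_of_hasCompactSupport (HasCompactSupport.of_compactSpace _)
  have h2 := integral_prod_symm f h1
  have h3 : ∀ g : UnitAddCircle → ℝ, ∫ s, g s = ∫ r in (0 : ℝ)..1, g (r : UnitAddCircle) := by
    intro g
    have := AddCircle.intervalIntegral_preimage (1 : ℝ) 0 g
    rw [zero_add] at this
    exact this.symm
  refine h2.trans ?_
  rw [h3]
  simp only [h3]
  rfl

theorem TwoForm.integral_eq (σ : TwoForm) : σ.integral = yPrim σ.coeff 1 :=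
  integral_torus_eq (fun q => σ.toFun q (1, 0) (0, 1))
    ((σ.smooth.continuous.clm_apply continuous_const).clm_apply continuous_const)

end Lifts

/-! ### The action -/

section Action

variable (g : TorusMetric)

/-- The metric, as a function on the plane. -/
def TorusMetric.coeff : C(Plane, Plane →L[ℝ] Plane →L[ℝ] ℝ) :=
  ⟨fun v => g.toFun (proj v), g.smooth.continuous.comp continuous_proj⟩

/-- Twice the kinetic energy of a path. -/
def TorusMetric.energy (w : PathData) : ℝ :=
  pairing₂ (superpose g.coeff (path w)) w.2 w.2

/-- The velocity enters through a bounded bilinear pairing, and the position only through the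
superposition operator of the smooth metric. -/
theorem TorusMetric.contDiff_energy : ContDiff ℝ ∞ g.energy := by
  have h0 : ContDiff ℝ ∞ g.coeff := hasTranslationCharts_proj.contDiff_comp g.smooth
  have h1 : ContDiff ℝ ∞ fun w : PathData => superpose g.coeff (path w) :=
    (contDiff_superpose g.coeff h0).comp path.contDiff
  exact ((pairing₂.contDiff.comp h1).clm_apply contDiff_snd).clm_apply contDiff_snd

theorem TorusMetric.energy_eq (w : PathData) : g.energy w = ∫ s : unitInterval,
    g.toFun (proj (path w s)) (w.2 ((s : ℝ) : UnitAddCircle))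
      (w.2 ((s : ℝ) : UnitAddCircle)) :=
  pairing₂_apply _ _ _

theorem integrable_kinetic (γ : Loop) :
    Integrable (fun s => g.toFun (Loop.pt γ s) (Loop.vel γ s) (Loop.vel γ s)) volume := by
  obtain ⟨C, hC⟩ := (isCompact_univ (X := Torus)).exists_bound_of_continuousOn
    (f := g.toFun) g.smooth.continuous.continuousOn
  have h2 : Integrable (fun s => ‖γ.1.1.2 s‖ ^ 2) volume := by
    simpa using (Lp.memLp γ.1.1.2).integrable_norm_pow (by norm_num)
  refine Integrable.mono' (h2.const_mul C) ?_ (Filter.Eventually.of_forall fun s => ?_)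
  · have hc : Continuous fun s => g.toFun (Loop.pt γ s) :=
      g.smooth.continuous.comp γ.1.1.1.continuous
    have hv := (integrable_L2 γ.1.1.2).aestronglyMeasurable
    have h3 := ContinuousLinearMap.aestronglyMeasurable_comp₂ (𝕜 := ℝ)
      (E := Plane →L[ℝ] Plane →L[ℝ] ℝ) (F := Plane) (G := Plane →L[ℝ] ℝ)
      (ContinuousLinearMap.id ℝ (Plane →L[ℝ] Plane →L[ℝ] ℝ))
      (hc.aestronglyMeasurable (μ := volume)) hv
    exact (ContinuousLinearMap.id ℝ (Plane →L[ℝ] ℝ)).aestronglyMeasurable_comp₂ h3 hv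
  · refine (ContinuousLinearMap.le_opNorm₂ _ _ _).trans ?_
    have := hC (Loop.pt γ s) (mem_univ _)
    calc ‖g.toFun (Loop.pt γ s)‖ * ‖Loop.vel γ s‖ * ‖Loop.vel γ s‖
        ≤ C * ‖Loop.vel γ s‖ * ‖Loop.vel γ s‖ := by gcongr
      _ = C * ‖γ.1.1.2 s‖ ^ 2 := by rw [mul_assoc, sq]; rfl

theorem action_eq (k : ℝ) {γ : Loop} {w : PathData} (h : IsLift γ w) :
    action g k γ = γ.2 * (1 / (2 * γ.2 ^ 2) * g.energy w + k) := by
  rw [action, integral_add ((integrable_kinetic g γ).const_mul _) (integrable_const k),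
    integral_const_mul, integral_const, g.energy_eq, integral_circle_eq]
  simp only [h.vel, ← h.proj_path]
  simp

/-- On path data the energy is smooth, so the only restriction comes from dividing by the squared
period. -/
theorem contDiffAt_action (k : ℝ) {γ : Loop} (hγ : γ ∈ freeLoops) :
    ContDiffAt ℝ ∞ (fun e => action g k (γ + freeExp e)) 0 := by
  obtain ⟨w, h⟩ := exists_isLift γ
  have h1 : (fun e : LoopVec => action g k (γ + freeExp e)) = fun e => (γ.2 + e.2) *
      (1 / (2 * (γ.2 + e.2) ^ 2) * g.energy (w + liftL e) + k) :=
    funext fun e => action_eq g k (h.add e)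
  rw [h1]
  have hpos : 0 < γ.2 := hγ
  have h2 : ContDiffAt ℝ ∞ (fun e : LoopVec => g.energy (w + liftL e)) 0 :=
    (contDiff_add_liftL g.contDiff_energy w).contDiffAt
  have h3 : ContDiffAt ℝ ∞ (fun e : LoopVec => γ.2 + e.2) 0 := by fun_prop
  have h4 : ContDiffAt ℝ ∞ (fun e : LoopVec => 1 / (2 * (γ.2 + e.2) ^ 2)) 0 :=
    contDiffAt_const.div (contDiffAt_const.mul (h3.pow 2)) (by
      simp only [Prod.snd_zero, add_zero]; positivity)
  exact h3.mul ((h4.mul h2).add contDiffAt_const)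

/-- The action is a function on loops and the transgression has the primitive `σ.pot` on lifts;
their sum is a local primitive. It is claimed only near `0`, where the period remains positive. -/
theorem eta_chart (σ : TwoForm) (k : ℝ) {γ : Loop} (hγ : γ ∈ freeLoops) {w : PathData}
    (h : IsLift γ w) : ∀ᶠ e in 𝓝 (0 : LoopVec), eta g σ k (γ + freeExp e) =
      fderiv ℝ (fun e => action g k (γ + freeExp e) + σ.pot (w + liftL e)) e := by
  have h1 := contDiffAt_action g k hγ
  have h2 := hasTranslationCharts_freeExp.extDer_eventually h1
    (Filter.Eventually.of_forall fun _ => rfl)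
  filter_upwards [h2, (h1.of_le (m := 1) (by simp)).eventually (by simp)] with e he hde
  have h3 := (contDiff_add_liftL σ.contDiff_pot w).differentiable (by simp) e
  have h4 := ((hde.differentiableAt (by simp)).hasFDerivAt.add h3.hasFDerivAt).fderiv
  have h5 : fderiv ℝ (fun e => action g k (γ + freeExp e) + σ.pot (w + liftL e)) e = _ := h4
  rw [h5, ← he, ← transgression_chart σ h e]
  rfl

theorem contDiffAt_eta_primitive (σ : TwoForm) (k : ℝ) {γ : Loop} (hγ : γ ∈ freeLoops)
    (w : PathData) :
    ContDiffAt ℝ ∞ (fun e => action g k (γ + freeExp e) + σ.pot (w + liftL e)) 0 :=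
  (contDiffAt_action g k hγ).add (contDiff_add_liftL σ.contDiff_pot w).contDiffAt

theorem eta_closed (σ : TwoForm) (k : ℝ) : eta g σ k ∈ closedForms freeLoops := by
  intro γ hγ
  obtain ⟨w, h⟩ := exists_isLift γ
  exact hasTranslationCharts_freeExp.closed_of_primitive (contDiffAt_eta_primitive g σ k hγ w)
    (eta_chart g σ k hγ h)

theorem transgression_closed (σ : TwoForm) (U : Set Loop) : transgression σ ∈ closedForms U := by
  intro γ _
  obtain ⟨w, h⟩ := exists_isLift γ
  exact hasTranslationCharts_freeExp.closed_of_primitive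
    (contDiff_add_liftL σ.contDiff_pot w).contDiffAt
    (Filter.Eventually.of_forall fun e => transgression_chart σ h e)

end Action

/-! ### Components and straight loops -/

section Straight

/-- After rescaling time to `[0, 1]`, the curve `c` and the path `w` cover the same loop. Moved to a
common starting point they coincide coordinatewise by uniqueness of lifts, hence have the same
displacement. -/
theorem displacement_of_mem_component {a b : ℤ} {γ : Loop} (hγ : γ ∈ component a b)
    {w : PathData} (h : IsLift γ w) : prim w.2 1 = ((a : ℝ), (b : ℝ)) := by
  obtain ⟨hpos, c, hc, hcγ, hcT⟩ := hγ
  have hT : γ.2 ≠ 0 := (show 0 < γ.2 from hpos).ne'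
  have key : ∀ s ∈ Icc (0 : ℝ) 1, proj (c (γ.2 * s)) = proj (w.1 + prim w.2 s) := by
    intro s hs
    rw [hcγ, Loop.curve, mul_div_cancel_left₀ _ hT]
    exact (h.proj_path ⟨s, hs⟩).symm
  have k0 : proj (c 0) = proj w.1 := by
    simpa using key 0 (left_mem_Icc.2 zero_le_one)
  have key' : ∀ s ∈ Icc (0 : ℝ) 1, proj (c (γ.2 * s)) = proj (c 0 + prim w.2 s) := by
    intro s hs
    rw [key s hs, map_add, map_add, k0]
  have hp := continuousOn_prim w.2
  have e1 := eqOn_of_coe_eqOn (f := fun s => (c (γ.2 * s)).1) (h := fun s => (c 0 + prim w.2 s).1)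
    (by fun_prop) (continuous_fst.comp_continuousOn (continuousOn_const.add hp)) (by simp)
    (fun s hs => congrArg Prod.fst (key' s hs)) (right_mem_Icc.2 zero_le_one)
  have e2 := eqOn_of_coe_eqOn (f := fun s => (c (γ.2 * s)).2) (h := fun s => (c 0 + prim w.2 s).2)
    (by fun_prop) (continuous_snd.comp_continuousOn (continuousOn_const.add hp)) (by simp)
    (fun s hs => congrArg Prod.snd (key' s hs)) (right_mem_Icc.2 zero_le_one)
  have e3 : c (γ.2 * 1) = c 0 + prim w.2 1 := Prod.ext e1 e2
  rw [mul_one, hcT, add_comm] at e3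
  exact (add_left_cancel e3).symm

theorem constLoop_mem (v : Plane) : (ContinuousMap.const UnitAddCircle v, (0 : L2)) ∈ H1 := by
  intro s hs
  simp [prim_zero hs]

/-- Constant vector fields along loops. -/
def constL : Plane →L[ℝ] LoopVec :=
  LinearMap.mkContinuous
    { toFun := fun v => (⟨_, constLoop_mem v⟩, 0)
      map_add' := fun v w => by
        refine Prod.ext (Subtype.ext (Prod.ext ?_ ?_)) ?_
        · rfl
        · exact (add_zero (0 : L2)).symm
        · exact (add_zero (0 : ℝ)).symm
      map_smul' := fun c v => by
        refine Prod.ext (Subtype.ext (Prod.ext ?_ ?_)) ?_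
        · rfl
        · exact (smul_zero (A := L2) c).symm
        · exact (smul_zero (A := ℝ) c).symm } 1 (by
    intro v
    rw [one_mul]
    refine max_le (max_le ?_ ?_) ?_
    · exact (ContinuousMap.norm_le _ (norm_nonneg v)).2 fun _ => le_rfl
    · exact (norm_zero (E := L2)).le.trans (norm_nonneg v)
    · exact (norm_zero (E := ℝ)).le.trans (norm_nonneg v))

theorem liftL_constL (v : Plane) : liftL (constL v) = (v, 0) := rfl

/-- In translation charts the family of straight loops is the linear map `constL`, which gives its
smoothness and its differential together. -/
theorem straight_add (a b : ℤ) (T : ℝ) (q : Torus) (v : Plane) :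
    straight a b T (q + proj v) = straight a b T q + freeExp (constL v) := by
  refine Prod.ext (Subtype.ext (Prod.ext ?_ ?_)) ?_
  · ext1 s
    exact add_right_comm _ _ _
  · exact (add_zero (Lp.const 2 (volume : Measure UnitAddCircle) ((a : ℝ), (b : ℝ)) : L2)).symm
  · exact (add_zero T).symm

/-- The constant velocity `(a, b)`. -/
def constVel (a b : ℤ) : L2 := Lp.const 2 (volume : Measure UnitAddCircle) ((a : ℝ), (b : ℝ))

theorem isLift_straight (a b : ℤ) (T : ℝ) (v : Plane) :
    IsLift (straight a b T (proj v)) (v, constVel a b) := by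
  refine ⟨?_, rfl⟩
  change proj v = proj v + (a • (0 : UnitAddCircle), b • (0 : UnitAddCircle))
  simp

theorem straight_mem_freeLoops (a b : ℤ) {T : ℝ} (hT : 0 < T) (q : Torus) :
    straight a b T q ∈ freeLoops := hT

theorem straight_mem_component (a b : ℤ) {T : ℝ} (hT : 0 < T) (q : Torus) :
    straight a b T q ∈ component a b := by
  obtain ⟨p, rfl⟩ := proj_surjective q
  refine ⟨hT, fun t => p + (t / T) • ((a : ℝ), (b : ℝ)), by fun_prop, fun t => ?_, ?_⟩
  · rw [map_add]
    change proj p + _ = proj p + (a • (((t / T : ℝ)) : UnitAddCircle), b • ((t / T : ℝ) : UnitAddCircle))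
    congr 1
    refine Prod.ext ?_ ?_
    · change (((t / T) • (a : ℝ) : ℝ) : UnitAddCircle) = a • ((t / T : ℝ) : UnitAddCircle)
      rw [← AddCircle.coe_zsmul, zsmul_eq_mul, smul_eq_mul, mul_comm]
    · change (((t / T) • (b : ℝ) : ℝ) : UnitAddCircle) = b • ((t / T : ℝ) : UnitAddCircle)
      rw [← AddCircle.coe_zsmul, zsmul_eq_mul, smul_eq_mul, mul_comm]
  · change p + (T / T) • ((a : ℝ), (b : ℝ)) = ((a : ℝ), (b : ℝ)) + (p + (0 / T) • ((a : ℝ), (b : ℝ)))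
    rw [div_self hT.ne', one_smul, zero_div, zero_smul, add_zero, add_comm]

theorem prim_constVel (a b : ℤ) : prim (constVel a b) 1 = ((a : ℝ), (b : ℝ)) :=
  displacement_of_mem_component (straight_mem_component a b one_pos (proj 0))
    (isLift_straight a b 1 0)

theorem straight_hasMFDerivAt (a b : ℤ) (T : ℝ) (q : Torus) :
    ContMDiffAt 𝓘(ℝ, Plane) 𝓘(ℝ, LoopVec) ∞ (straight a b T) q ∧
      HasMFDerivAt 𝓘(ℝ, Plane) 𝓘(ℝ, LoopVec) (straight a b T) q constL :=
  hasTranslationCharts_proj.hasMFDerivAt_of_linear hasTranslationCharts_freeExp constL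
    (straight_add a b T q)

theorem pullback_straight (a b : ℤ) (T : ℝ) (α : OneForm LoopVec Loop) (q : Torus) :
    pullback (straight a b T) α q = (α (straight a b T q)).comp constL :=
  congrArg (fun L : Plane →L[ℝ] LoopVec => (α (straight a b T q)).comp L)
    (straight_hasMFDerivAt a b T q).2.mfderiv

theorem pullback_straight_tau (a b : ℤ) (T : ℝ) :
    pullback (straight a b T) tau = (b : ℝ) • dq1 - (a : ℝ) • dq2 := by
  funext q
  rw [pullback_straight]
  refine ContinuousLinearMap.ext fun v => ?_
  change ∫ s : UnitAddCircle, areaForm.toFun (Loop.pt (straight a b T q) s) v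
    (constVel a b s) = (b : ℝ) * v.1 - (a : ℝ) * v.2
  have h : (fun s : UnitAddCircle => areaForm.toFun (Loop.pt (straight a b T q) s) v
      (constVel a b s)) =ᵐ[volume] fun _ => (b : ℝ) * v.1 - (a : ℝ) * v.2 := by
    filter_upwards [Lp.coeFn_const 2 (volume : Measure UnitAddCircle) ((a : ℝ), (b : ℝ))] with s hs
    rw [constVel, hs]
    change v.1 * (b : ℝ) - v.2 * (a : ℝ) = _
    ring
  rw [integral_congr_ae h]
  simp

theorem interiorProduct_areaForm (a b : ℤ) :
    interiorProduct ((a : ℝ), (b : ℝ)) areaForm = -((b : ℝ) • dq1 - (a : ℝ) • dq2) := by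
  funext q
  refine ContinuousLinearMap.ext fun v => ?_
  change (a : ℝ) * v.2 - (b : ℝ) * v.1 = -((b : ℝ) * v.1 - (a : ℝ) * v.2)
  ring

theorem const_closed (ℓ : Plane →L[ℝ] ℝ) :
    (fun _ => ℓ : OneForm Plane Torus) ∈ closedForms (univ : Set Torus) := by
  intro q _
  refine ⟨contMDiffAt_const, fun v w => ?_⟩
  have : formDer (fun _ => ℓ : OneForm Plane Torus) q = 0 := mfderiv_const
  rw [this]; rfl

theorem straightForm_closed (a b : ℝ) :
    a • dq1 - b • dq2 ∈ closedForms (univ : Set Torus) :=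
  const_closed (a • ContinuousLinearMap.fst ℝ ℝ ℝ - b • ContinuousLinearMap.snd ℝ ℝ ℝ)

end Straight

/-! ### Exactness of `tau` on components and the class of the pulled-back action form -/

section Classes

variable {E X : Type*} [NormedAddCommGroup E] [NormedSpace ℝ E] [TopologicalSpace X]
  [ChartedSpace E X]

theorem cohClass_eq_iff {U : Set X} {α β : OneForm E X} (hα : α ∈ closedForms U)
    (hβ : β ∈ closedForms U) :
    cohClass U α hα = cohClass U β hβ ↔ α - β ∈ exactForms U :=
  Submodule.Quotient.eq _

theorem cohClass_eq_zero_iff {U : Set X} {α : OneForm E X} (hα : α ∈ closedForms U) :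
    cohClass U α hα = 0 ↔ α ∈ exactForms U :=
  Submodule.Quotient.mk_eq_zero _

/-- The jump `b m - a n` vanishes for all shifts when `a = b = 0`. -/
theorem pot_eq_of_displacement_zero (σ : TwoForm) {γ : Loop} {w w' : PathData} (h : IsLift γ w)
    (h' : IsLift γ w') (h0 : prim w.2 1 = 0) : σ.pot w' = σ.pot w := by
  obtain ⟨j, n, rfl⟩ := h.eq_add h'
  have := areaPot_add σ.contDiff_coeff σ.latticePeriodic_coeff w.1 w.2 (a := 0) (b := 0)
    (h0.trans (by ext <;> simp)) j n
  rw [TwoForm.pot, this]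
  simp

theorem transgression_exact_component_zero (σ : TwoForm) :
    transgression σ ∈ exactForms (component 0 0) := by
  refine hasTranslationCharts_freeExp.exact_of_primitive (fun γ => σ.pot (chosenLift γ)) ?_
  intro γ hγ
  have hl := isLift_chosenLift γ
  have h0 : prim (chosenLift γ).2 1 = 0 := by
    rw [displacement_of_mem_component hγ hl]; simp
  refine ⟨fun e => σ.pot (chosenLift γ + liftL e),
    (contDiff_add_liftL σ.contDiff_pot _).contDiffAt, Filter.Eventually.of_forall fun e => ?_, ?_⟩
  · refine pot_eq_of_displacement_zero σ (hl.add e) (isLift_chosenLift _) ?_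
    rw [Prod.snd_add, prim_add _ _ (right_mem_Icc.2 zero_le_one), h0, prim_liftL, add_zero]
  · simpa using transgression_chart σ hl 0

/-- A primitive restricted to the straight loops is a function on the compact torus. At its maximum
the differential `b dq¹ - a dq²` must vanish, and this form has constant coefficients. Conversely,
on the contractible component the potential does not depend on the lift. -/
theorem tau_exact_iff (a b : ℤ) : tau ∈ exactForms (component a b) ↔ (a, b) = (0, 0) := by
  constructor
  · rintro ⟨f, hf⟩
    let φ : Torus → Loop := straight a b 1
    have hφ : ∀ q, φ q ∈ component a b := straight_mem_component a b one_pos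
    have hcont : Continuous fun q => f (φ q) := continuous_iff_continuousAt.2 fun q =>
      ContinuousAt.comp (g := f) (hf _ (hφ q)).1.continuousAt
        (straight_hasMFDerivAt a b 1 q).1.continuousAt
    obtain ⟨q, -, hq⟩ := isCompact_univ.exists_isMaxOn (univ_nonempty (α := Torus))
      hcont.continuousOn
    have hd := hasTranslationCharts_freeExp.contDiffAt (hf _ (hφ q)).1
    have hd1 := (hd.differentiableAt (by simp)).hasFDerivAt
    have hd2 : tau (φ q) = fderiv ℝ (fun e => f (φ q + freeExp e)) 0 :=
      (hf _ (hφ q)).2.trans (hasTranslationCharts_freeExp.mfderiv_eq hd1)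
    have hd3 : HasFDerivAt (fun v => f (φ (q + proj v))) ((tau (φ q)).comp constL) 0 := by
      have h1 : (fun v => f (φ (q + proj v))) = fun v => f (φ q + freeExp (constL v)) :=
        funext fun v => congrArg f (straight_add a b 1 q v)
      rw [h1, hd2]
      have h2 : HasFDerivAt (fun e => f (φ q + freeExp e))
          (fderiv ℝ (fun e => f (φ q + freeExp e)) 0) (constL 0) := by
        rw [map_zero]; exact hd1
      exact h2.comp (0 : Plane) constL.hasFDerivAt
    have hmax : IsLocalMax (fun v => f (φ (q + proj v))) 0 :=
      Filter.Eventually.of_forall fun v => by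
        simpa using hq (mem_univ (q + proj v))
    have h0 := hmax.hasFDerivAt_eq_zero hd3
    have h1 : ((b : ℝ) • dq1 - (a : ℝ) • dq2) q = 0 := by
      rw [← pullback_straight_tau a b 1, pullback_straight]
      exact h0
    have h2 : (b : ℝ) * 1 - (a : ℝ) * 0 = 0 := congrArg (fun L : Plane →L[ℝ] ℝ => L (1, 0)) h1
    have h3 : (b : ℝ) * 0 - (a : ℝ) * 1 = 0 := congrArg (fun L : Plane →L[ℝ] ℝ => L (0, 1)) h1
    have hb : (b : ℝ) = 0 := by linarith
    have ha : (a : ℝ) = 0 := by linarith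
    exact Prod.ext (by exact_mod_cast ha) (by exact_mod_cast hb)
  · intro h
    obtain ⟨rfl, rfl⟩ := Prod.mk.inj h
    exact transgression_exact_component_zero areaForm

variable (g : TorusMetric) (σ : TwoForm) (k : ℝ) (a b : ℤ)

/-- A primitive of the pull-back of the action form to the plane. -/
def etaPlane (T : ℝ) (v : Plane) : ℝ :=
  action g k (straight a b T (proj v)) + σ.pot (v, constVel a b)

/-- The action term is periodic, so all of the jump comes from the potential of `σ`. -/
theorem etaPlane_add (T : ℝ) (v : Plane) (m n : ℤ) :
    etaPlane g σ k a b T (v + ((m : ℝ), (n : ℝ))) =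
      etaPlane g σ k a b T v + σ.integral * (b * m - a * n) := by
  have h := areaPot_add σ.contDiff_coeff σ.latticePeriodic_coeff v (constVel a b)
    (prim_constVel a b) m n
  have h' : proj (v + ((m : ℝ), (n : ℝ))) = proj v := (proj_eq_proj_iff _ _).2 ⟨m, n, rfl⟩
  rw [etaPlane, etaPlane, h', TwoForm.pot, h, σ.integral_eq]
  ring

theorem etaPlane_translate (T : ℝ) (v e : Plane) :
    etaPlane g σ k a b T (v + e) = action g k (straight a b T (proj v) + freeExp (constL e)) +
      σ.pot ((v, constVel a b) + liftL (constL e)) := by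
  rw [etaPlane, map_add, straight_add, liftL_constL]
  congr 2
  exact Prod.ext rfl (add_zero (constVel a b)).symm

theorem contDiffAt_etaPlane {T : ℝ} (hT : 0 < T) (v : Plane) :
    ContDiffAt ℝ ∞ (fun e => etaPlane g σ k a b T (v + e)) 0 := by
  simp only [etaPlane_translate]
  have h1 := contDiffAt_eta_primitive g σ k (straight_mem_freeLoops a b hT (proj v))
    (v, constVel a b)
  have h2 : ContDiffAt ℝ ∞ (fun e => action g k (straight a b T (proj v) + freeExp e) +
      σ.pot ((v, constVel a b) + liftL e)) (constL 0) := by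
    rw [map_zero]; exact h1
  exact h2.comp (0 : Plane) constL.contDiff.contDiffAt

theorem pullback_eta_chart {T : ℝ} (hT : 0 < T) (v : Plane) :
    ∀ᶠ e in 𝓝 (0 : Plane), pullback (straight a b T) (eta g σ k) (proj v + proj e) =
      fderiv ℝ (fun e => etaPlane g σ k a b T (v + e)) e := by
  have hγ := straight_mem_freeLoops a b hT (proj v)
  have h1 := contDiffAt_eta_primitive g σ k hγ (v, constVel a b)
  have h2 := eta_chart g σ k hγ (isLift_straight a b T v)
  have ht : Filter.Tendsto constL (𝓝 0) (𝓝 0) := by simpa using constL.continuous.tendsto 0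
  filter_upwards [ht.eventually h2,
    ht.eventually ((h1.of_le (m := 1) (by simp)).eventually (by simp))] with e he hde
  simp only [etaPlane_translate]
  rw [pullback_straight, straight_add, he]
  exact (HasFDerivAt.comp (f := constL) e (hde.differentiableAt (by simp)).hasFDerivAt
    constL.hasFDerivAt).fderiv.symm

theorem pullback_eta_closed {T : ℝ} (hT : 0 < T) :
    pullback (E := Plane) (straight a b T) (eta g σ k) ∈ closedForms (univ : Set Torus) := by
  intro q _
  obtain ⟨v, rfl⟩ := proj_surjective q
  exact hasTranslationCharts_proj.closed_of_primitive (contDiffAt_etaPlane g σ k a b hT v)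
    (pullback_eta_chart g σ k a b hT v)

/-- The linear form with coefficients `∫ σ (b, -a)` has the same lattice jumps as `etaPlane`, so
their difference descends to a smooth primitive on the torus. -/
theorem pullback_eta_exact {T : ℝ} (hT : 0 < T) :
    pullback (E := Plane) (straight a b T) (eta g σ k) - σ.integral • ((b : ℝ) • dq1 - (a : ℝ) • dq2) ∈
      exactForms (E := Plane) (univ : Set Torus) := by
  let ℓ : Plane →L[ℝ] ℝ := σ.integral • ((b : ℝ) • ContinuousLinearMap.fst ℝ ℝ ℝ -
    (a : ℝ) • ContinuousLinearMap.snd ℝ ℝ ℝ)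
  have hℓ : ∀ v, ℓ v = σ.integral * (b * v.1 - a * v.2) := fun v => rfl
  let G : Plane → ℝ := fun v => etaPlane g σ k a b T v - ℓ v
  have hG : LatticePeriodic G := by
    intro v m n
    simp only [G, etaPlane_add, map_add, hℓ ((m : ℝ), (n : ℝ))]
    ring
  have hG' : ∀ v w, proj v = proj w → G v = G w := by
    intro v w hvw
    obtain ⟨m, n, rfl⟩ := (proj_eq_proj_iff _ _).1 hvw
    exact hG w m n
  -- The section need not be continuous, because `G` takes the same value on all representatives.
  let L : Torus → Plane := fun q => (proj_surjective q).choose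
  have hL : ∀ q, proj (L q) = q := fun q => (proj_surjective q).choose_spec
  refine hasTranslationCharts_proj.exact_of_primitive (fun q => G (L q)) ?_
  intro q _
  have h1 := contDiffAt_etaPlane g σ k a b hT (L q)
  have h2 : ContDiffAt ℝ ∞ (fun e : Plane => ℓ (L q + e)) 0 :=
    (ℓ.contDiff.comp (contDiff_const.add contDiff_id)).contDiffAt
  refine ⟨fun e => G (L q + e), h1.sub h2, Filter.Eventually.of_forall fun e => ?_, ?_⟩
  · refine hG' _ _ ?_
    rw [hL, map_add, hL]
  · have h3 := (pullback_eta_chart g σ k a b hT (L q)).self_of_nhds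
    rw [map_zero, add_zero, hL] at h3
    have h4 : HasFDerivAt (fun e : Plane => ℓ (L q + e)) ℓ 0 :=
      ℓ.hasFDerivAt.comp (0 : Plane) ((hasFDerivAt_id (0 : Plane)).const_add (L q))
    have h5 := ((h1.differentiableAt (by simp)).hasFDerivAt.sub h4).fderiv
    have h6 : fderiv ℝ (fun e => G (L q + e)) 0 = _ := h5
    rw [h6, ← h3]
    rfl

end Classes

/-! ### Periods of the action form -/

section Periods

/-- A smooth curve in a translation chart. -/
theorem HasTranslationCharts.curve_chart {E X : Type*} [NormedAddCommGroup E] [NormedSpace ℝ E]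
    [AddCommGroup X] [TopologicalSpace X] [IsTopologicalAddGroup X] [ChartedSpace E X]
    {p : E →+ X} (hp : HasTranslationCharts p) {c : ℝ → X} {S : Set ℝ} {t₀ : ℝ}
    (hc : ContMDiffWithinAt 𝓘(ℝ, ℝ) 𝓘(ℝ, E) ∞ c S t₀) :
    ∃ e : ℝ → E, ContDiffWithinAt ℝ ∞ e S t₀ ∧ e t₀ = 0 ∧
      (∀ᶠ t in 𝓝[S] t₀, c t = c t₀ + p (e t)) ∧
      mfderivWithin 𝓘(ℝ, ℝ) 𝓘(ℝ, E) c S t₀ = fderivWithin ℝ e S t₀ := by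
  refine ⟨fun t => extChartAt 𝓘(ℝ, E) (c t₀) (c t), ?_, hp.extChartAt_self _, ?_, ?_⟩
  · have h := (contMDiffWithinAt_iff.1 hc).2
    rw [modelWithCornersSelf_coe, range_id, inter_univ] at h
    exact h
  · filter_upwards [hc.continuousWithinAt (extChartAt_source_mem_nhds (I := 𝓘(ℝ, E)) (c t₀))]
      with t ht
    have h := (extChartAt 𝓘(ℝ, E) (c t₀)).left_inv ht
    rw [hp.extChartAt_symm] at h
    exact h.symm
  · rw [(hc.mdifferentiableWithinAt (by simp)).mfderivWithin]
    rw [modelWithCornersSelf_coe, range_id, inter_univ]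
    rfl

theorem exists_lift_circle (f : ℝ → UnitAddCircle) (hf : ContinuousOn f (Icc 0 1)) :
    ∃ P : ℝ → ℝ, ContinuousOn P (Icc 0 1) ∧ ∀ t ∈ Icc (0 : ℝ) 1, (P t : UnitAddCircle) = f t := by
  let γ : C(unitInterval, UnitAddCircle) :=
    ⟨fun t => f t, continuousOn_iff_continuous_domRestrict.1 hf⟩
  obtain ⟨x, hx⟩ := QuotientAddGroup.mk_surjective (γ 0)
  obtain ⟨Γ, hΓ, -⟩ := (AddCircle.isCoveringMap_coe (1 : ℝ)).exists_path_lifts γ x hx.symm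
  refine ⟨fun t => Γ (projIcc 0 1 zero_le_one t),
    (Γ.continuous.comp continuous_projIcc).continuousOn, fun t ht => ?_⟩
  have := congrFun hΓ ⟨t, ht⟩
  simp only [projIcc_of_mem zero_le_one ht]
  exact this

theorem exists_lift_torus (f : ℝ → Torus) (hf : ContinuousOn f (Icc 0 1)) :
    ∃ P : ℝ → Plane, ContinuousOn P (Icc 0 1) ∧ ∀ t ∈ Icc (0 : ℝ) 1, proj (P t) = f t := by
  obtain ⟨P₁, h1, h1'⟩ := exists_lift_circle _ (continuous_fst.comp_continuousOn hf)
  obtain ⟨P₂, h2, h2'⟩ := exists_lift_circle _ (continuous_snd.comp_continuousOn hf)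
  exact ⟨fun t => (P₁ t, P₂ t), h1.prodMk h2, fun t ht => Prod.ext (h1' t ht) (h2' t ht)⟩

theorem eq_zero_of_proj_eq_zero {v : Plane} (h : proj v = 0) (hv : ‖v‖ < 1) : v = 0 := by
  rw [← map_zero proj] at h
  obtain ⟨m, n, rfl⟩ := (proj_eq_proj_iff _ _).1 h
  rw [zero_add] at hv ⊢
  have h1 : |(m : ℝ)| < 1 := (norm_fst_le ((m : ℝ), (n : ℝ))).trans_lt hv
  have h2 : |(n : ℝ)| < 1 := (norm_snd_le ((m : ℝ), (n : ℝ))).trans_lt hv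
  have hm : m = 0 := Int.abs_lt_one_iff.1 (by exact_mod_cast h1)
  have hn : n = 0 := Int.abs_lt_one_iff.1 (by exact_mod_cast h2)
  simp [hm, hn]

variable (g : TorusMetric) (σ : TwoForm) (k : ℝ)

/-- A continuous lift `P` of the base points selects a continuous branch of the primitive along the
curve, and the fundamental theorem of calculus applies to that branch. Only continuity of `P` is
assumed; smoothness of the branch follows in charts. -/
theorem pathIntegral_eta_lift {c : ℝ → Loop}
    (hc : ContMDiffOn 𝓘(ℝ, ℝ) 𝓘(ℝ, LoopVec) ∞ c (Icc 0 1)) (hU : MapsTo c (Icc 0 1) freeLoops)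
    {P : ℝ → Plane} (hP : ContinuousOn P (Icc 0 1))
    (hP' : ∀ t ∈ Icc (0 : ℝ) 1, proj (P t) = Loop.pt (c t) 0) :
    pathIntegral (eta g σ k) c =
      (action g k (c 1) + σ.pot (P 1, (c 1).1.1.2)) -
        (action g k (c 0) + σ.pot (P 0, (c 0).1.1.2)) := by
  let Φ : ℝ → ℝ := fun t => action g k (c t) + σ.pot (P t, (c t).1.1.2)
  have key : ∀ t₀ ∈ Icc (0 : ℝ) 1, ContDiffWithinAt ℝ 1 Φ (Icc 0 1) t₀ ∧
      derivWithin Φ (Icc 0 1) t₀ = eta g σ k (c t₀)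
        (mfderivWithin 𝓘(ℝ, ℝ) 𝓘(ℝ, LoopVec) c (Icc 0 1) t₀ (1 : ℝ) : LoopVec) := by
    intro t₀ ht₀
    obtain ⟨e, he, he0, hce, hde⟩ := hasTranslationCharts_freeExp.curve_chart (hc t₀ ht₀)
    have hlift : IsLift (c t₀) (P t₀, (c t₀).1.1.2) := ⟨hP' t₀ ht₀, rfl⟩
    -- The difference of the two lifts is continuous, lattice-valued near `t₀` and zero at `t₀`, so
    -- it vanishes nearby: nonzero lattice vectors have norm at least one.
    have hPe : ∀ᶠ t in 𝓝[Icc 0 1] t₀, P t = P t₀ + (liftL (e t)).1 := by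
      have hcw : ContinuousWithinAt (fun t => P t - (P t₀ + (liftL (e t)).1)) (Icc 0 1) t₀ :=
        (hP t₀ ht₀).sub (continuousWithinAt_const.add
          ((continuous_fst.comp liftL.continuous).continuousAt.comp_continuousWithinAt
            he.continuousWithinAt))
      have h0 : P t₀ - (P t₀ + (liftL (e t₀)).1) = 0 := by simp [he0]
      have hball := hcw.eventually (Metric.ball_mem_nhds _ one_pos)
      filter_upwards [hball, hce, self_mem_nhdsWithin] with t ht hct htI
      rw [h0, dist_zero_right] at ht
      refine sub_eq_zero.1 (eq_zero_of_proj_eq_zero ?_ ht)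
      rw [map_sub, hP' t htI, hct, sub_eq_zero]
      exact ((hlift.add (e t)).1).symm
    let Ψ : LoopVec → ℝ := fun e => action g k (c t₀ + freeExp e) +
      σ.pot ((P t₀, (c t₀).1.1.2) + liftL e)
    have hΨ : ContDiffAt ℝ ∞ Ψ 0 := contDiffAt_eta_primitive g σ k (hU ht₀) _
    have hΦ : Φ =ᶠ[𝓝[Icc 0 1] t₀] fun t => Ψ (e t) := by
      filter_upwards [hPe, hce] with t h1 h2
      have h3 : (c t).1.1.2 = (c t₀).1.1.2 + (liftL (e t)).2 := by rw [h2]; rfl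
      simp only [Φ, Ψ]
      rw [h3, h1, h2]
      rfl
    have hΦ0 : Φ t₀ = Ψ (e t₀) := hΦ.self_of_nhdsWithin ht₀
    have hΨ' : ContDiffAt ℝ ∞ Ψ (e t₀) := by rw [he0]; exact hΨ
    have hcomp : ContDiffWithinAt ℝ ∞ (fun t => Ψ (e t)) (Icc 0 1) t₀ :=
      hΨ'.comp_contDiffWithinAt t₀ he
    refine ⟨(hcomp.congr_of_eventuallyEq hΦ hΦ0).of_le (by simp), ?_⟩
    have hη : eta g σ k (c t₀) = fderiv ℝ Ψ (e t₀) := by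
      rw [he0]
      simpa using (eta_chart g σ k (hU ht₀) hlift).self_of_nhds
    have hu : UniqueDiffWithinAt ℝ (Icc (0 : ℝ) 1) t₀ := uniqueDiffOn_Icc_zero_one t₀ ht₀
    have hd1 := (hΨ'.differentiableAt (by simp)).hasFDerivAt
    have hd2 := (he.differentiableWithinAt (by simp)).hasFDerivWithinAt
    have hd3 := hd1.comp_hasFDerivWithinAt t₀ hd2
    have hd4 : HasFDerivWithinAt Φ ((fderiv ℝ Ψ (e t₀)).comp (fderivWithin ℝ e (Icc 0 1) t₀))
        (Icc 0 1) t₀ := hd3.congr_of_eventuallyEq hΦ hΦ0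
    have hd5 := hd4.fderivWithin hu
    rw [hη, hde]
    change fderivWithin ℝ Φ (Icc 0 1) t₀ 1 = _
    rw [hd5]
    rfl
  have hFTC := intervalIntegral.integral_derivWithin_Icc_of_contDiffOn_Icc (f := Φ) (a := 0)
    (b := 1) (fun t ht => (key t ht).1) zero_le_one
  change _ = Φ 1 - Φ 0
  rw [← hFTC, pathIntegral]
  refine intervalIntegral.integral_congr fun t ht => ?_
  rw [uIcc_of_le zero_le_one] at ht
  exact ((key t ht).2).symm

/-- A primitive of the action form, up to integer multiples of the integral of `σ`. -/
def etaPot (γ : Loop) : ℝ := action g k γ + σ.pot (chosenLift γ)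

/-- The chosen lift may jump along the curve, but it differs from a continuous lift by lattice
vectors, which change the potential by integer multiples of `∫ σ`. -/
theorem pathIntegral_eta_mod {c : ℝ → Loop}
    (hc : ContMDiffOn 𝓘(ℝ, ℝ) 𝓘(ℝ, LoopVec) ∞ c (Icc 0 1)) (hU : MapsTo c (Icc 0 1) freeLoops) :
    ((pathIntegral (eta g σ k) c : ℝ) : ℝ ⧸ AddSubgroup.zmultiples σ.integral) =
      (etaPot g σ k (c 1) : ℝ ⧸ AddSubgroup.zmultiples σ.integral) - etaPot g σ k (c 0) := by
  have hpt : Continuous fun γ : Loop => Loop.pt γ 0 := by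
    have h1 : Continuous fun γ : Loop => γ.1.1.1 := by fun_prop
    exact (ContinuousEvalConst.continuous_eval_const (0 : UnitAddCircle)).comp h1
  obtain ⟨P, hP, hP'⟩ := exists_lift_torus (fun t => Loop.pt (c t) 0)
    (hpt.comp_continuousOn hc.continuousOn)
  have hmod : ∀ t ∈ Icc (0 : ℝ) 1,
      ((action g k (c t) + σ.pot (P t, (c t).1.1.2) : ℝ) :
        ℝ ⧸ AddSubgroup.zmultiples σ.integral) = etaPot g σ k (c t) := by
    intro t ht
    obtain ⟨n, hn⟩ := pot_eq_of_isLift σ (w := (P t, (c t).1.1.2)) ⟨hP' t ht, rfl⟩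
      (isLift_chosenLift (c t))
    rw [QuotientAddGroup.eq, etaPot, hn, ← σ.integral_eq]
    refine ⟨n, ?_⟩
    simp only [zsmul_eq_mul]
    ring
  rw [pathIntegral_eta_lift g σ k hc hU hP hP', QuotientAddGroup.mk_sub,
    hmod 1 (right_mem_Icc.2 zero_le_one), hmod 0 (left_mem_Icc.2 zero_le_one)]

/-- Modulo `∫ σ`, integration over a chain is evaluation of `etaPot` on its boundary, and the
boundary of a cycle is zero. -/
theorem periods_eta_le {U : Set Loop} (hU : U ⊆ freeLoops) :
    periods (eta g σ k) U ≤ AddSubgroup.zmultiples σ.integral := by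
  rintro _ ⟨z, ⟨hz, hz0⟩, rfl⟩
  let Q := ℝ ⧸ AddSubgroup.zmultiples σ.integral
  let ev : (Loop →₀ ℤ) →+ Q := Finsupp.liftAddHom fun γ =>
    zmultiplesHom Q ((etaPot g σ k γ : ℝ) : Q)
  have hev : ∀ γ (n : ℤ), ev (Finsupp.single γ n) = n • ((etaPot g σ k γ : ℝ) : Q) := by
    intro γ n
    simp [ev]
  have h1 : ((chainIntegral (eta g σ k) z : ℝ) : Q) = ev (boundary Loop z) := by
    have hb : boundary Loop z =
        ∑ c ∈ z.support, (Finsupp.single (c 1) (z c) - Finsupp.single (c 0) (z c)) := rfl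
    have hi : chainIntegral (eta g σ k) z =
        ∑ c ∈ z.support, (z c : ℝ) * pathIntegral (eta g σ k) c := rfl
    rw [hb, hi, map_sum]
    change QuotientAddGroup.mk' _ _ = _
    rw [map_sum]
    refine Finset.sum_congr rfl fun c hc => ?_
    have h2 := pathIntegral_eta_mod g σ k (hz c hc).1 ((hz c hc).2.mono_right hU)
    have h3 : ev (Finsupp.single (c 1) (z c) - Finsupp.single (c 0) (z c)) =
        z c • (((etaPot g σ k (c 1) : ℝ) : Q) - ((etaPot g σ k (c 0) : ℝ) : Q)) := by
      rw [map_sub, hev, hev, smul_sub]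
    refine Eq.trans ?_ h3.symm
    rw [← h2]
    change QuotientAddGroup.mk' _ ((z c : ℝ) * pathIntegral (eta g σ k) c) =
      z c • QuotientAddGroup.mk' _ (pathIntegral (eta g σ k) c)
    rw [← map_zsmul, zsmul_eq_mul]
  rw [hz0, map_zero] at h1
  exact (QuotientAddGroup.eq_zero_iff _).1 h1

theorem periods_eta_discrete {U : Set Loop} (hU : U ⊆ freeLoops) :
    DiscreteTopology (periods (eta g σ k) U) :=
  DiscreteTopology.of_subset (s := (AddSubgroup.zmultiples σ.integral : Set ℝ))
    (inferInstanceAs (DiscreteTopology (AddSubgroup.zmultiples σ.integral)))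
    (periods_eta_le g σ k hU)

end Periods

/-! ### Loops avoiding a point -/

section Avoiding

theorem forall_curve_iff {γ : Loop} (hγ : γ ∈ freeLoops) (P : Torus → Prop) :
    (∀ t, P (Loop.curve γ t)) ↔ ∀ s, P (Loop.pt γ s) := by
  have hT : γ.2 ≠ 0 := (show 0 < γ.2 from hγ).ne'
  refine ⟨fun h s => ?_, fun h t => h _⟩
  obtain ⟨r, rfl⟩ := QuotientAddGroup.mk_surjective s
  have := h (γ.2 * r)
  rwa [Loop.curve, mul_div_cancel_left₀ _ hT] at this

theorem exists_unitInterval_coe (s : UnitAddCircle) :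
    ∃ r : unitInterval, ((r : ℝ) : UnitAddCircle) = s := by
  obtain ⟨x, rfl⟩ := QuotientAddGroup.mk_surjective s
  refine ⟨⟨Int.fract x, Int.fract_nonneg x, (Int.fract_lt_one x).le⟩, ?_⟩
  exact (coe_eq_coe_iff_exists_int _ _).2 ⟨-⌊x⌋, by simp [Int.fract, sub_eq_add_neg]⟩

theorem forall_pt_iff {γ : Loop} {w : PathData} (h : IsLift γ w) (P : Torus → Prop) :
    (∀ s, P (Loop.pt γ s)) ↔ ∀ s : unitInterval, P (proj (path w s)) := by
  refine ⟨fun H s => by rw [h.proj_path]; exact H _, fun H s => ?_⟩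
  obtain ⟨r, rfl⟩ := exists_unitInterval_coe s
  rw [← h.proj_path]
  exact H r

/-- The image of an absolutely continuous path has Hausdorff dimension at most one, because it is
a Lipschitz image of a subset of the line, by arc length. -/
theorem dimH_range_path (w : PathData) : dimH (range (path w)) ≤ 1 := by
  let V : unitInterval → ℝ := fun s => ∫ r in (0 : ℝ)..s, ‖w.2 (r : UnitAddCircle)‖
  have hV : ∀ s t : unitInterval, dist (path w s) (path w t) ≤ dist (V s) (V t) := by
    intro s t
    have hi := fun s : unitInterval => intervalIntegrable_L2 w.2 s.2
    rw [dist_eq_norm, dist_eq_norm, path_apply, path_apply, add_sub_add_left_eq_sub]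
    simp only [prim, V]
    rw [intervalIntegral.integral_interval_sub_left (hi s) (hi t),
      intervalIntegral.integral_interval_sub_left (hi s).norm (hi t).norm]
    exact intervalIntegral.norm_integral_le_abs_integral_norm
  -- The arc length `V` need not be injective, but by `hV` times of equal arc length give the same
  -- point, so any right inverse of `V` parametrises the image.
  choose! ψ hψ using fun (y : ℝ) (hy : y ∈ range V) => hy
  have hlip : LipschitzOnWith 1 (fun y => path w (ψ y)) (range V) := by
    refine LipschitzOnWith.of_dist_le_mul fun x hx y hy => ?_
    have := hV (ψ x) (ψ y)
    rw [hψ x hx, hψ y hy] at this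
    simpa using this
  have himg : range (path w) ⊆ (fun y => path w (ψ y)) '' range V := by
    rintro _ ⟨s, rfl⟩
    refine ⟨V s, mem_range_self s, ?_⟩
    have := hV (ψ (V s)) s
    rw [hψ (V s) (mem_range_self s), dist_self] at this
    exact dist_le_zero.1 this
  calc dimH (range (path w)) ≤ dimH ((fun y => path w (ψ y)) '' range V) := dimH_mono himg
    _ ≤ dimH (range V) := hlip.dimH_image_le
    _ ≤ dimH (univ : Set ℝ) := dimH_mono (subset_univ _)
    _ = 1 := Real.dimH_univ

/-- The preimage of the loop in the plane is a countable union of translates of one path. It has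
dimension at most one, less than two, so its complement is dense. -/
theorem exists_notMem_curve {γ : Loop} (hγ : γ ∈ freeLoops) : ∃ q, ∀ t, Loop.curve γ t ≠ q := by
  obtain ⟨w, h⟩ := exists_isLift γ
  let S : Set Plane := ⋃ z : ℤ × ℤ, (fun v : Plane => v + ((z.1 : ℝ), (z.2 : ℝ))) '' range (path w)
  have hS : dimH S ≤ 1 := by
    rw [dimH_iUnion]
    refine iSup_le fun z => ?_
    exact ((IsometryEquiv.addRight (((z.1 : ℝ), (z.2 : ℝ)) : Plane)).isometry.dimH_image
      (range (path w))).trans_le (dimH_range_path w)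
  have hd : Dense Sᶜ := dense_compl_of_dimH_lt_finrank (hS.trans_lt (by simp))
  obtain ⟨p, hp⟩ := hd.nonempty
  refine ⟨proj p, (forall_curve_iff hγ (· ≠ proj p)).2 
    ((forall_pt_iff h (· ≠ proj p)).2 fun s hs => hp ?_)⟩
  obtain ⟨m, n, hmn⟩ := (proj_eq_proj_iff _ _).1 hs.symm
  exact mem_iUnion.2 ⟨(m, n), path w s, mem_range_self s, hmn.symm⟩

/-- The circle is compact and the complement of `q` is open, so avoiding `q` is an open condition in
the compact-open topology. -/
theorem isOpen_avoiding (q : Torus) : IsOpen (avoiding q) := by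
  have h1 : avoiding q = freeLoops ∩ (fun γ : Loop => γ.1.1.1) ⁻¹'
      {f : C(UnitAddCircle, Torus) | MapsTo f univ {q}ᶜ} := by
    ext γ
    constructor
    · rintro ⟨h, h'⟩
      exact ⟨h, fun s _ => (forall_curve_iff h (· ≠ q)).1 h' s⟩
    · rintro ⟨h, h'⟩
      exact ⟨h, (forall_curve_iff h (· ≠ q)).2 fun s => h' (mem_univ s)⟩
  rw [h1]
  refine IsOpen.inter (isOpen_lt continuous_const continuous_snd) (IsOpen.preimage ?_
    (ContinuousMap.isOpen_setOfPred_mapsTo isCompact_univ isOpen_compl_singleton))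
  fun_prop

theorem rotatedIterate_mem_avoiding {γ β : Loop} (hγ : γ ∈ freeLoops) {q : Torus}
    (hq : ∀ t, Loop.curve γ t ≠ q) {n : ℕ} (hn : 0 < n) {ψ : UnitAddCircle}
    (h : IsRotatedIterate γ n ψ β) : β ∈ avoiding q := by
  have hγ' : 0 < γ.2 := hγ
  have hβ : β ∈ freeLoops := by
    change 0 < β.2
    rw [h.1]
    positivity
  refine ⟨hβ, (forall_curve_iff hβ (· ≠ q)).2 fun s => ?_⟩
  rw [h.2]
  exact (forall_curve_iff hγ (· ≠ q)).1 hq _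

end Avoiding

/-! ### Angular forms on the punctured torus -/

section Angular

open Real

/-- A periodic function vanishing exactly on the integer lattice. -/
def latticeDist (v : Plane) : ℝ := sin (π * v.1) ^ 2 + sin (π * v.2) ^ 2

/-- The squared radius `sin² 2πx + sin² 2πy` near the integer lattice. -/
def radiusSq (v : Plane) : ℝ := sin (2 * π * v.1) ^ 2 + sin (2 * π * v.2) ^ 2

theorem contDiff_latticeDist : ContDiff ℝ ∞ latticeDist := by
  unfold latticeDist; fun_prop

theorem contDiff_radiusSq : ContDiff ℝ ∞ radiusSq := by
  unfold radiusSq; fun_prop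

theorem latticeDist_nonneg (v : Plane) : 0 ≤ latticeDist v := by
  unfold latticeDist; positivity

theorem latticePeriodic_latticeDist : LatticePeriodic latticeDist := by
  have h : ∀ (x : ℝ) (n : ℤ), sin (π * (x + n)) ^ 2 = sin (π * x) ^ 2 := by
    intro x n
    have h1 : π * (x + n) = π * x + n * π := by ring
    rw [h1, sin_add_int_mul_pi, mul_pow, ← zpow_natCast, ← zpow_mul, mul_comm n, zpow_mul]
    simp
  intro v m n
  simp only [latticeDist, Prod.fst_add, Prod.snd_add, h]

theorem sin_two_pi_add_int (x : ℝ) (n : ℤ) : sin (2 * π * (x + n)) = sin (2 * π * x) := by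
  rw [mul_add, mul_comm (2 * π) (n : ℝ)]
  exact sin_add_int_mul_two_pi _ n

theorem cos_two_pi_add_int (x : ℝ) (n : ℤ) : cos (2 * π * (x + n)) = cos (2 * π * x) := by
  rw [mul_add, mul_comm (2 * π) (n : ℝ)]
  exact cos_add_int_mul_two_pi _ n

theorem latticePeriodic_radiusSq : LatticePeriodic radiusSq := by
  intro v m n
  simp only [radiusSq, Prod.fst_add, Prod.snd_add, sin_two_pi_add_int]

theorem proj_eq_zero_of_latticeDist {v : Plane} (h : latticeDist v = 0) : proj v = 0 := by
  have h1 : sin (π * v.1) = 0 := by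
    have := sq_nonneg (sin (π * v.2))
    have h2 := sq_nonneg (sin (π * v.1))
    unfold latticeDist at h
    exact pow_eq_zero_iff two_ne_zero |>.1 (by linarith)
  have h2 : sin (π * v.2) = 0 := by
    unfold latticeDist at h
    rw [h1] at h
    simpa using h
  obtain ⟨m, hm⟩ := sin_eq_zero_iff.1 h1
  obtain ⟨n, hn⟩ := sin_eq_zero_iff.1 h2
  rw [← map_zero proj, proj_eq_proj_iff]
  refine ⟨m, n, ?_⟩
  rw [zero_add]
  refine Prod.ext ?_ ?_
  · have : π * (v.1 - m) = 0 := by linarith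
    rcases mul_eq_zero.1 this with h | h
    · exact absurd h pi_ne_zero
    · exact sub_eq_zero.1 h
  · have : π * (v.2 - n) = 0 := by linarith
    rcases mul_eq_zero.1 this with h | h
    · exact absurd h pi_ne_zero
    · exact sub_eq_zero.1 h

/-- The squared radius vanishes on the whole half-integer lattice. At the spurious zeros some
coordinate is a proper half-integer and contributes a full `1` to `latticeDist`, so a function
vanishing beyond `1 / 2` removes them. -/
theorem latticeDist_of_radiusSq_eq_zero {v : Plane} (h : radiusSq v = 0) :
    latticeDist v = 0 ∨ 1 ≤ latticeDist v := by
  have key : ∀ x : ℝ, sin (2 * π * x) = 0 → sin (π * x) ^ 2 = 0 ∨ sin (π * x) ^ 2 = 1 := by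
    intro x hx
    have h1 : 2 * π * x = 2 * (π * x) := by ring
    rw [h1, sin_two_mul] at hx
    rcases mul_eq_zero.1 hx with h2 | h2
    · left
      have : sin (π * x) = 0 := by linarith
      rw [this]; norm_num
    · right
      have := sin_sq_add_cos_sq (π * x)
      rw [h2] at this
      linarith
  unfold radiusSq at h
  have s1 := sq_nonneg (sin (2 * π * v.1))
  have s2 := sq_nonneg (sin (2 * π * v.2))
  have h1 := key v.1 (pow_eq_zero_iff two_ne_zero |>.1 (by linarith))
  have h2 := key v.2 (pow_eq_zero_iff two_ne_zero |>.1 (by linarith))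
  unfold latticeDist
  rcases h1 with h1 | h1 <;> rcases h2 with h2 | h2 <;> rw [h1, h2] <;> norm_num

/-- A smooth function on the line that vanishes near `0` and beyond `1 / 2`. -/
structure IsCutoff (χ : ℝ → ℝ) : Prop where
  contDiff : ContDiff ℝ ∞ χ
  exists_zero : ∃ δ > 0, ∀ t < δ, χ t = 0
  zero : ∀ t, 1 / 2 ≤ t → χ t = 0

/-- The quotient of a cut-off function by the squared radius. -/
def radialQuot (χ : ℝ → ℝ) (v : Plane) : ℝ := χ (latticeDist v) / radiusSq v

theorem latticePeriodic_radialQuot (χ : ℝ → ℝ) : LatticePeriodic (radialQuot χ) := by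
  intro v m n
  rw [radialQuot, latticePeriodic_latticeDist, latticePeriodic_radiusSq]
  rfl

theorem IsCutoff.radialQuot_eventually {χ : ℝ → ℝ} (hχ : IsCutoff χ) {v : Plane}
    (hv : radiusSq v = 0) : ∀ᶠ z in 𝓝 v, radialQuot χ z = 0 := by
  have hc := contDiff_latticeDist.continuous.tendsto v
  rcases latticeDist_of_radiusSq_eq_zero hv with h | h
  · obtain ⟨δ, hδ, hδ'⟩ := hχ.exists_zero
    rw [h] at hc
    filter_upwards [hc.eventually (gt_mem_nhds hδ)] with z hz
    rw [radialQuot, hδ' _ hz, zero_div]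
  · filter_upwards [hc.eventually (lt_mem_nhds (show (1 / 2 : ℝ) < latticeDist v by linarith))]
      with z hz
    rw [radialQuot, hχ.zero _ hz.le, zero_div]

/-- Near every zero of the denominator the numerator is identically zero: either by the cut-off near
`0`, or by the cut-off beyond `1 / 2`. -/
theorem IsCutoff.contDiff_radialQuot {χ : ℝ → ℝ} (hχ : IsCutoff χ) :
    ContDiff ℝ ∞ (radialQuot χ) := by
  rw [contDiff_iff_contDiffAt]
  intro v
  by_cases hv : radiusSq v = 0
  · exact (contDiffAt_const (c := (0 : ℝ))).congr_of_eventuallyEq (hχ.radialQuot_eventually hv)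
  · exact (hχ.contDiff.comp contDiff_latticeDist).contDiffAt.div contDiff_radiusSq.contDiffAt hv

/-- The component along `dy` of the angular form. -/
def angComp (χ : ℝ → ℝ) (v : Plane) : ℝ :=
  radialQuot χ v * (sin (2 * π * v.1) * (2 * π * cos (2 * π * v.2)))

theorem IsCutoff.contDiff_angComp {χ : ℝ → ℝ} (hχ : IsCutoff χ) : ContDiff ℝ ∞ (angComp χ) := by
  have h1 := hχ.contDiff_radialQuot
  have h2 : ContDiff ℝ ∞ fun v : Plane => sin (2 * π * v.1) * (2 * π * cos (2 * π * v.2)) := by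
    fun_prop
  exact h1.mul h2

theorem latticePeriodic_angComp (χ : ℝ → ℝ) : LatticePeriodic (angComp χ) := by
  intro v m n
  rw [angComp, latticePeriodic_radialQuot]
  simp only [Prod.fst_add, Prod.snd_add, sin_two_pi_add_int, cos_two_pi_add_int]
  rfl

/-- The derivative is split so that the first summand carries `χ'` and the second is antisymmetric
under exchanging the coordinates. The second therefore cancels in the exterior derivative,
reflecting that the angular form is closed. -/
theorem IsCutoff.fderiv_angComp {χ : ℝ → ℝ} (hχ : IsCutoff χ) (v : Plane) :
    fderiv ℝ (angComp χ) v (1, 0) =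
      radialQuot (deriv χ) v * (π * sin (2 * π * v.1) ^ 2 * (2 * π * cos (2 * π * v.2))) +
      radialQuot χ v / radiusSq v * (2 * π * cos (2 * π * v.1)) * (2 * π * cos (2 * π * v.2)) *
        (sin (2 * π * v.2) ^ 2 - sin (2 * π * v.1) ^ 2) := by
  by_cases hv : radiusSq v = 0
  · have h0 : angComp χ =ᶠ[𝓝 v] fun _ => 0 := by
      filter_upwards [hχ.radialQuot_eventually hv] with z hz
      rw [angComp, hz, zero_mul]
    rw [h0.fderiv_eq]
    -- Division by zero is zero, so the right-hand side also vanishes here.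
    simp [radialQuot, hv]
  · have h1 : HasFDerivAt (angComp χ) (fderiv ℝ (angComp χ) v) v :=
      (hχ.contDiff_angComp.differentiable (by simp) v).hasFDerivAt
    have h2 : HasDerivAt (fun x : ℝ => ((x, v.2) : Plane)) (1, 0) v.1 :=
      (hasDerivAt_id v.1).prodMk (hasDerivAt_const v.1 v.2)
    have h3 : HasDerivAt (fun x => angComp χ (x, v.2)) (fderiv ℝ (angComp χ) v (1, 0)) v.1 :=
      HasFDerivAt.comp_hasDerivAt (f := fun x : ℝ => ((x, v.2) : Plane)) v.1 h1 h2
    have hlin : ∀ a : ℝ, HasDerivAt (fun x : ℝ => a * x) a v.1 := fun a => by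
      simpa using (hasDerivAt_id v.1).const_mul a
    have hD : HasDerivAt (fun x => latticeDist (x, v.2)) (π * sin (2 * π * v.1)) v.1 := by
      have h4 := (((hasDerivAt_sin (π * v.1)).comp v.1 (hlin π)).pow 2).add_const
        (sin (π * v.2) ^ 2)
      refine h4.congr_deriv ?_
      have : 2 * π * v.1 = 2 * (π * v.1) := by ring
      rw [this, sin_two_mul]
      simp
      ring
    have hS : HasDerivAt (fun x => sin (2 * π * x)) (2 * π * cos (2 * π * v.1)) v.1 := by
      have h4 := (hasDerivAt_sin (2 * π * v.1)).comp v.1 (hlin (2 * π))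
      refine h4.congr_deriv ?_
      ring
    have hR : HasDerivAt (fun x => radiusSq (x, v.2))
        (2 * sin (2 * π * v.1) * (2 * π * cos (2 * π * v.1))) v.1 := by
      have h4 := (hS.pow 2).add_const (sin (2 * π * v.2) ^ 2)
      refine h4.congr_deriv ?_
      simp
    have hX : HasDerivAt (fun x => χ (latticeDist (x, v.2)))
        (deriv χ (latticeDist v) * (π * sin (2 * π * v.1))) v.1 :=
      HasDerivAt.comp (h₂ := χ) v.1
        (hχ.contDiff.differentiable (by simp) (latticeDist v)).hasDerivAt hD
    have h5 := (hX.div hR hv).mul (hS.mul_const (2 * π * cos (2 * π * v.2)))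
    rw [h3.unique h5]
    simp only [radialQuot]
    have e1 : latticeDist (v.1, v.2) = latticeDist v := rfl
    have e2 : radiusSq (v.1, v.2) = radiusSq v := rfl
    simp only [Pi.div_apply, e1, e2]
    have e3 : sin (2 * π * v.2) ^ 2 = radiusSq v - sin (2 * π * v.1) ^ 2 := by
      unfold radiusSq; ring
    rw [e3]
    field_simp
    ring

/-- The angular form around the integer lattice, multiplied by a cut-off function. -/
def angForm (χ : ℝ → ℝ) (v : Plane) : Plane →L[ℝ] ℝ :=
  angComp χ v • ContinuousLinearMap.snd ℝ ℝ ℝ -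
    angComp χ v.swap • ContinuousLinearMap.fst ℝ ℝ ℝ

theorem latticePeriodic_angForm (χ : ℝ → ℝ) : LatticePeriodic (angForm χ) := by
  intro v m n
  have h : (v + ((m : ℝ), (n : ℝ))).swap = v.swap + ((n : ℝ), (m : ℝ)) := rfl
  rw [angForm, h, latticePeriodic_angComp, latticePeriodic_angComp]
  rfl

theorem contDiff_swap : ContDiff ℝ ∞ (Prod.swap : Plane → Plane) :=
  contDiff_snd.prodMk contDiff_fst

theorem IsCutoff.contDiff_angForm {χ : ℝ → ℝ} (hχ : IsCutoff χ) : ContDiff ℝ ∞ (angForm χ) :=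
  (hχ.contDiff_angComp.smul contDiff_const).sub
    ((hχ.contDiff_angComp.comp contDiff_swap).smul contDiff_const)

/-- The coefficient of the exterior derivative of the angular form. -/
def angCurl (ρ : ℝ → ℝ) (v : Plane) : ℝ :=
  radialQuot ρ v * (2 * π ^ 2 * (sin (2 * π * v.1) ^ 2 * cos (2 * π * v.2) +
    sin (2 * π * v.2) ^ 2 * cos (2 * π * v.1)))

theorem latticePeriodic_angCurl (ρ : ℝ → ℝ) : LatticePeriodic (angCurl ρ) := by
  intro v m n
  rw [angCurl, latticePeriodic_radialQuot]
  simp only [Prod.fst_add, Prod.snd_add, sin_two_pi_add_int, cos_two_pi_add_int]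
  rfl

theorem IsCutoff.contDiff_angCurl {ρ : ℝ → ℝ} (hρ : IsCutoff ρ) : ContDiff ℝ ∞ (angCurl ρ) := by
  have h1 := hρ.contDiff_radialQuot
  have h2 : ContDiff ℝ ∞ fun v : Plane => 2 * π ^ 2 * (sin (2 * π * v.1) ^ 2 * cos (2 * π * v.2) +
    sin (2 * π * v.2) ^ 2 * cos (2 * π * v.1)) := by
    fun_prop
  exact h1.mul h2

/-- With `D = latticeDist` and `θ` the angle of `(sin 2πx, sin 2πy)`, the form is `χ(D) dθ`. Since
`dθ` is closed, its exterior derivative is `χ'(D) dD ∧ dθ`, whose coefficient is `angCurl`. -/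
theorem IsCutoff.fderiv_angForm {χ : ℝ → ℝ} (hχ : IsCutoff χ) (v a b : Plane) :
    fderiv ℝ (angForm χ) v a b - fderiv ℝ (angForm χ) v b a =
      angCurl (deriv χ) v * planeDet a b := by
  have hd : ∀ z, HasFDerivAt (angComp χ) (fderiv ℝ (angComp χ) z) z := fun z =>
    (hχ.contDiff_angComp.differentiable (by simp) z).hasFDerivAt
  let sw : Plane →L[ℝ] Plane :=
    (ContinuousLinearMap.snd ℝ ℝ ℝ).prod (ContinuousLinearMap.fst ℝ ℝ ℝ)
  have h1 : HasFDerivAt (fun z : Plane => angComp χ z.swap)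
      ((fderiv ℝ (angComp χ) v.swap).comp sw) v :=
    HasFDerivAt.comp (f := fun z : Plane => z.swap) v (hd v.swap) sw.hasFDerivAt
  have h2 := ((hd v).smul_const (ContinuousLinearMap.snd ℝ ℝ ℝ)).sub
    (h1.smul_const (ContinuousLinearMap.fst ℝ ℝ ℝ))
  have h3 : fderiv ℝ (angForm χ) v = _ := h2.fderiv
  have hexp : ∀ z a : Plane, fderiv ℝ (angComp χ) z a =
      fderiv ℝ (angComp χ) z (1, 0) * a.1 + fderiv ℝ (angComp χ) z (0, 1) * a.2 := by
    intro z a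
    have h5 : a = a.1 • ((1, 0) : Plane) + a.2 • ((0, 1) : Plane) := by ext <;> simp
    conv_lhs => rw [h5, map_add, map_smul, map_smul]
    simp [mul_comm]
  have e : ∀ a b : Plane, fderiv ℝ (angForm χ) v a b = fderiv ℝ (angComp χ) v a * b.2 -
      fderiv ℝ (angComp χ) v.swap a.swap * b.1 := by
    intro a b
    rw [h3]
    rfl
  have hR : radiusSq v.swap = radiusSq v := by simp [radiusSq, add_comm]
  have hQ : ∀ χ, radialQuot χ v.swap = radialQuot χ v := fun χ => by
    simp [radialQuot, radiusSq, latticeDist, add_comm]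
  rw [e, e, hexp v a, hexp v b, hexp v.swap a.swap, hexp v.swap b.swap, hχ.fderiv_angComp,
    hχ.fderiv_angComp, hR, hQ, hQ]
  simp only [Prod.fst_swap, Prod.snd_swap, planeDet, angCurl]
  ring

end Angular

/-! ### Exactness on loops avoiding a point -/

section Exactness

open Real

/-- A bump function supported in `[1 / 8, 3 / 8]`. -/
def radialBump : ContDiffBump (1 / 4 : ℝ) where
  rIn := 1 / 16
  rOut := 1 / 8
  rIn_pos := by norm_num
  rIn_lt_rOut := by norm_num

theorem radialBump_zero_of_le {t : ℝ} (ht : t ≤ 1 / 8) : radialBump t = 0 := by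
  refine radialBump.zero_of_le_dist ?_
  rw [Real.dist_eq, abs_of_nonpos (by linarith)]
  change (1 / 8 : ℝ) ≤ _
  linarith

theorem radialBump_zero_of_ge {t : ℝ} (ht : 3 / 8 ≤ t) : radialBump t = 0 := by
  refine radialBump.zero_of_le_dist ?_
  rw [Real.dist_eq, abs_of_nonneg (by linarith)]
  change (1 / 8 : ℝ) ≤ _
  linarith

theorem isCutoff_radialBump : IsCutoff radialBump where
  contDiff := radialBump.contDiff
  exists_zero := ⟨1 / 8, by norm_num, fun _ ht => radialBump_zero_of_le ht.le⟩
  zero t ht := radialBump_zero_of_ge (by linarith)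

/-- The primitive of the bump function that vanishes beyond `1 / 2`. -/
def bumpPrim (t : ℝ) : ℝ := ∫ r in (1 / 2 : ℝ)..t, radialBump r

theorem hasDerivAt_bumpPrim (t : ℝ) : HasDerivAt bumpPrim (radialBump t) t :=
  (radialBump.continuous.integral_hasStrictDerivAt (1 / 2) t).hasDerivAt

theorem contDiff_bumpPrim : ContDiff ℝ ∞ bumpPrim := by
  rw [contDiff_infty_iff_deriv]
  refine ⟨fun t => (hasDerivAt_bumpPrim t).differentiableAt, ?_⟩
  rw [show deriv bumpPrim = radialBump from funext fun t => (hasDerivAt_bumpPrim t).deriv]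
  exact radialBump.contDiff

theorem bumpPrim_zero {t : ℝ} (ht : 1 / 2 ≤ t) : bumpPrim t = 0 := by
  refine intervalIntegral.integral_zero_ae (Filter.Eventually.of_forall fun r hr => ?_)
  rw [uIoc_of_le ht] at hr
  exact radialBump_zero_of_ge (by linarith [hr.1])

/-- The primitive of the bump function, cut off near `0`. -/
def cutPrim (ε t : ℝ) : ℝ := bumpPrim t * smoothTransition (2 * t / ε - 1)

/-- The argument `2 t / ε - 1` makes the transition factor vanish for `t ≤ ε / 2` and equal one for
`t ≥ ε`. The factor is needed because `bumpPrim` does not vanish near `0`. -/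
theorem isCutoff_cutPrim {ε : ℝ} (hε : 0 < ε) : IsCutoff (cutPrim ε) where
  contDiff := by
    refine contDiff_bumpPrim.mul (smoothTransition.contDiff.comp ?_)
    fun_prop
  exists_zero := by
    refine ⟨ε / 2, by positivity, fun t ht => ?_⟩
    rw [cutPrim, smoothTransition.zero_of_nonpos, mul_zero]
    rw [sub_nonpos, div_le_one hε]
    linarith
  zero t ht := by rw [cutPrim, bumpPrim_zero ht, zero_mul]

theorem cutPrim_eq {ε t : ℝ} (hε : 0 < ε) (ht : ε ≤ t) : cutPrim ε t = bumpPrim t := by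
  rw [cutPrim, smoothTransition.one_of_one_le, mul_one]
  rw [le_sub_iff_add_le, le_div_iff₀ hε]
  linarith

theorem deriv_cutPrim {ε t : ℝ} (hε : 0 < ε) (ht : ε < t) :
    deriv (cutPrim ε) t = radialBump t := by
  have h : cutPrim ε =ᶠ[𝓝 t] bumpPrim := by
    filter_upwards [lt_mem_nhds ht] with r hr using cutPrim_eq hε hr.le
  rw [h.deriv_eq]
  exact (hasDerivAt_bumpPrim t).deriv

theorem angForm_congr {χ χ' : ℝ → ℝ} {v : Plane} (h : χ (latticeDist v) = χ' (latticeDist v)) :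
    angForm χ v = angForm χ' v := by
  have h' : latticeDist v.swap = latticeDist v := by simp [latticeDist, add_comm]
  simp only [angForm, angComp, radialQuot, h', h]

theorem angCurl_congr {χ χ' : ℝ → ℝ} {v : Plane} (h : χ (latticeDist v) = χ' (latticeDist v)) :
    angCurl χ v = angCurl χ' v := by
  simp only [angCurl, radialQuot, h]

/-- The curl of the angular form around the lattice translated by `p`. -/
def ringCurl (p v : Plane) : ℝ := angCurl radialBump (v - p)

theorem contDiff_ringCurl (p : Plane) : ContDiff ℝ ∞ (ringCurl p) :=
  isCutoff_radialBump.contDiff_angCurl.comp (contDiff_id.sub contDiff_const)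

theorem LatticePeriodic.comp_sub {F : Type*} {f : Plane → F} (hf : LatticePeriodic f) (p : Plane) :
    LatticePeriodic fun v => f (v - p) := fun v m n => by
  change f (v + ((m : ℝ), (n : ℝ)) - p) = f (v - p)
  rw [add_sub_right_comm]
  exact hf _ m n

theorem latticePeriodic_ringCurl (p : Plane) : LatticePeriodic (ringCurl p) :=
  (latticePeriodic_angCurl radialBump).comp_sub p

/-- For `latticeDist v < 1 / 2` both cosines are nonnegative, by `cos 2πx = 1 - 2 sin² πx`;
elsewhere the bump is zero. -/
theorem angCurl_radialBump_nonneg (v : Plane) : 0 ≤ angCurl radialBump v := by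
  by_cases h : latticeDist v < 1 / 2
  · have hc : ∀ x : ℝ, sin (π * x) ^ 2 < 1 / 2 → 0 ≤ cos (2 * π * x) := by
      intro x hx
      rw [mul_assoc, cos_two_mul, cos_sq']
      linarith
    unfold latticeDist at h
    have h1 := hc v.1 (by linarith [sq_nonneg (sin (π * v.2))])
    have h2 := hc v.2 (by linarith [sq_nonneg (sin (π * v.1))])
    have h3 : 0 ≤ radiusSq v := by unfold radiusSq; positivity
    have h4 : 0 ≤ radialBump (latticeDist v) := radialBump.nonneg
    unfold angCurl radialQuot
    positivity
  · rw [angCurl, radialQuot, radialBump_zero_of_ge (by linarith)]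
    simp

/-- The point is chosen because `sin² (π / 6) = 1 / 4` is the centre of the bump. -/
theorem angCurl_radialBump_pos : 0 < angCurl radialBump (1 / 6, 0) := by
  have h1 : latticeDist (1 / 6, 0) = 1 / 4 := by
    have : π * (1 / 6) = π / 6 := by ring
    simp only [latticeDist, this, sin_pi_div_six]
    norm_num
  have h2 : 0 < sin (2 * π * (1 / 6)) := by
    have : 2 * π * (1 / 6) = π / 3 := by ring
    rw [this, sin_pi_div_three]
    positivity
  have h3 : radialBump (1 / 4 : ℝ) = 1 :=
    radialBump.one_of_mem_closedBall (Metric.mem_closedBall_self radialBump.rIn_pos.le)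
  simp only [angCurl, radialQuot, h1, h3, radiusSq, mul_zero, sin_zero, cos_zero, mul_one, zero_mul,
    add_zero, ne_eq, OfNat.ofNat_ne_zero, not_false_eq_true, zero_pow]
  positivity

/-- Fractional parts move the point of positivity into the unit square. The integral of a
nonnegative continuous function that is somewhere positive is positive; this is used first along a
row and then across rows. -/
theorem yPrim_pos {h : Plane → ℝ} (hh : ContDiff ℝ ∞ h) (hper : LatticePeriodic h)
    (h0 : ∀ v, 0 ≤ h v) {v : Plane} (hv : 0 < h v) : 0 < yPrim h 1 := by
  have hx : ∀ y, 0 ≤ xPrim h (1, y) := fun y =>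
    intervalIntegral.integral_nonneg zero_le_one fun r _ => h0 _
  have hc : Continuous fun y => xPrim h (1, y) :=
    (contDiff_xPrim hh).continuous.comp (by fun_prop)
  have hhc := hh.continuous
  have hv' : 0 < h (Int.fract v.1, Int.fract v.2) := by
    have := hper v (-⌊v.1⌋) (-⌊v.2⌋)
    have e : v + (((-⌊v.1⌋ : ℤ) : ℝ), ((-⌊v.2⌋ : ℤ) : ℝ)) = (Int.fract v.1, Int.fract v.2) := by
      ext <;> simp [Int.fract, sub_eq_add_neg]
    rwa [← e, this]
  have hf : ∀ r : ℝ, Int.fract r ∈ Icc (0 : ℝ) 1 := fun r =>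
    ⟨Int.fract_nonneg r, (Int.fract_lt_one r).le⟩
  have h1 : 0 < xPrim h (1, Int.fract v.2) :=
    intervalIntegral.integral_pos zero_lt_one (by fun_prop) (fun r _ => h0 _) ⟨_, hf v.1, hv'⟩
  exact intervalIntegral.integral_pos zero_lt_one hc.continuousOn (fun r _ => hx r)
    ⟨_, hf v.2, h1⟩

theorem yPrim_ringCurl_pos (p : Plane) : 0 < yPrim (ringCurl p) 1 := by
  refine yPrim_pos (contDiff_ringCurl p) (latticePeriodic_ringCurl p)
    (fun v => angCurl_radialBump_nonneg _) (v := p + (1 / 6, 0)) ?_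
  rw [ringCurl, add_sub_cancel_left]
  exact angCurl_radialBump_pos

/-- The smooth angular form around the lattice translated by `p`. -/
def ringForm (p : Plane) {ε : ℝ} (hε : 0 < ε) : C(Plane, Plane →L[ℝ] ℝ) :=
  ⟨fun v => angForm (cutPrim ε) (v - p),
    (isCutoff_cutPrim hε).contDiff_angForm.continuous.comp (by fun_prop)⟩

theorem contDiff_ringForm (p : Plane) {ε : ℝ} (hε : 0 < ε) : ContDiff ℝ ∞ (ringForm p hε) :=
  (isCutoff_cutPrim hε).contDiff_angForm.comp (contDiff_id.sub contDiff_const)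

theorem fderiv_ringForm (p : Plane) {ε : ℝ} (hε : 0 < ε) (v a b : Plane) :
    fderiv ℝ (ringForm p hε) v a b - fderiv ℝ (ringForm p hε) v b a =
      angCurl (deriv (cutPrim ε)) (v - p) * planeDet a b := by
  have h : fderiv ℝ (ringForm p hε) v = fderiv ℝ (angForm (cutPrim ε)) (v - p) :=
    fderiv_comp_sub (f := angForm (cutPrim ε)) p
  rw [h]
  exact (isCutoff_cutPrim hε).fderiv_angForm _ _ _

/-- The integral of the singular angular form along a path. -/
def angInt (p : Plane) (w : PathData) : ℝ :=
  ∫ s : unitInterval, angForm bumpPrim (path w s - p) (w.2 ((s : ℝ) : UnitAddCircle))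

/-- At distance more than `ε` the cut-off is inactive, so the singular integral inherits smoothness
from the smooth one. -/
theorem angInt_eq (p : Plane) {ε : ℝ} (hε : 0 < ε) {w : PathData}
    (hw : ∀ s, ε < latticeDist (path w s - p)) : angInt p w = lineInt (ringForm p hε) w := by
  rw [lineInt_eq]
  refine integral_congr_ae (Filter.Eventually.of_forall fun s => ?_)
  change angForm bumpPrim (path w s - p) _ = angForm (cutPrim ε) (path w s - p) _
  rw [angForm_congr (cutPrim_eq hε (hw s).le).symm]

/-- Along lifts of loops avoiding the point, both functions are primitives of the same
transgression. For the angular form no boundary term survives, because it is lattice periodic and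
the variation closes up. -/
theorem fderiv_lineInt_ringForm (p : Plane) {ε : ℝ} (hε : 0 < ε) {γ : Loop} {w : PathData}
    (h : IsLift γ w) (hw : ∀ s, ε < latticeDist (path w s - p)) (e : LoopVec) :
    fderiv ℝ (lineInt (ringForm p hε)) w (liftL e) =
      fderiv ℝ (areaPot (ringCurl p) (contDiff_ringCurl p)) w (liftL e) := by
  obtain ⟨a, b, hab⟩ := h.exists_displacement
  rw [fderiv_lineInt_apply _ (contDiff_ringForm p hε) (fderiv_ringForm p hε),
    fderiv_areaPot _ (latticePeriodic_ringCurl p) w (liftL e) hab (prim_liftL e)]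
  have h1 : path (liftL e) 1 = path (liftL e) 0 := by
    rw [path_one, path_zero, prim_liftL, add_zero]
  have h2 : ringForm p hε (path w 1) = ringForm p hε (path w 0) := by
    rw [path_one, path_zero, hab]
    exact (latticePeriodic_angForm (cutPrim ε)).comp_sub p w.1 a b
  rw [h1, h2, sub_self, add_zero]
  refine integral_congr_ae (Filter.Eventually.of_forall fun s => ?_)
  change angCurl (deriv (cutPrim ε)) (path w s - p) * _ = angCurl radialBump (path w s - p) * _
  rw [angCurl_congr (deriv_cutPrim hε (hw s))]

theorem areaForm_coeff : areaForm.coeff = fun _ => 1 := by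
  funext v
  simp [TwoForm.coeff, areaForm, dq1, dq2]

theorem yPrim_areaForm : yPrim areaForm.coeff 1 = 1 := by
  simp [areaForm_coeff, yPrim, xPrim]

/-- The primitive of `tau` on the loops avoiding `proj p`, as a function of lifts. -/
def avoidingPot (p : Plane) (w : PathData) : ℝ :=
  areaForm.pot w + (yPrim (ringCurl p) 1)⁻¹ *
    (angInt p w - areaPot (ringCurl p) (contDiff_ringCurl p) w)

/-- With jump number `b m - a n`, the area potential jumps by it, `areaPot (ringCurl p)` by `yPrim
(ringCurl p) 1` times it, and `angInt` not at all. The normalising factor makes the jumps cancel. -/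
theorem avoidingPot_eq_of_isLift (p : Plane) {γ : Loop} {w w' : PathData} (h : IsLift γ w)
    (h' : IsLift γ w') : avoidingPot p w' = avoidingPot p w := by
  obtain ⟨a, b, hab⟩ := h.exists_displacement
  obtain ⟨m, n, rfl⟩ := h.eq_add h'
  have h1 := areaPot_add areaForm.contDiff_coeff areaForm.latticePeriodic_coeff w.1 w.2 hab m n
  have h2 := areaPot_add (contDiff_ringCurl p) (latticePeriodic_ringCurl p) w.1 w.2 hab m n
  have h3 : angInt p (w.1 + ((m : ℝ), (n : ℝ)), w.2) = angInt p w := by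
    refine integral_congr_ae (Filter.Eventually.of_forall fun s => ?_)
    have e : path (w.1 + ((m : ℝ), (n : ℝ)), w.2) s = path w s + ((m : ℝ), (n : ℝ)) := by
      rw [path_apply, path_apply]
      exact add_right_comm _ _ _
    change angForm bumpPrim (path (w.1 + ((m : ℝ), (n : ℝ)), w.2) s - p) _ = _
    rw [e]
    exact congrArg (fun ℓ : Plane →L[ℝ] ℝ => ℓ (w.2 ((s : ℝ) : UnitAddCircle)))
      ((latticePeriodic_angForm bumpPrim).comp_sub p (path w s) m n)
  have hC := (yPrim_ringCurl_pos p).ne'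
  rw [avoidingPot, avoidingPot, TwoForm.pot, h1, h2, h3, yPrim_areaForm]
  change areaPot areaForm.coeff _ w + _ + _ * (_ - (areaPot (ringCurl p) _ w + _)) = _
  field_simp
  ring

/-- The distance attains a minimum on the compact interval, positive since the loop misses the
point; half of it leaves a strict margin. -/
theorem exists_latticeDist_gt (p : Plane) {γ : Loop} {w : PathData} (h : IsLift γ w)
    (hγ : γ ∈ avoiding (proj p)) : ∃ ε > 0, ∀ s, ε < latticeDist (path w s - p) := by
  have hc : Continuous fun s => latticeDist (path w s - p) :=
    contDiff_latticeDist.continuous.comp ((path w).continuous.sub continuous_const)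
  obtain ⟨s₀, hs₀⟩ := hc.exists_forall_le_of_hasCompactSupport (HasCompactSupport.of_compactSpace _)
  have hpos : 0 < latticeDist (path w s₀ - p) := by
    refine lt_of_le_of_ne (latticeDist_nonneg _) fun h0 => ?_
    have h1 := proj_eq_zero_of_latticeDist h0.symm
    rw [map_sub, sub_eq_zero, h.proj_path] at h1
    exact (forall_curve_iff hγ.1 (· ≠ proj p)).1 hγ.2 _ h1
  exact ⟨_, half_pos hpos, fun s => (half_lt_self hpos).trans_le (hs₀ s)⟩

theorem eventually_latticeDist_gt (p : Plane) {ε : ℝ} {w : PathData}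
    (hw : ∀ s, ε < latticeDist (path w s - p)) :
    ∀ᶠ e in 𝓝 (0 : LoopVec), ∀ s, ε < latticeDist (path (w + liftL e) s - p) := by
  have ho : IsOpen {v : Plane | ε < latticeDist (v - p)} :=
    isOpen_lt continuous_const (contDiff_latticeDist.continuous.comp (by fun_prop))
  have ho' := ContinuousMap.isOpen_setOfPred_mapsTo (isCompact_univ (X := unitInterval)) ho
  have hc : Continuous fun e : LoopVec => path (w + liftL e) :=
    path.continuous.comp (continuous_const.add liftL.continuous)
  have h0 : path (w + liftL 0) ∈ {f : C(unitInterval, Plane) |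
      MapsTo f univ {v : Plane | ε < latticeDist (v - p)}} := by
    rw [map_zero, add_zero]
    exact fun s _ => hw s
  filter_upwards [hc.continuousAt.eventually (ho'.mem_nhds h0)] with e he s using he (mem_univ s)

theorem tau_exact_avoiding (q : Torus) : tau ∈ exactForms (avoiding q) := by
  obtain ⟨p, rfl⟩ := proj_surjective q
  refine hasTranslationCharts_freeExp.exact_of_primitive (fun γ => avoidingPot p (chosenLift γ))
    fun γ hγ => ?_
  have h := isLift_chosenLift γ
  set w := chosenLift γ
  obtain ⟨ε, hε, hw⟩ := exists_latticeDist_gt p h hγ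
  set C := yPrim (ringCurl p) 1
  -- Near this loop the singular integral is replaced by the smooth one with the margin `ε`, so `F`
  -- is smooth everywhere and agrees with `avoidingPot` on nearby lifts.
  let F : PathData → ℝ := fun w => areaForm.pot w + C⁻¹ *
    (lineInt (ringForm p hε) w - areaPot (ringCurl p) (contDiff_ringCurl p) w)
  have hL := contDiff_lineInt _ (contDiff_ringForm p hε)
  have hA := contDiff_areaPot (contDiff_ringCurl p)
  have hF : ContDiff ℝ ∞ F := areaForm.contDiff_pot.add (contDiff_const.mul (hL.sub hA))
  refine ⟨fun e => F (w + liftL e), (contDiff_add_liftL hF w).contDiffAt, ?_, ?_⟩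
  · filter_upwards [eventually_latticeDist_gt p hw] with e he
    change avoidingPot p (chosenLift (γ + freeExp e)) = F (w + liftL e)
    rw [avoidingPot_eq_of_isLift p (h.add e) (isLift_chosenLift _), avoidingPot, angInt_eq p hε he]
  · rw [fderiv_add_liftL (hF.differentiable (by simp) _), map_zero, add_zero]
    refine ContinuousLinearMap.ext fun e => ?_
    have d1 := (areaForm.contDiff_pot.differentiable (by simp) w).hasFDerivAt
    have d2 := (hL.differentiable (by simp) w).hasFDerivAt
    have d3 := (hA.differentiable (by simp) w).hasFDerivAt
    have d4 : fderiv ℝ F w = _ := (d1.add ((d2.sub d3).const_mul C⁻¹)).fderiv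
    have d5 : fderiv ℝ F w (liftL e) = fderiv ℝ areaForm.pot w (liftL e) + C⁻¹ *
        (fderiv ℝ (lineInt (ringForm p hε)) w (liftL e) -
          fderiv ℝ (areaPot (ringCurl p) (contDiff_ringCurl p)) w (liftL e)) := by
      rw [d4]
      rfl
    change tau γ e = fderiv ℝ F w (liftL e)
    rw [d5, fderiv_lineInt_ringForm p hε h hw, sub_self, mul_zero, add_zero, fderiv_pot _ h]
    rfl

end Exactness

end

end MagneticTorus

theorem lemma5p3 :
    -- `τ` is a closed 1-form on the free loop space `ℳ`
    tau ∈ closedForms freeLoops ∧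
    -- (i) the class of `τ` on the components `ℳ(a, b)`
    (∀ a b : ℤ,
      (∀ T : ℝ, 0 < T →
        ContMDiff 𝓘(ℝ, Plane) 𝓘(ℝ, LoopVec) ∞ (straight a b T) ∧
        (∀ q, straight a b T q ∈ component a b) ∧
        ∃ (h₁ : pullback (straight a b T) tau ∈ closedForms (univ : Set Torus))
          (h₂ : interiorProduct ((a : ℝ), (b : ℝ)) areaForm ∈ closedForms (univ : Set Torus))
          (h₃ : (b : ℝ) • dq1 - (a : ℝ) • dq2 ∈ closedForms (univ : Set Torus)),
          cohClass univ (pullback (straight a b T) tau) h₁ =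
              -cohClass univ (interiorProduct ((a : ℝ), (b : ℝ)) areaForm) h₂ ∧
          cohClass univ (pullback (straight a b T) tau) h₁ =
              cohClass univ ((b : ℝ) • dq1 - (a : ℝ) • dq2) h₃) ∧
      ∃ h : tau ∈ closedForms (component a b),
        cohClass (component a b) tau h = 0 ↔ (a, b) = (0, 0)) ∧
    -- (ii) the class of `τ` is trivial on the neighbourhoods `𝒱^γ` of loops avoiding a point `q`
    -- outside the image of `γ`
    (∀ γ ∈ freeLoops, (∃ q, ∀ t, Loop.curve γ t ≠ q) ∧
      ∀ q, (∀ t, Loop.curve γ t ≠ q) →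
        IsOpen (avoiding q) ∧
        (∀ (n : ℕ) (ψ : UnitAddCircle) (β : Loop), 0 < n → IsRotatedIterate γ n ψ β →
          β ∈ avoiding q) ∧
        ∃ h : tau ∈ closedForms (avoiding q), cohClass (avoiding q) tau h = 0) ∧
    -- the action 1-form: its class on `ℳ(a, b)` and its periods
    (∀ (g : TorusMetric) (σ : TwoForm) (k : ℝ), 0 < k →
      eta g σ k ∈ closedForms freeLoops ∧
      ∀ a b : ℤ,
        (∀ T : ℝ, 0 < T →
          ∃ (h₁ : pullback (straight a b T) (eta g σ k) ∈ closedForms (univ : Set Torus))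
            (h₂ : (b : ℝ) • dq1 - (a : ℝ) • dq2 ∈ closedForms (univ : Set Torus)),
            cohClass univ (pullback (straight a b T) (eta g σ k)) h₁ =
              σ.integral • cohClass univ ((b : ℝ) • dq1 - (a : ℝ) • dq2) h₂) ∧
        DiscreteTopology (periods (eta g σ k) (component a b))) := by
  have hτ : ∀ U : Set Loop, tau ∈ closedForms U := transgression_closed areaForm
  refine ⟨hτ _, fun a b => ⟨fun T hT => ?_, hτ _, ?_⟩, fun γ hγ => ⟨exists_notMem_curve hγ,
    fun q hq => ⟨isOpen_avoiding q, fun n ψ β hn hβ => rotatedIterate_mem_avoiding hγ hq hn hβ,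
      hτ _, (cohClass_eq_zero_iff _).2 (tau_exact_avoiding q)⟩⟩,
    fun g σ k _ => ⟨eta_closed g σ k, fun a b => ⟨fun T hT => ?_,
      periods_eta_discrete g σ k fun γ hγ => hγ.1⟩⟩⟩
  · have h₃ := straightForm_closed (b : ℝ) (a : ℝ)
    have h₁ : pullback (E := Plane) (straight a b T) tau ∈ closedForms (univ : Set Torus) := by
      rw [pullback_straight_tau]
      exact h₃
    have h₂ : interiorProduct ((a : ℝ), (b : ℝ)) areaForm ∈ closedForms (univ : Set Torus) := by
      rw [interiorProduct_areaForm]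
      exact neg_mem h₃
    refine ⟨fun q => (straight_hasMFDerivAt a b T q).1, straight_mem_component a b hT,
      h₁, h₂, h₃, ?_, ?_⟩
    · refine (cohClass_eq_iff h₁ (neg_mem h₂)).2 ?_
      rw [pullback_straight_tau, interiorProduct_areaForm, neg_neg, sub_self]
      exact zero_mem _
    · refine (cohClass_eq_iff h₁ h₃).2 ?_
      rw [pullback_straight_tau, sub_self]
      exact zero_mem _
  · exact (cohClass_eq_zero_iff _).trans (tau_exact_iff a b)
  · have h₂ := straightForm_closed (b : ℝ) (a : ℝ)
    exact ⟨pullback_eta_closed g σ k a b hT, h₂,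
      (cohClass_eq_iff _ (Submodule.smul_mem _ σ.integral h₂)).2 (pullback_eta_exact g σ k a b hT)⟩
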